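/- **Setting.** Let $m\ge 1$ and let $(X_j,d_j,\mu_j)$, $0\le j\le m$, be metric measure spaces, where $\mu_j$ is a positive measure on a $\sigma$-algebra containing the Borel sets of $X_j$, such that all balls have finite measure and every measurable set $A$ with $\mu_j(A)<\infty$ satisfies $\mu_j(A)=\sup\{\mu_j(K): K\subset A \text{ compact}\}=\inf\{\mu_j(U): U\supset A\text{ open}\}$. Let $\mathcal C_c(X_j)$ be the space of complex-valued continuous functions with compact support on $X_j$, and let $L^1_{\rm loc}(X_0)$ be the space of (a.e. classes of) measurable complex functions on $X_0$ that are integrable over every compact set. Let $\mathbf S=\{z\in\mathbb C:0<\operatorname{Re} z<1\}$ and $\overline{\mathbf S}=\{z\in\mathbb C:0\le\operatorname{Re} z\le 1\}$. For every $z\in\overline{\mathbf S}$ let $T_z$ be an $m$-linear operator on $\mathcal C_c(X_1)\times\cdots\times\mathcal C_c(X_m)$ with values in $L^1_{\rm loc}(X_0)$. Assume: * (analytic family) for all $(\varphi_1,\dots,\varphi_m)\in \mathcal C_c(X_1)\times\cdots\times\mathcal C_c(X_m)$ and every bounded measurable function $w$ with compact support on $X_0$, the map $z\mapsto\int_{X_0}T_z(\varphi_1,\dots,\varphi_m)\,w\,d\mu_0$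 is analytic in $\mathbf S$ and continuous on $\overline{\mathbf S}$; * (admissible growth) there are $\gamma\in[0,\pi)$ and $s\in[1,\infty]$ such that for all $(\varphi_1,\dots,\varphi_m)$ as above and every compact $K\subset X_0$ there is a constant $C=C(\varphi_1,\dots,\varphi_m,K)$ with $$\log\|T_z(\varphi_1,\dots,\varphi_m)\|_{L^s(K,\mu_0)}\le C\,e^{\gamma|\operatorname{Im}z|}\qquad\text{for all } z\in\overline{\mathbf S}\quad(\log 0=-\infty).$$ **Theorem.** Let $0<p_0^\kappa,p_1^\kappa\le\infty$ for $1\le\kappa\le m$, let $0<q_0,q_1\le\infty$ and $0<\theta<1$, and define $p^\kappa,q\in(0,\infty]$ by $$\frac1{p^\kappa}=\frac{1-\theta}{p_0^\kappa}+\frac{\theta}{p_1^\kappa},\qquad \frac1q=\frac{1-\theta}{q_0}+\frac{\theta}{q_1}.$$ Suppose that for all $(f^1,\dots,f^m)\in\mathcal C_c(X_1)\times\cdots\times\mathcal C_c(X_m)$ and all $y\in\mathbb R$ $$\|T_{iy}(f^1,\dots,f^m)\|_{L^{q_0}(X_0)}\le B_0M_0(y)\prod_{\kappa=1}^m\|f^\kappa\|_{L^{p_0^\kappa}(X_\kappa)},\qquad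 \|T_{1+iy}(f^1,\dots,f^m)\|_{L^{q_1}(X_0)}\le B_1M_1(y)\prod_{\kappa=1}^m\|f^\kappa\|_{L^{p_1^\kappa}(X_\kappa)},$$ where $B_0,B_1>0$ and $M_0,M_1$ are nonnegative continuous functions on $\mathbb R$ such that, for some $c\ge0$ and $0\le\tau<\pi$, $M_0(y)\le e^{c\,e^{\tau|y|}}$ and $M_1(y)\le e^{c\,e^{\tau|y|}}$ for all $y\in\mathbb R$. Put $$\Omega(x,y)=\frac12\,\frac{\sin(\pi x)}{\cosh(\pi y)+\cos(\pi x)},\qquad M(\theta)=\exp\left\{\int_{-\infty}^{\infty}\big[\Omega(1-\theta,y)\log M_0(y)+\Omega(\theta,y)\log M_1(y)\big]\,dy\right\},$$ where the integral (that of the positive part minus that of the negative part) may take the value $-\infty$, and $\log 0=-\infty$, $\exp(-\infty)=0$. Then $M(\theta)<\infty$, and for all $(f^1,\dots,f^m)\in\mathcal C_c(X_1)\times\cdots\times\mathcal C_c(X_m)$ $$\|T_\theta(f^1,\dots,f^m)\|_{L^q(X_0)}\le B_0^{1-\theta}B_1^{\theta}\,M(\theta)\prod_{\kappa=1}^m\|f^\kappa\|_{L^{p^\kappa}(X_\kappa)}.$$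 -/

import Mathlib

open MeasureTheory Set
open scoped ENNReal CompactlySupported

noncomputable section

/-- The standing assumptions on a metric measure space `(X, d, μ)`: balls have finite measure, and
every measurable set of finite measure is approximated from inside by compact sets and from outside
by open sets. The σ-algebra of `X` may be any σ-algebra containing the Borel sets. -/
structure IsRegularMetricMeasure {X : Type*} [MetricSpace X] [MeasurableSpace X]
    (μ : Measure X) : Prop where
  ball_lt_top : ∀ (x : X) (r : ℝ), μ (Metric.ball x r) < ∞
  inner_regular : ∀ A : Set X, MeasurableSet A → μ A < ∞ →
    μ A = ⨆ (K : Set X) (_ : K ⊆ A) (_ : IsCompact K), μ K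
  outer_regular : ∀ A : Set X, MeasurableSet A → μ A < ∞ →
    μ A = ⨅ (U : Set X) (_ : A ⊆ U) (_ : IsOpen U), μ U

/-- The space `L¹_loc(X)` of (a.e. classes of) measurable complex functions which are integrable on
every compact set. -/
def L1loc {X : Type*} [TopologicalSpace X] [MeasurableSpace X] (μ : Measure X) :
    Submodule ℂ (X →ₘ[μ] ℂ) where
  carrier := {f | ∀ K : Set X, IsCompact K → IntegrableOn f K μ}
  zero_mem' := fun K _ =>
    (integrable_zero X ℂ (μ.restrict K)).congr
      (ae_restrict_of_ae (AEEqFun.coeFn_zero (μ := μ) (β := ℂ)).symm)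
  add_mem' := fun {f g} hf hg K hK =>
    ((hf K hK).add (hg K hK)).congr (ae_restrict_of_ae (AEEqFun.coeFn_add f g).symm)
  smul_mem' := fun c f hf K hK =>
    ((hf K hK).smul c).congr (ae_restrict_of_ae (AEEqFun.coeFn_smul c f).symm)

/-- The open unit strip `0 < Re z < 1`. -/
def openStrip : Set ℂ := {z | 0 < z.re ∧ z.re < 1}

/-- The closed unit strip `0 ≤ Re z ≤ 1`. -/
def closedStrip : Set ℂ := {z | 0 ≤ z.re ∧ z.re ≤ 1}

section Families

variable {m : ℕ} {X₀ : Type*} {X : Fin m → Type*}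
  [MetricSpace X₀] [MeasurableSpace X₀] [∀ κ, MetricSpace (X κ)]

/-- `(T_z)` is an analytic family: for all `φ^κ ∈ C_c(X_κ)` and all bounded measurable functions `w`
with compact support in `X₀`, the map `z ↦ ∫ T_z(φ¹,…,φᵐ) w dμ₀` is analytic in the open strip and
continuous on the closed strip. Only the operators `T_z` with `z` in the closed strip matter. -/
def IsAnalyticFamily (μ₀ : Measure X₀)
    (T : ℂ → MultilinearMap ℂ (fun κ => C_c(X κ, ℂ)) (L1loc μ₀)) : Prop :=
  ∀ (φ : ∀ κ, C_c(X κ, ℂ)) (w : X₀ → ℂ), Measurable w → (∃ R : ℝ, ∀ x, ‖w x‖ ≤ R) →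
    HasCompactSupport w →
    DifferentiableOn ℂ (fun z => ∫ x, (T z φ : X₀ →ₘ[μ₀] ℂ) x * w x ∂μ₀) openStrip ∧
    ContinuousOn (fun z => ∫ x, (T z φ : X₀ →ₘ[μ₀] ℂ) x * w x ∂μ₀) closedStrip

/-- `(T_z)` is of admissible growth: there are `0 ≤ γ < π` and `1 ≤ s ≤ ∞` such that for all
`φ^κ ∈ C_c(X_κ)` and all compact `K ⊆ X₀` there is a constant `C` with
`log ‖T_z(φ¹,…,φᵐ)‖_{L^s(K)} ≤ C exp(γ |Im z|)` on the closed strip, where `log 0 = -∞`. -/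
def IsOfAdmissibleGrowth (μ₀ : Measure X₀)
    (T : ℂ → MultilinearMap ℂ (fun κ => C_c(X κ, ℂ)) (L1loc μ₀)) : Prop :=
  ∃ γ : ℝ, 0 ≤ γ ∧ γ < Real.pi ∧ ∃ s : ℝ≥0∞, 1 ≤ s ∧
    ∀ (φ : ∀ κ, C_c(X κ, ℂ)) (K : Set X₀), IsCompact K → ∃ C : ℝ, ∀ z ∈ closedStrip,
      ENNReal.log (eLpNorm (T z φ : X₀ →ₘ[μ₀] ℂ) s (μ₀.restrict K)) ≤
        ((C * Real.exp (γ * |z.im|) : ℝ) : EReal)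

end Families

/-- The half Poisson kernel of the unit strip,
`Ω(x, y) = (1/2) sin(πx) / (cosh(πy) + cos(πx))`. -/
def stripKernel (x y : ℝ) : ℝ :=
  1 / 2 * (Real.sin (Real.pi * x) / (Real.cosh (Real.pi * y) + Real.cos (Real.pi * x)))

/-- The integral over the real line of an extended real function, as the integral of the positive
part minus the integral of the negative part. -/
def lineIntegralEReal (h : ℝ → EReal) : EReal :=
  ((∫⁻ y, (h y).toENNReal : ℝ≥0∞) : EReal) - ((∫⁻ y, (-h y).toENNReal : ℝ≥0∞) : EReal)

/-- `M(θ) = exp ∫ [Ω(1-θ, y) log M₀(y) + Ω(θ, y) log M₁(y)] dy` with the conventions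
`log 0 = -∞` and `exp(-∞) = 0`. -/
def stripMean (M₀ M₁ : ℝ → ℝ) (θ : ℝ) : ℝ≥0∞ :=
  EReal.exp (lineIntegralEReal fun y =>
    (stripKernel (1 - θ) y : EReal) * ENNReal.log (ENNReal.ofReal (M₀ y)) +
      (stripKernel θ y : EReal) * ENNReal.log (ENNReal.ofReal (M₁ y)))

end

/-! The exponents $q_0,q_1,q$ may be less than $1$, so $T_zf$ cannot be tested against a dual space.
The interpolation is made pointwise in the target space instead. For a scalar analytic function $F$
of admissible growth on the strip, Hirschman's lemma (`log_norm_le_integral_stripKernel`) bounds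
$\log|F(\theta)|$ by the Poisson integrals of $\log|F|$ over the two edges. When $F$ depends on a
further point $k$, exponentiation turns the right side into a geometric mean of the boundary
functions of $k$. By Jensen's inequality for $\exp$, a geometric mean of functions in the unit ball
of $L^r$ stays in that ball for every $0<r\le\infty$, and Hölder's inequality joins the two edges
(`eLpNorm_exp_integral_stripKernel_le`).

The values $T_zf$ are only classes of functions, analytic after integration against bounded
functions of compact support, so they cannot be evaluated at points. On a compact set $K$ they are
replaced by their averages over the cells of a countable partition. Each average is a scalar
analytic function, and the index set of the cells, with the image measure, is the countable space to
which the pointwise argument applies (`eLpNorm_cellAverage_le_exp`). The averages converge in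
$L^1(K)$ along a sequence of partitions, and Fatou's lemma along an a.e. convergent subsequence
gives the bound on $K$ (`IsWeaklyAnalytic.eLpNorm_restrict_le`). Regularity of $\mu_0$ then gives it
on all of $X_0$.

To change the exponents of the arguments, each $f^\kappa$ is put into a family $f^\kappa_z=\sum_j
a_j(z)\varphi_j$ in $C_c$ with $f^\kappa_\theta=f^\kappa$ and $|f^\kappa_z|$ at most about
$|f^\kappa|^{p^\kappa/p^\kappa_0}$ on the left edge and $|f^\kappa|^{p^\kappa/p^\kappa_1}$ on the
right edge (`exists_analytic_deformation`). By multilinearity $T_z(f_z)$ is a finite sum of analytic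
coefficients times $T_z(\varphi)$, hence again weakly analytic and of admissible growth
(`eLpNorm_le_mul_stripMean`). At the end the error $\varepsilon$ of the deformation tends to $0$.
All logarithms are truncated from below, and monotone convergence removes the truncation of
$M_0,M_1$. -/

/-! ### Jensen's inequality on the disc. -/

/-- The logarithm of the modulus of an analytic function is bounded at the centre of a disc by its
average over the boundary circle, also after truncation from below. -/
theorem log_norm_le_circleAverage_log_max {f : ℂ → ℂ} {R δ : ℝ} (hR : 0 < R) (hδ : 0 < δ)
    (hf : AnalyticOnNhd ℂ f (Metric.closedBall 0 R)) (h0 : f 0 ≠ 0) :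
    Real.log ‖f 0‖ ≤ Real.circleAverage (fun z => Real.log (max ‖f z‖ δ)) 0 R := by
  have hJ := AnalyticOnNhd.circleAverage_log_norm (c := 0) (f := f) hR.ne'
    (by rwa [abs_of_pos hR]) h0
  have hsub : Metric.sphere (0 : ℂ) |R| ⊆ Metric.closedBall 0 R := by
    rw [abs_of_pos hR]; exact Metric.sphere_subset_closedBall
  have h1 : Real.log ‖f 0‖ ≤ Real.circleAverage (fun z => Real.log ‖f z‖) 0 R := by
    rw [hJ]
    refine le_add_of_nonneg_left (finsum_nonneg fun u => ?_)
    by_cases hu : u ∈ Metric.closedBall (0 : ℂ) |R|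
    · refine mul_nonneg ?_ ?_
      · rw [abs_of_pos hR]
        exact_mod_cast MeromorphicOn.AnalyticOnNhd.divisor_nonneg hf u
      · rw [abs_of_pos hR, mem_closedBall_zero_iff] at hu
        rcases eq_or_ne u 0 with rfl | hu0
        -- At the centre $\|0-u\|^{-1}=0$ by convention, so the logarithm is `Real.log 0 = 0`.
        · simp
        · refine Real.log_nonneg ?_
          rw [zero_sub, norm_neg, ← div_eq_mul_inv]
          exact (one_le_div (norm_pos_iff.2 hu0)).2 hu
    · rw [Function.locallyFinsuppWithin.apply_eq_zero_of_notMem _ hu]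
      simp
  have hcont : ContinuousOn (fun z => Real.log (max ‖f z‖ δ)) (Metric.sphere (0 : ℂ) |R|) := by
    refine ContinuousOn.log ?_ fun z _ => (lt_max_of_lt_right hδ).ne'
    exact ((hf.continuousOn.mono hsub).norm).sup continuousOn_const
  have hmer := (hf.mono hsub).meromorphicOn.circleIntegrable_log_norm
  have hci : CircleIntegrable (fun z => Real.log (max ‖f z‖ δ)) 0 R := by
    rw [abs_of_pos hR] at hcont
    exact hcont.circleIntegrable hR.le
  have hne : ∀ᶠ z in Filter.codiscreteWithin (Metric.sphere (0 : ℂ) |R|), f z ≠ 0 := by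
    refine Filter.codiscreteWithin_mono hsub ?_
    rcases hf.eqOn_zero_or_eventually_ne_zero_of_preconnected
      (convex_closedBall (0 : ℂ) R).isPreconnected with h | h
    · exact absurd (h (Metric.mem_closedBall_self hR.le)) h0
    · exact h
  -- At a zero of `f` the convention `Real.log 0 = 0` can exceed `Real.log δ` and spoil the
  -- pointwise comparison. The value is changed there, which does not affect the average since the
  -- zeros are isolated.
  have heq : (fun z => Real.log ‖f z‖) =ᶠ[Filter.codiscreteWithin (Metric.sphere (0 : ℂ) |R|)]
      fun z => if f z = 0 then Real.log δ else Real.log ‖f z‖ := by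
    filter_upwards [hne] with z hz
    simp [hz]
  rw [Real.circleAverage_congr_codiscreteWithin heq hR.ne'] at h1
  refine h1.trans (Real.circleAverage_mono (hmer.congr_codiscreteWithin heq) hci fun z _ => ?_)
  split_ifs with hz
  · exact Real.log_le_log hδ (le_max_right _ _)
  · exact Real.log_le_log (norm_pos_iff.2 hz) (le_max_left _ _)

theorem abs_log_max_le {a δ C : ℝ} (hδ : 0 < δ) (hC : a ≤ C) :
    |Real.log (max a δ)| ≤ |Real.log δ| + |Real.log (max C δ)| := by
  have h1 : Real.log δ ≤ Real.log (max a δ) := Real.log_le_log hδ (le_max_right _ _)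
  have h2 : Real.log (max a δ) ≤ Real.log (max C δ) :=
    Real.log_le_log (lt_max_of_lt_right hδ) (max_le_max hC le_rfl)
  rw [abs_le]
  constructor
  · linarith [neg_abs_le (Real.log δ), abs_nonneg (Real.log (max C δ))]
  · linarith [le_abs_self (Real.log (max C δ)), abs_nonneg (Real.log δ)]

/-- Let $R\to1$ in the inequality on circles. Boundedness of `f` and truncation at `δ` give a
constant majorant, so almost everywhere radial convergence suffices. -/
theorem log_norm_le_integral_boundary {f : ℂ → ℂ} {g : ℝ → ℝ} {C δ : ℝ} (hδ : 0 < δ)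
    (hf : DifferentiableOn ℂ f (Metric.ball 0 1)) (hC : ∀ z ∈ Metric.ball (0 : ℂ) 1, ‖f z‖ ≤ C)
    (h0 : f 0 ≠ 0)
    (hg : ∀ᵐ t : ℝ, t ∈ Ioo 0 (2 * Real.pi) →
      Filter.Tendsto (fun R : ℝ => ‖f (circleMap 0 R t)‖) (nhdsWithin 1 (Iio 1)) (nhds (g t))) :
    Real.log ‖f 0‖ ≤ (2 * Real.pi)⁻¹ * ∫ t in Ioo 0 (2 * Real.pi), Real.log (max (g t) δ) := by
  have hpi := Real.two_pi_pos
  have hev : ∀ᶠ R : ℝ in nhdsWithin 1 (Iio 1), R ∈ Ioo (0 : ℝ) 1 :=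
    Ioo_mem_nhdsLT one_pos
  have hmem : ∀ R ∈ Ioo (0 : ℝ) 1, ∀ t, circleMap 0 R t ∈ Metric.ball (0 : ℂ) 1 := by
    intro R hR t
    simpa [abs_of_pos hR.1] using hR.2
  have hlim : Filter.Tendsto
      (fun R : ℝ => ∫ t in (0 : ℝ)..2 * Real.pi, Real.log (max ‖f (circleMap 0 R t)‖ δ))
      (nhdsWithin 1 (Iio 1)) (nhds (∫ t in (0 : ℝ)..2 * Real.pi, Real.log (max (g t) δ))) := by
    refine intervalIntegral.tendsto_integral_filter_of_dominated_convergence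
      (fun _ => |Real.log δ| + |Real.log (max C δ)|) ?_ ?_ ?_ ?_
    · filter_upwards [hev] with R hR
      refine Continuous.aestronglyMeasurable ?_
      refine Continuous.log ?_ fun t => (lt_max_of_lt_right hδ).ne'
      refine Continuous.max ?_ continuous_const
      exact (hf.continuousOn.comp_continuous (continuous_circleMap 0 R) (hmem R hR)).norm
    · filter_upwards [hev] with R hR
      exact Filter.Eventually.of_forall fun t _ => abs_log_max_le hδ (hC _ (hmem R hR t))
    · exact intervalIntegrable_const
    · have hne : ∀ᵐ t : ℝ, t ≠ 2 * Real.pi := by simp [ae_iff]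
      filter_upwards [hg, hne] with t ht hne htI
      rw [uIoc_of_le hpi.le] at htI
      refine Filter.Tendsto.log ?_ (lt_max_of_lt_right hδ).ne'
      exact (ht ⟨htI.1, lt_of_le_of_ne htI.2 hne⟩).max tendsto_const_nhds
  rw [← integral_Ioc_eq_integral_Ioo, ← intervalIntegral.integral_of_le hpi.le]
  refine ge_of_tendsto (hlim.const_mul (2 * Real.pi)⁻¹) ?_
  filter_upwards [hev] with R hR
  refine log_norm_le_circleAverage_log_max hR.1 hδ ?_ h0
  exact (hf.analyticOnNhd Metric.isOpen_ball).mono (Metric.closedBall_subset_ball hR.2)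

/-! ### The boundary correspondence between the circle and the strip, with the Poisson kernel as
Jacobian. -/

theorem sin_pi_mul_pos {θ : ℝ} (h0 : 0 < θ) (h1 : θ < 1) : 0 < Real.sin (Real.pi * θ) :=
  Real.sin_pos_of_pos_of_lt_pi (by positivity) (by nlinarith [Real.pi_pos])

/-- The angle of the point of the unit circle that the conformal map `discToStrip θ` sends to
`y * I` (for `σ = 1`) or to `1 + y * I` (for `σ = -1`). -/
noncomputable def boundaryAngle (θ σ y : ℝ) : ℝ :=
  Real.pi + 2 * Real.arctan
    ((σ * Real.exp (-(Real.pi * y)) - Real.cos (Real.pi * θ)) / Real.sin (Real.pi * θ))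

theorem boundaryAngle_mem (θ σ y : ℝ) : boundaryAngle θ σ y ∈ Ioo 0 (2 * Real.pi) := by
  have h1 := Real.arctan_lt_pi_div_two
    ((σ * Real.exp (-(Real.pi * y)) - Real.cos (Real.pi * θ)) / Real.sin (Real.pi * θ))
  have h2 := Real.neg_pi_div_two_lt_arctan
    ((σ * Real.exp (-(Real.pi * y)) - Real.cos (Real.pi * θ)) / Real.sin (Real.pi * θ))
  constructor <;> unfold boundaryAngle <;> linarith

/-- With `σ = τ` this gives injectivity on one edge; with opposite signs it shows that the two edges
correspond to disjoint sets of angles. -/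
theorem boundaryAngle_inj {θ σ τ y z : ℝ} (h0 : 0 < θ) (h1 : θ < 1)
    (h : boundaryAngle θ σ y = boundaryAngle θ τ z) :
    σ * Real.exp (-(Real.pi * y)) = τ * Real.exp (-(Real.pi * z)) := by
  have hs := sin_pi_mul_pos h0 h1
  unfold boundaryAngle at h
  have h2 := Real.arctan_injective (mul_left_cancel₀ two_ne_zero (add_left_cancel h))
  rw [div_left_inj' hs.ne'] at h2
  linarith

theorem injective_boundaryAngle {θ σ : ℝ} (h0 : 0 < θ) (h1 : θ < 1) (hσ : σ ≠ 0) :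
    Function.Injective (boundaryAngle θ σ) := by
  intro y z h
  have h2 := Real.exp_injective (mul_left_cancel₀ hσ (boundaryAngle_inj h0 h1 h))
  have := Real.pi_pos
  exact mul_left_cancel₀ this.ne' (by linarith)

theorem continuous_boundaryAngle (θ σ : ℝ) : Continuous (boundaryAngle θ σ) := by
  unfold boundaryAngle
  fun_prop

theorem measurableSet_range_boundaryAngle {θ σ : ℝ} (h0 : 0 < θ) (h1 : θ < 1) (hσ : σ ≠ 0) :
    MeasurableSet (range (boundaryAngle θ σ)) :=
  ((continuous_boundaryAngle θ σ).measurableEmbedding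
    (injective_boundaryAngle h0 h1 hσ)).measurableSet_range

theorem disjoint_range_boundaryAngle {θ : ℝ} (h0 : 0 < θ) (h1 : θ < 1) :
    Disjoint (range (boundaryAngle θ 1)) (range (boundaryAngle θ (-1))) := by
  rw [Set.disjoint_left]
  rintro _ ⟨y, rfl⟩ ⟨z, hz⟩
  have := boundaryAngle_inj h0 h1 hz
  have h2 := Real.exp_pos (-(Real.pi * y))
  have h3 := Real.exp_pos (-(Real.pi * z))
  linarith

/-- Only one angle in the open interval is missed, namely that of the circle point corresponding to
the upper end of the strip. The lower end corresponds to the angle $0$, which is already excluded.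
-/
theorem ae_mem_range_boundaryAngle {θ : ℝ} (h0 : 0 < θ) (h1 : θ < 1) :
    ∀ᵐ t : ℝ, t ∈ Ioo 0 (2 * Real.pi) →
      t ∈ range (boundaryAngle θ 1) ∪ range (boundaryAngle θ (-1)) := by
  have hs := sin_pi_mul_pos h0 h1
  have hne : ∀ᵐ t : ℝ, t ≠ Real.pi + 2 * Real.arctan
      (-Real.cos (Real.pi * θ) / Real.sin (Real.pi * θ)) := by simp [ae_iff]
  filter_upwards [hne] with t hne ht
  have hpi := Real.pi_pos
  have hat : Real.arctan (Real.tan ((t - Real.pi) / 2)) = (t - Real.pi) / 2 :=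
    Real.arctan_tan (by linarith [ht.1]) (by linarith [ht.2])
  -- This is the value that $\sigma e^{-\pi y}$ must take; its sign selects the edge.
  set s := Real.sin (Real.pi * θ) * Real.tan ((t - Real.pi) / 2) + Real.cos (Real.pi * θ) with hsdef
  have key : ∀ σ : ℝ, σ ^ 2 = 1 → 0 < σ * s → t ∈ range (boundaryAngle θ σ) := by
    intro σ hσ hpos
    refine ⟨-(Real.log (σ * s)) / Real.pi, ?_⟩
    unfold boundaryAngle
    have e1 : -(Real.pi * (-(Real.log (σ * s)) / Real.pi)) = Real.log (σ * s) := by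
      field_simp
    have e2 : (σ * (σ * s) - Real.cos (Real.pi * θ)) / Real.sin (Real.pi * θ)
        = Real.tan ((t - Real.pi) / 2) := by
      rw [← mul_assoc, ← sq, hσ, hsdef]
      field_simp
      ring
    rw [e1, Real.exp_log hpos, e2, hat]
    ring
  rcases lt_trichotomy s 0 with h | h | h
  · exact Or.inr (key (-1) (by norm_num) (by linarith))
  · exfalso
    apply hne
    have : -Real.cos (Real.pi * θ) / Real.sin (Real.pi * θ) = Real.tan ((t - Real.pi) / 2) := by
      rw [div_eq_iff hs.ne']; linarith
    rw [this, hat]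
    ring
  · exact Or.inl (key 1 (by norm_num) (by linarith))

theorem hasDerivAt_boundaryAngle (θ σ y : ℝ) :
    HasDerivAt (boundaryAngle θ σ)
      (2 * (1 / (1 + ((σ * Real.exp (-(Real.pi * y)) - Real.cos (Real.pi * θ)) /
        Real.sin (Real.pi * θ)) ^ 2) * (σ * (Real.exp (-(Real.pi * y)) * -Real.pi) /
        Real.sin (Real.pi * θ)))) y := by
  unfold boundaryAngle
  have h1 : HasDerivAt (fun y : ℝ => -(Real.pi * y)) (-Real.pi) y := by
    simpa using (hasDerivAt_id y).const_mul (-Real.pi)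
  exact (((((h1.exp).const_mul σ).sub_const (Real.cos (Real.pi * θ))).div_const
    (Real.sin (Real.pi * θ))).arctan.const_mul 2).const_add Real.pi

/-- The substitution from angles to edge points has Jacobian $2\pi$ times the Poisson kernel. With
$e=e^{-\pi y}$, $a=\cos\pi\theta$, $b=\sin\pi\theta$, the relations $a^2+b^2=1$ and $\sigma^2=1$
give $b^2+(\sigma e-a)^2=e\,(e+e^{-1}-2\sigma a)$. The case $\sigma=1$ is the kernel at $1-\theta$,
since $\cos\pi(1-\theta)=-a$. -/
theorem abs_deriv_boundaryAngle {θ σ : ℝ} (h0 : 0 < θ) (h1 : θ < 1) (hσ : σ = 1 ∨ σ = -1) (y : ℝ) :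
    |2 * (1 / (1 + ((σ * Real.exp (-(Real.pi * y)) - Real.cos (Real.pi * θ)) /
        Real.sin (Real.pi * θ)) ^ 2) * (σ * (Real.exp (-(Real.pi * y)) * -Real.pi) /
        Real.sin (Real.pi * θ)))| =
      2 * Real.pi * (1 / 2 * (Real.sin (Real.pi * θ) /
        (Real.cosh (Real.pi * y) - σ * Real.cos (Real.pi * θ)))) := by
  have hs := sin_pi_mul_pos h0 h1
  have hsc := Real.sin_sq_add_cos_sq (Real.pi * θ)
  rw [Real.cosh_eq]
  have he' : Real.exp (Real.pi * y) = (Real.exp (-(Real.pi * y)))⁻¹ := by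
    rw [Real.exp_neg, inv_inv]
  rw [he']
  have he := Real.exp_pos (-(Real.pi * y))
  set e := Real.exp (-(Real.pi * y))
  set a := Real.cos (Real.pi * θ)
  set b := Real.sin (Real.pi * θ)
  have hpi := Real.pi_pos
  have hσ2 : σ ^ 2 = 1 := by rcases hσ with rfl | rfl <;> norm_num
  have hσa : |σ| = 1 := by rcases hσ with rfl | rfl <;> norm_num
  have hden : 0 < b ^ 2 + (σ * e - a) ^ 2 := by positivity
  have hden2 : b ^ 2 + (σ * e - a) ^ 2 = e * (e⁻¹ + e - 2 * (σ * a)) := by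
    field_simp
    linear_combination hsc + e ^ 2 * hσ2
  have hden3 : 0 < e⁻¹ + e - 2 * (σ * a) := by
    rw [hden2] at hden
    exact pos_of_mul_pos_right hden he.le
  have e1 : 2 * (1 / (1 + ((σ * e - a) / b) ^ 2) * (σ * (e * -Real.pi) / b)) =
      σ * -(2 * Real.pi * (b / (e⁻¹ + e - 2 * (σ * a)))) := by
    have : 1 + ((σ * e - a) / b) ^ 2 = e * (e⁻¹ + e - 2 * (σ * a)) / b ^ 2 := by
      rw [← hden2]; field_simp
    rw [this]
    generalize e⁻¹ + e - 2 * (σ * a) = D at hden3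
    field_simp
  rw [e1, abs_mul, hσa, one_mul, abs_neg, abs_of_pos (by positivity)]
  have : (e⁻¹ + e) / 2 - σ * a = (e⁻¹ + e - 2 * (σ * a)) / 2 := by ring
  rw [this]
  generalize e⁻¹ + e - 2 * (σ * a) = D at hden3
  field_simp

theorem abs_deriv_boundaryAngle_one {θ : ℝ} (h0 : 0 < θ) (h1 : θ < 1) (y : ℝ) :
    |2 * (1 / (1 + ((1 * Real.exp (-(Real.pi * y)) - Real.cos (Real.pi * θ)) /
        Real.sin (Real.pi * θ)) ^ 2) * (1 * (Real.exp (-(Real.pi * y)) * -Real.pi) /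
        Real.sin (Real.pi * θ)))| = 2 * Real.pi * stripKernel (1 - θ) y := by
  rw [abs_deriv_boundaryAngle h0 h1 (Or.inl rfl)]
  have : Real.pi * (1 - θ) = Real.pi - Real.pi * θ := by ring
  rw [stripKernel, this, Real.sin_pi_sub, Real.cos_pi_sub]
  ring_nf

theorem abs_deriv_boundaryAngle_neg_one {θ : ℝ} (h0 : 0 < θ) (h1 : θ < 1) (y : ℝ) :
    |2 * (1 / (1 + ((-1 * Real.exp (-(Real.pi * y)) - Real.cos (Real.pi * θ)) /
        Real.sin (Real.pi * θ)) ^ 2) * (-1 * (Real.exp (-(Real.pi * y)) * -Real.pi) /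
        Real.sin (Real.pi * θ)))| = 2 * Real.pi * stripKernel θ y := by
  rw [abs_deriv_boundaryAngle h0 h1 (Or.inr rfl), stripKernel]
  ring_nf

theorem integral_range_boundaryAngle_one {θ : ℝ} (h0 : 0 < θ) (h1 : θ < 1) (h : ℝ → ℝ) :
    ∫ t in range (boundaryAngle θ 1), h t =
      2 * Real.pi * ∫ y, stripKernel (1 - θ) y * h (boundaryAngle θ 1 y) := by
  rw [← image_univ, integral_image_eq_integral_abs_deriv_smul MeasurableSet.univ
    (fun y _ => (hasDerivAt_boundaryAngle θ 1 y).hasDerivWithinAt)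
    (injective_boundaryAngle h0 h1 one_ne_zero).injOn, setIntegral_univ, ← integral_const_mul]
  simp only [abs_deriv_boundaryAngle_one h0 h1, smul_eq_mul, mul_assoc]

theorem integral_range_boundaryAngle_neg_one {θ : ℝ} (h0 : 0 < θ) (h1 : θ < 1) (h : ℝ → ℝ) :
    ∫ t in range (boundaryAngle θ (-1)), h t =
      2 * Real.pi * ∫ y, stripKernel θ y * h (boundaryAngle θ (-1) y) := by
  rw [← image_univ, integral_image_eq_integral_abs_deriv_smul MeasurableSet.univ
    (fun y _ => (hasDerivAt_boundaryAngle θ (-1) y).hasDerivWithinAt)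
    (injective_boundaryAngle h0 h1 (by norm_num)).injOn, setIntegral_univ, ← integral_const_mul]
  simp only [abs_deriv_boundaryAngle_neg_one h0 h1, smul_eq_mul, mul_assoc]

theorem integrableOn_range_boundaryAngle_one {θ : ℝ} (h0 : 0 < θ) (h1 : θ < 1) {h : ℝ → ℝ} :
    IntegrableOn h (range (boundaryAngle θ 1)) ↔
      Integrable fun y => stripKernel (1 - θ) y * h (boundaryAngle θ 1 y) := by
  rw [← image_univ, integrableOn_image_iff_integrableOn_abs_deriv_smul MeasurableSet.univ
    (fun y _ => (hasDerivAt_boundaryAngle θ 1 y).hasDerivWithinAt)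
    (injective_boundaryAngle h0 h1 one_ne_zero).injOn, integrableOn_univ]
  simp only [abs_deriv_boundaryAngle_one h0 h1, smul_eq_mul, mul_assoc]
  rw [integrable_const_mul_iff (IsUnit.mk0 _ two_ne_zero),
    integrable_const_mul_iff (IsUnit.mk0 _ Real.pi_ne_zero)]

theorem integrableOn_range_boundaryAngle_neg_one {θ : ℝ} (h0 : 0 < θ) (h1 : θ < 1) {h : ℝ → ℝ} :
    IntegrableOn h (range (boundaryAngle θ (-1))) ↔
      Integrable fun y => stripKernel θ y * h (boundaryAngle θ (-1) y) := by
  rw [← image_univ, integrableOn_image_iff_integrableOn_abs_deriv_smul MeasurableSet.univ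
    (fun y _ => (hasDerivAt_boundaryAngle θ (-1) y).hasDerivWithinAt)
    (injective_boundaryAngle h0 h1 (by norm_num)).injOn, integrableOn_univ]
  simp only [abs_deriv_boundaryAngle_neg_one h0 h1, smul_eq_mul, mul_assoc]
  rw [integrable_const_mul_iff (IsUnit.mk0 _ two_ne_zero),
    integrable_const_mul_iff (IsUnit.mk0 _ Real.pi_ne_zero)]

theorem integral_Ioo_eq_integral_stripKernel {θ : ℝ} (h0 : 0 < θ) (h1 : θ < 1) {h : ℝ → ℝ}
    (i0 : Integrable fun y => stripKernel (1 - θ) y * h (boundaryAngle θ 1 y))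
    (i1 : Integrable fun y => stripKernel θ y * h (boundaryAngle θ (-1) y)) :
    (2 * Real.pi)⁻¹ * ∫ t in Ioo 0 (2 * Real.pi), h t =
      (∫ y, stripKernel (1 - θ) y * h (boundaryAngle θ 1 y)) +
        ∫ y, stripKernel θ y * h (boundaryAngle θ (-1) y) := by
  have hae : (Ioo 0 (2 * Real.pi) : Set ℝ) =ᵐ[volume]
      (range (boundaryAngle θ 1) ∪ range (boundaryAngle θ (-1)) : Set ℝ) := by
    filter_upwards [ae_mem_range_boundaryAngle h0 h1] with t ht
    refine propext ⟨ht, ?_⟩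
    rintro (⟨y, rfl⟩ | ⟨y, rfl⟩) <;> exact boundaryAngle_mem _ _ _
  rw [setIntegral_congr_set hae, setIntegral_union (disjoint_range_boundaryAngle h0 h1)
    (measurableSet_range_boundaryAngle h0 h1 (by norm_num))
    ((integrableOn_range_boundaryAngle_one h0 h1).2 i0)
    ((integrableOn_range_boundaryAngle_neg_one h0 h1).2 i1),
    integral_range_boundaryAngle_one h0 h1, integral_range_boundaryAngle_neg_one h0 h1]
  have := Real.pi_pos
  field_simp

/-- Up to $2\pi$ the kernel is the Jacobian of an injective map into a bounded interval. -/
theorem integrable_stripKernel {x : ℝ} (h0 : 0 < x) (h1 : x < 1) : Integrable (stripKernel x) := by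
  have : IntegrableOn (fun _ => (1 : ℝ)) (range (boundaryAngle x (-1))) := by
    refine IntegrableOn.mono_set (t := Ioo 0 (2 * Real.pi)) ?_ ?_
    · exact integrableOn_const (by simp [ENNReal.mul_eq_top])
    · rintro _ ⟨y, rfl⟩
      exact boundaryAngle_mem _ _ _
  simpa using (integrableOn_range_boundaryAngle_neg_one h0 h1).1 this

theorem stripKernel_pos {x : ℝ} (h0 : 0 < x) (h1 : x < 1) (y : ℝ) : 0 < stripKernel x y := by
  have hs := sin_pi_mul_pos h0 h1
  have hc : -1 < Real.cos (Real.pi * x) := by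
    have := Real.sin_sq_add_cos_sq (Real.pi * x)
    nlinarith
  have := Real.one_le_cosh (Real.pi * y)
  unfold stripKernel
  have : 0 < Real.cosh (Real.pi * y) + Real.cos (Real.pi * x) := by linarith
  positivity

theorem continuous_stripKernel {x : ℝ} (h0 : 0 < x) (h1 : x < 1) : Continuous (stripKernel x) := by
  unfold stripKernel
  refine continuous_const.mul (continuous_const.div (by fun_prop) fun y => ?_)
  -- Were the denominator zero, the kernel would be `0` by the convention for division, against its
  -- positivity.
  have := stripKernel_pos h0 h1 y
  intro h
  simp [stripKernel, h] at this

/-! ### The conformal map of the disc onto the strip and its boundary values. -/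

/-- The conformal map of the unit disc onto the right half-plane, shifted and scaled so that
`discToStrip θ` sends the centre to `θ`. -/
noncomputable def discToHalfPlane (θ : ℝ) (w : ℂ) : ℂ :=
  Real.sin (Real.pi * θ) * ((1 + w) / (1 - w)) - Complex.I * Real.cos (Real.pi * θ)

/-- The conformal map of the unit disc onto the unit strip that sends the centre to `θ`. -/
noncomputable def discToStrip (θ : ℝ) (w : ℂ) : ℂ :=
  1 / 2 - Complex.I / Real.pi * Complex.log (discToHalfPlane θ w)

theorem one_sub_ne_zero_of_mem_ball {w : ℂ} (hw : w ∈ Metric.ball (0 : ℂ) 1) : 1 - w ≠ 0 := by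
  intro h
  have : w = 1 := (sub_eq_zero.1 h).symm
  simp [this] at hw

theorem discToHalfPlane_re_pos {θ : ℝ} (h0 : 0 < θ) (h1 : θ < 1) {w : ℂ}
    (hw : w ∈ Metric.ball (0 : ℂ) 1) : 0 < (discToHalfPlane θ w).re := by
  have hs := sin_pi_mul_pos h0 h1
  have e1 : (discToHalfPlane θ w).re = Real.sin (Real.pi * θ) * ((1 + w) / (1 - w)).re := by
    simp only [discToHalfPlane, Complex.sub_re, Complex.mul_re,
      Complex.I_re, Complex.I_im, Complex.ofReal_re, Complex.ofReal_im]
    ring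
  have hn : 0 < Complex.normSq (1 - w) := Complex.normSq_pos.2 (one_sub_ne_zero_of_mem_ball hw)
  have hw2 : w.re * w.re + w.im * w.im < 1 := by
    rw [← Complex.normSq_apply, Complex.normSq_eq_norm_sq]
    have : ‖w‖ < 1 := by simpa using hw
    nlinarith [norm_nonneg w]
  rw [e1, Complex.div_re, ← add_div]
  refine mul_pos hs (div_pos ?_ hn)
  simp only [Complex.add_re, Complex.sub_re, Complex.add_im, Complex.sub_im, Complex.one_re,
    Complex.one_im]
  nlinarith

theorem discToStrip_re (θ : ℝ) (w : ℂ) :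
    (discToStrip θ w).re = 1 / 2 + (discToHalfPlane θ w).arg / Real.pi := by
  have : Complex.I / Real.pi * Complex.log (discToHalfPlane θ w) =
      ((Real.pi⁻¹ : ℝ) : ℂ) * (Complex.I * Complex.log (discToHalfPlane θ w)) := by
    push_cast; ring
  rw [discToStrip, this, Complex.sub_re, Complex.re_ofReal_mul, Complex.I_mul_re, Complex.log_im]
  norm_num
  ring

theorem discToStrip_mem {θ : ℝ} (h0 : 0 < θ) (h1 : θ < 1) {w : ℂ}
    (hw : w ∈ Metric.ball (0 : ℂ) 1) : discToStrip θ w ∈ openStrip := by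
  have h := Complex.abs_arg_lt_pi_div_two_iff.2 (Or.inl (discToHalfPlane_re_pos h0 h1 hw))
  rw [abs_lt] at h
  have hpi := Real.pi_pos
  have h3 : -(1 / 2) < (discToHalfPlane θ w).arg / Real.pi := by
    rw [lt_div_iff₀ hpi]; linarith [h.1]
  have h4 : (discToHalfPlane θ w).arg / Real.pi < 1 / 2 := by
    rw [div_lt_iff₀ hpi]; linarith [h.2]
  show 0 < (discToStrip θ w).re ∧ (discToStrip θ w).re < 1
  rw [discToStrip_re]
  constructor <;> linarith

theorem differentiableAt_discToStrip {θ : ℝ} {w : ℂ} (hw : 1 - w ≠ 0)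
    (hs : discToHalfPlane θ w ∈ Complex.slitPlane) : DifferentiableAt ℂ (discToStrip θ) w := by
  have h1 : DifferentiableAt ℂ (discToHalfPlane θ) w := by
    unfold discToHalfPlane
    exact (((differentiableAt_const _).add differentiableAt_id).div
      ((differentiableAt_const _).sub differentiableAt_id) hw).const_mul _ |>.sub_const _
  unfold discToStrip
  exact (differentiableAt_const _).sub ((h1.clog hs).const_mul _)

theorem differentiableOn_discToStrip {θ : ℝ} (h0 : 0 < θ) (h1 : θ < 1) :
    DifferentiableOn ℂ (discToStrip θ) (Metric.ball 0 1) := fun _ hw =>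
  (differentiableAt_discToStrip (one_sub_ne_zero_of_mem_ball hw)
    (Or.inl (discToHalfPlane_re_pos h0 h1 hw))).differentiableWithinAt

theorem discToStrip_zero {θ : ℝ} (h0 : 0 < θ) (h1 : θ < 1) : discToStrip θ 0 = θ := by
  have hpi := Real.pi_pos
  have e1 : discToHalfPlane θ 0 = Complex.exp (((Real.pi * θ - Real.pi / 2 : ℝ) : ℂ) * Complex.I) := by
    rw [Complex.exp_mul_I, ← Complex.ofReal_cos, ← Complex.ofReal_sin, Real.cos_sub_pi_div_two,
      Real.sin_sub_pi_div_two]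
    simp [discToHalfPlane]
    ring
  rw [discToStrip, e1, Complex.log_exp]
  · have : (Real.pi : ℂ) ≠ 0 := by exact_mod_cast hpi.ne'
    push_cast
    field_simp
    linear_combination -(2 * (θ : ℂ) - 1) * Complex.I_sq
  · simp only [Complex.mul_im, Complex.I_re, Complex.I_im, Complex.ofReal_re, Complex.ofReal_im]
    nlinarith
  · simp only [Complex.mul_im, Complex.I_re, Complex.I_im, Complex.ofReal_re, Complex.ofReal_im]
    nlinarith

/-- Half-angle parametrization of the circle: $w=-e^{2i\arctan u}=-(1+iu)/(1-iu)$, from which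
$(1+w)/(1-w)=-iu$. -/
theorem circleMap_pi_add_two_mul_arctan (u : ℝ) :
    circleMap 0 1 (Real.pi + 2 * Real.arctan u) * (1 - Complex.I * u) = -(1 + Complex.I * u) := by
  have hc := Real.cos_arctan_pos u
  have hsin : Real.sin (Real.arctan u) = u * Real.cos (Real.arctan u) := by
    have := Real.tan_mul_cos hc.ne'
    rw [Real.tan_arctan] at this
    exact this.symm
  have hsq := Real.sin_sq_add_cos_sq (Real.arctan u)
  rw [hsin] at hsq
  have e1 : circleMap 0 1 (Real.pi + 2 * Real.arctan u) =
      -(Complex.exp (Real.arctan u * Complex.I)) ^ 2 := by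
    rw [circleMap, ← Complex.exp_nat_mul]
    push_cast
    rw [zero_add, one_mul, add_mul, Complex.exp_add, Complex.exp_pi_mul_I]
    ring_nf
  rw [e1, Complex.exp_mul_I, ← Complex.ofReal_cos, ← Complex.ofReal_sin, hsin]
  generalize Real.cos (Real.arctan u) = c at *
  have hsq' : ((u : ℂ) * c) ^ 2 + (c : ℂ) ^ 2 = 1 := by exact_mod_cast hsq
  push_cast
  linear_combination (-(1 + Complex.I * u)) * hsq' +
    ((1 + Complex.I * u) * ((u : ℂ) * c) ^ 2) * Complex.I_sq

/-- The circle goes to the imaginary axis. Its lower half ($\sigma=1$) and upper half ($\sigma=-1$)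
become the left and right edges of the strip under the logarithm. -/
theorem discToHalfPlane_boundary {θ : ℝ} (h0 : 0 < θ) (h1 : θ < 1) (σ y : ℝ) :
    1 - circleMap 0 1 (boundaryAngle θ σ y) ≠ 0 ∧
    discToHalfPlane θ (circleMap 0 1 (boundaryAngle θ σ y)) =
      (Real.exp (-(Real.pi * y)) : ℝ) * (-(σ * Complex.I)) := by
  have hs := sin_pi_mul_pos h0 h1
  have hu := circleMap_pi_add_two_mul_arctan
    ((σ * Real.exp (-(Real.pi * y)) - Real.cos (Real.pi * θ)) / Real.sin (Real.pi * θ))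
  change circleMap 0 1 (boundaryAngle θ σ y) * _ = _ at hu
  set u := (σ * Real.exp (-(Real.pi * y)) - Real.cos (Real.pi * θ)) / Real.sin (Real.pi * θ) with hudef
  set w := circleMap 0 1 (boundaryAngle θ σ y)
  have hne : 1 - w ≠ 0 := by
    intro h
    have : w = 1 := (sub_eq_zero.1 h).symm
    rw [this] at hu
    have h2 : (2 : ℂ) = 0 := by linear_combination hu
    norm_num at h2
  have hdiv : (1 + w) / (1 - w) = -(Complex.I * u) := by
    rw [div_eq_iff hne]
    linear_combination hu
  have hb : (Real.sin (Real.pi * θ) : ℂ) ≠ 0 := by exact_mod_cast hs.ne'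
  have hu2 : (Real.sin (Real.pi * θ) : ℂ) * u =
      σ * (Real.exp (-(Real.pi * y)) : ℝ) - Real.cos (Real.pi * θ) := by
    rw [hudef]
    push_cast at hb ⊢
    field_simp
  refine ⟨hne, ?_⟩
  rw [discToHalfPlane, hdiv]
  linear_combination (-Complex.I) * hu2

theorem discToStrip_boundary_one {θ : ℝ} (h0 : 0 < θ) (h1 : θ < 1) (y : ℝ) :
    ContinuousAt (discToStrip θ) (circleMap 0 1 (boundaryAngle θ 1 y)) ∧
    discToStrip θ (circleMap 0 1 (boundaryAngle θ 1 y)) = (y : ℂ) * Complex.I := by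
  obtain ⟨hne, hW⟩ := discToHalfPlane_boundary h0 h1 1 y
  have he := Real.exp_pos (-(Real.pi * y))
  constructor
  · refine (differentiableAt_discToStrip hne ?_).continuousAt
    rw [hW, Complex.mem_slitPlane_iff]
    right
    generalize Real.exp (-(Real.pi * y)) = e at he
    simp [he.ne']
  · have hpi : (Real.pi : ℂ) ≠ 0 := by exact_mod_cast Real.pi_ne_zero
    rw [discToStrip, hW, Complex.log_ofReal_mul he (by simp), Real.log_exp, Complex.ofReal_one,
      one_mul, Complex.log_neg_I]
    push_cast
    field_simp
    linear_combination Complex.I_sq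

theorem discToStrip_boundary_neg_one {θ : ℝ} (h0 : 0 < θ) (h1 : θ < 1) (y : ℝ) :
    ContinuousAt (discToStrip θ) (circleMap 0 1 (boundaryAngle θ (-1) y)) ∧
    discToStrip θ (circleMap 0 1 (boundaryAngle θ (-1) y)) = 1 + (y : ℂ) * Complex.I := by
  obtain ⟨hne, hW⟩ := discToHalfPlane_boundary h0 h1 (-1) y
  have he := Real.exp_pos (-(Real.pi * y))
  constructor
  · refine (differentiableAt_discToStrip hne ?_).continuousAt
    rw [hW, Complex.mem_slitPlane_iff]
    right
    generalize Real.exp (-(Real.pi * y)) = e at he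
    simp [he.ne']
  · have hpi : (Real.pi : ℂ) ≠ 0 := by exact_mod_cast Real.pi_ne_zero
    rw [discToStrip, hW, Complex.log_ofReal_mul he (by simp), Real.log_exp,
      show -(((-1 : ℝ) : ℂ) * Complex.I) = Complex.I by simp, Complex.log_I]
    push_cast
    field_simp
    linear_combination -Complex.I_sq

/-! ### Hirschman's lemma on the strip. -/

theorem openStrip_subset_closedStrip : openStrip ⊆ closedStrip := fun _ h => ⟨h.1.le, h.2.le⟩

theorem mul_I_mem_closedStrip (y : ℝ) : (y : ℂ) * Complex.I ∈ closedStrip := by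
  simp [closedStrip]

theorem one_add_mul_I_mem_closedStrip (y : ℝ) : 1 + (y : ℂ) * Complex.I ∈ closedStrip := by
  simp [closedStrip]

theorem integrable_stripKernel_mul_log_max {x C δ : ℝ} (h0 : 0 < x) (h1 : x < 1) (hδ : 0 < δ)
    {g : ℝ → ℝ} (hg : Measurable g) (hC : ∀ y, g y ≤ C) :
    Integrable fun y => stripKernel x y * Real.log (max (g y) δ) := by
  refine (integrable_stripKernel h0 h1).mul_bdd (c := |Real.log δ| + |Real.log (max C δ)|)
    (Real.measurable_log.comp (hg.max measurable_const)).aestronglyMeasurable ?_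
  exact Filter.Eventually.of_forall fun y => abs_log_max_le hδ (hC y)

/-- Hirschman's lemma for bounded analytic functions on the strip. -/
theorem log_norm_le_integral_stripKernel_of_bounded {F : ℂ → ℂ} {C δ θ : ℝ} (h0 : 0 < θ)
    (h1 : θ < 1) (hδ : 0 < δ) (hd : DifferentiableOn ℂ F openStrip)
    (hc : ContinuousOn F closedStrip) (hC : ∀ z ∈ closedStrip, ‖F z‖ ≤ C) (hF : F θ ≠ 0) :
    Real.log ‖F θ‖ ≤
      (∫ y : ℝ, stripKernel (1 - θ) y * Real.log (max ‖F (y * Complex.I)‖ δ)) +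
        ∫ y : ℝ, stripKernel θ y * Real.log (max ‖F (1 + y * Complex.I)‖ δ) := by
  have hmaps : MapsTo (discToStrip θ) (Metric.ball 0 1) openStrip := fun w hw =>
    discToStrip_mem h0 h1 hw
  have hcc : ∀ y : ℝ, discToStrip θ (circleMap 0 1 (boundaryAngle θ 1 y)) = y * Complex.I :=
    fun y => (discToStrip_boundary_one h0 h1 y).2
  have hcc' : ∀ y : ℝ, discToStrip θ (circleMap 0 1 (boundaryAngle θ (-1) y)) =
      1 + y * Complex.I := fun y => (discToStrip_boundary_neg_one h0 h1 y).2
  have key := log_norm_le_integral_boundary (f := F ∘ discToStrip θ)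
    (g := fun t => ‖F (discToStrip θ (circleMap 0 1 t))‖) hδ
    (hd.comp (differentiableOn_discToStrip h0 h1) hmaps)
    (fun w hw => hC _ (openStrip_subset_closedStrip (hmaps hw)))
    (by simpa [discToStrip_zero h0 h1] using hF) ?_
  · rw [Function.comp_apply, discToStrip_zero h0 h1] at key
    refine key.trans (le_of_eq ?_)
    rw [integral_Ioo_eq_integral_stripKernel h0 h1]
    · simp only [hcc, hcc']
    · simp only [hcc]
      refine integrable_stripKernel_mul_log_max (by linarith) (by linarith) hδ ?_
        (fun y => hC _ (mul_I_mem_closedStrip y))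
      exact (hc.comp_continuous (by fun_prop) mul_I_mem_closedStrip).norm.measurable
    · simp only [hcc']
      refine integrable_stripKernel_mul_log_max h0 h1 hδ ?_
        (fun y => hC _ (one_add_mul_I_mem_closedStrip y))
      exact (hc.comp_continuous (by fun_prop) one_add_mul_I_mem_closedStrip).norm.measurable
  -- At almost every angle the conformal map is continuous at the circle point with value in the
  -- closed strip, so continuity of `F` there yields the radial limit.
  · filter_upwards [ae_mem_range_boundaryAngle h0 h1] with t ht htI
    have hev : ∀ᶠ R : ℝ in nhdsWithin 1 (Iio 1), R ∈ Ioo (0 : ℝ) 1 := Ioo_mem_nhdsLT one_pos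
    have hcirc : Filter.Tendsto (fun R : ℝ => circleMap 0 R t) (nhdsWithin 1 (Iio 1))
        (nhds (circleMap 0 1 t)) := by
      refine (Continuous.tendsto ?_ (1 : ℝ)).mono_left nhdsWithin_le_nhds
      unfold circleMap
      fun_prop
    have main : ContinuousAt (discToStrip θ) (circleMap 0 1 t) ∧
        discToStrip θ (circleMap 0 1 t) ∈ closedStrip := by
      rcases ht htI with ⟨y, rfl⟩ | ⟨y, rfl⟩
      · exact ⟨(discToStrip_boundary_one h0 h1 y).1, hcc y ▸ mul_I_mem_closedStrip y⟩
      · exact ⟨(discToStrip_boundary_neg_one h0 h1 y).1, hcc' y ▸ one_add_mul_I_mem_closedStrip y⟩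
    have hw : Filter.Tendsto (fun R : ℝ => discToStrip θ (circleMap 0 R t))
        (nhdsWithin 1 (Iio 1)) (nhdsWithin (discToStrip θ (circleMap 0 1 t)) closedStrip) := by
      refine tendsto_nhdsWithin_iff.2 ⟨main.1.tendsto.comp hcirc, ?_⟩
      filter_upwards [hev] with R hR
      refine openStrip_subset_closedStrip (hmaps ?_)
      simpa [abs_of_pos hR.1] using hR.2
    exact ((hc _ main.2).tendsto.comp hw).norm

/-- Hirschman's inequality for $e^{z}$ gives $\theta\le\int\Omega(\theta,y)\,dy$ and for $e^{-z}$
the reverse. All boundary moduli are at least $e^{-1}$, so truncation at that level changes nothing.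
-/
theorem integral_stripKernel {θ : ℝ} (h0 : 0 < θ) (h1 : θ < 1) : ∫ y, stripKernel θ y = θ := by
  have a1 : ∀ y : ℝ, ‖Complex.exp (y * Complex.I)‖ = 1 := Complex.norm_exp_ofReal_mul_I
  have a2 : ∀ y : ℝ, ‖Complex.exp (1 + y * Complex.I)‖ = Real.exp 1 := fun y => by
    simp [Complex.norm_exp]
  have b1 : ∀ y : ℝ, ‖Complex.exp (-(y * Complex.I))‖ = 1 := fun y => by
    simp [Complex.norm_exp]
  have b2 : ∀ y : ℝ, ‖Complex.exp (-(1 + y * Complex.I))‖ = Real.exp (-1) := fun y => by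
    simp [Complex.norm_exp]
  have hexp : Real.exp (-1) ≤ 1 := Real.exp_le_one_iff.2 (by norm_num)
  have hexp2 : Real.exp (-1) ≤ Real.exp 1 := Real.exp_le_exp.2 (by norm_num)
  have k1 := log_norm_le_integral_stripKernel_of_bounded (F := Complex.exp) (C := Real.exp 1) h0 h1
    (Real.exp_pos (-1)) Complex.differentiable_exp.differentiableOn
    Complex.continuous_exp.continuousOn
    (fun z hz => by rw [Complex.norm_exp]; exact Real.exp_le_exp.2 hz.2) (Complex.exp_ne_zero _)
  have k2 := log_norm_le_integral_stripKernel_of_bounded (F := fun z => Complex.exp (-z)) (C := 1)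
    h0 h1 (Real.exp_pos (-1)) (by fun_prop) (by fun_prop)
    (fun z hz => by
      rw [Complex.norm_exp]
      exact Real.exp_le_one_iff.2 (by simpa using hz.1)) (Complex.exp_ne_zero _)
  simp only [a1, a2, max_eq_left hexp, max_eq_left hexp2, Real.log_one, mul_zero, Real.log_exp,
    mul_one, integral_zero, zero_add, Complex.norm_exp_ofReal] at k1
  simp only [b1, b2, max_eq_left hexp, max_self, Real.log_one, mul_zero, Real.log_exp,
    mul_neg, mul_one, integral_zero, zero_add, ← Complex.ofReal_neg, Complex.norm_exp_ofReal,
    integral_neg] at k2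
  linarith

theorem integrable_exp_neg_mul_abs {c : ℝ} (hc : 0 < c) :
    Integrable fun y : ℝ => Real.exp (-c * |y|) := by
  rw [← integrableOn_univ, ← Iic_union_Ioi (a := (0 : ℝ)), integrableOn_union]
  constructor
  · refine (integrableOn_exp_mul_Iic hc 0).congr_fun (fun y hy => ?_) measurableSet_Iic
    simp only [abs_of_nonpos (mem_Iic.1 hy)]
    ring_nf
  · refine (exp_neg_integrableOn_Ioi 0 hc).congr_fun (fun y hy => ?_) measurableSet_Ioi
    simp only [abs_of_pos (mem_Ioi.1 hy)]

theorem exp_abs_le_two_mul_cosh (x : ℝ) : Real.exp |x| ≤ 2 * Real.cosh x := by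
  rw [← Real.cosh_abs, Real.cosh_eq]
  linarith [Real.exp_pos (-|x|)]

/-- Since $\cosh\ge1$, the denominator of the kernel is at least $(1-|\cos\pi x|)\cosh\pi y$, so the
kernel decays like $e^{-\pi|y|}$. This is why growth rates must stay below $\pi$. -/
theorem integrable_stripKernel_mul_exp {x γ : ℝ} (h0 : 0 < x) (h1 : x < 1) (hγ : γ < Real.pi) :
    Integrable fun y => stripKernel x y * Real.exp (γ * |y|) := by
  have hs := sin_pi_mul_pos h0 h1
  have hpi := Real.pi_pos
  have hc : 0 < 1 - |Real.cos (Real.pi * x)| := by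
    have := Real.sin_sq_add_cos_sq (Real.pi * x)
    have h2 : |Real.cos (Real.pi * x)| < 1 := by
      rw [abs_lt]; constructor <;> nlinarith
    linarith
  refine ((integrable_exp_neg_mul_abs (sub_pos.2 hγ)).const_mul
    (Real.sin (Real.pi * x) / (1 - |Real.cos (Real.pi * x)|))).mono' ?_ ?_
  · exact ((continuous_stripKernel h0 h1).mul (by fun_prop)).aestronglyMeasurable
  · refine Filter.Eventually.of_forall fun y => ?_
    rw [Real.norm_of_nonneg (mul_nonneg (stripKernel_pos h0 h1 y).le (Real.exp_pos _).le)]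
    have e1 : Real.exp (-(Real.pi - γ) * |y|) = (Real.exp (Real.pi * |y|))⁻¹ *
        Real.exp (γ * |y|) := by
      rw [← Real.exp_neg, ← Real.exp_add]; ring_nf
    rw [e1, ← mul_assoc]
    refine mul_le_mul_of_nonneg_right ?_ (Real.exp_pos _).le
    have h3 := exp_abs_le_two_mul_cosh (Real.pi * y)
    rw [abs_mul, abs_of_pos hpi] at h3
    have h4 := Real.one_le_cosh (Real.pi * y)
    have h5 : (1 - |Real.cos (Real.pi * x)|) * (Real.exp (Real.pi * |y|) / 2) ≤
        Real.cosh (Real.pi * y) + Real.cos (Real.pi * x) := by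
      calc _ ≤ (1 - |Real.cos (Real.pi * x)|) * Real.cosh (Real.pi * y) := by
            gcongr; linarith
        _ ≤ _ := by nlinarith [neg_abs_le (Real.cos (Real.pi * x)), abs_nonneg (Real.cos (Real.pi * x))]
    rw [stripKernel]
    have h6 := Real.exp_pos (Real.pi * |y|)
    calc 1 / 2 * (Real.sin (Real.pi * x) / (Real.cosh (Real.pi * y) + Real.cos (Real.pi * x)))
        ≤ 1 / 2 * (Real.sin (Real.pi * x) /
          ((1 - |Real.cos (Real.pi * x)|) * (Real.exp (Real.pi * |y|) / 2))) := by gcongr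
      _ = _ := by field_simp

/-- Doubly exponential growth of type less than `π`. -/
theorem abs_log_max_le_exp {a δ C γ y : ℝ} (hδ : 0 < δ) (hC : 0 ≤ C)
    (ha : a ≤ Real.exp (C * Real.exp (γ * |y|))) :
    |Real.log (max a δ)| ≤ |Real.log δ| + C * Real.exp (γ * |y|) := by
  have h1 : Real.log δ ≤ Real.log (max a δ) := Real.log_le_log hδ (le_max_right _ _)
  have h3 : 0 ≤ C * Real.exp (γ * |y|) := by positivity
  have h2 : Real.log (max a δ) ≤ |Real.log δ| + C * Real.exp (γ * |y|) := by
    rcases le_total a δ with h | h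
    · rw [max_eq_right h]; linarith [le_abs_self (Real.log δ)]
    · rw [max_eq_left h]
      have := Real.log_le_log (hδ.trans_le h) ha
      rw [Real.log_exp] at this
      linarith [abs_nonneg (Real.log δ)]
  rw [abs_le]
  exact ⟨by linarith [neg_abs_le (Real.log δ)], h2⟩

theorem integrable_stripKernel_mul_of_abs_le_exp {x A C γ : ℝ} (h0 : 0 < x) (h1 : x < 1)
    (hγ : γ < Real.pi) {g : ℝ → ℝ} (hg : Measurable g)
    (hC : ∀ y, |g y| ≤ A + C * Real.exp (γ * |y|)) :
    Integrable fun y => stripKernel x y * g y := by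
  refine (((integrable_stripKernel h0 h1).mul_const A).add
    ((integrable_stripKernel_mul_exp h0 h1 hγ).const_mul C)).mono'
    ((continuous_stripKernel h0 h1).measurable.mul hg).aestronglyMeasurable
    (Filter.Eventually.of_forall fun y => ?_)
  have hk := stripKernel_pos h0 h1 y
  rw [norm_mul, Real.norm_of_nonneg hk.le, Real.norm_eq_abs]
  calc stripKernel x y * |g y| ≤ stripKernel x y * (A + C * Real.exp (γ * |y|)) := by
        gcongr; exact hC y
    _ = _ := by simp only [Pi.add_apply]; ring

theorem integrable_stripKernel_mul_log_max_of_growth {x C δ γ : ℝ} (h0 : 0 < x) (h1 : x < 1)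
    (hδ : 0 < δ) (hγ : γ < Real.pi) (hC0 : 0 ≤ C) {g : ℝ → ℝ} (hg : Measurable g)
    (hC : ∀ y, g y ≤ Real.exp (C * Real.exp (γ * |y|))) :
    Integrable fun y => stripKernel x y * Real.log (max (g y) δ) :=
  integrable_stripKernel_mul_of_abs_le_exp h0 h1 hγ
    (Real.measurable_log.comp (hg.max measurable_const))
    fun y => abs_log_max_le_exp hδ hC0 (hC y)

theorem exists_growth_le {C γ b κ : ℝ} (hγb : γ < b) (hκ : 0 < κ) (hγ : 0 ≤ γ) (hC : 0 ≤ C) :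
    ∃ D : ℝ, ∀ t : ℝ, 0 ≤ t → C * Real.exp (γ * t) - κ * Real.exp (b * t) ≤ D := by
  -- Beyond `T` one has $\kappa e^{(b-\gamma)t}\ge C+1$, so the subtracted term dominates; before
  -- `T` the first term is bounded by its value at `|T|`.
  set T := Real.log ((C + 1) / κ) / (b - γ) with hT
  refine ⟨C * Real.exp (γ * |T|), fun t ht => ?_⟩
  have hbγ : 0 < b - γ := sub_pos.2 hγb
  rcases le_total t T with h | h
  · have : C * Real.exp (γ * t) ≤ C * Real.exp (γ * |T|) := by
      gcongr; exact h.trans (le_abs_self T)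
    have := mul_pos hκ (Real.exp_pos (b * t))
    linarith
  · have h2 : (C + 1) / κ ≤ Real.exp ((b - γ) * t) := by
      rw [← Real.log_le_iff_le_exp (by positivity)]
      rw [hT, div_le_iff₀ hbγ] at h
      linarith
    have h3 : C ≤ κ * Real.exp ((b - γ) * t) := by
      rw [div_le_iff₀ hκ] at h2; linarith
    have h4 : Real.exp (b * t) = Real.exp ((b - γ) * t) * Real.exp (γ * t) := by
      rw [← Real.exp_add]; ring_nf
    have h5 := mul_le_mul_of_nonneg_right h3 (Real.exp_pos (γ * t)).le
    have : 0 ≤ C * Real.exp (γ * |T|) := by positivity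
    rw [h4]
    linarith

theorem re_cos_mul_sub_half (b : ℝ) (z : ℂ) :
    (Complex.cos (b * (z - 1 / 2))).re = Real.cos (b * (z.re - 1 / 2)) * Real.cosh (b * z.im) := by
  have : (b : ℂ) * (z - 1 / 2) = ((b * (z.re - 1 / 2) : ℝ) : ℂ) + ((b * z.im : ℝ) : ℂ) * Complex.I := by
    conv_lhs => rw [← Complex.re_add_im z]
    push_cast; ring
  rw [this, Complex.cos_add_mul_I, ← Complex.ofReal_cos, ← Complex.ofReal_cosh,
    ← Complex.ofReal_sin, ← Complex.ofReal_sinh, Complex.sub_re]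
  simp [← Complex.ofReal_mul, -Complex.ofReal_cos, -Complex.ofReal_cosh, -Complex.ofReal_sin,
    -Complex.ofReal_sinh]

/-- On the strip $|b(\operatorname{Re}z-\tfrac12)|\le b/2<\pi/2$, so
$\operatorname{Re}\cos(b(z-\tfrac12))$ has a positive lower bound of order
$e^{b|\operatorname{Im}z|}$. Hence $\exp(-\varepsilon\cos(b(z-\tfrac12)))$ damps doubly exponential
growth of any rate below $b$. -/
theorem cos_half_mul_cosh_le {b : ℝ} (hb : 0 < b) (hbpi : b < Real.pi) {z : ℂ}
    (hz : z ∈ closedStrip) :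
    Real.cos (b / 2) * Real.cosh (b * z.im) ≤ (Complex.cos (b * (z - 1 / 2))).re := by
  rw [re_cos_mul_sub_half]
  refine mul_le_mul_of_nonneg_right ?_ (Real.cosh_pos _).le
  rw [← Real.cos_abs (b * (z.re - 1 / 2))]
  refine Real.cos_le_cos_of_nonneg_of_le_pi (abs_nonneg _) (by linarith) ?_
  rw [abs_mul, abs_of_pos hb]
  have : |z.re - 1 / 2| ≤ 1 / 2 := by
    rw [abs_le]; constructor <;> linarith [hz.1, hz.2]
  nlinarith

/-- **Hirschman's lemma**: an analytic function of admissible growth in the unit strip is bounded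
by the exponential of the Poisson integral of the logarithm of its boundary values. -/
theorem log_norm_le_integral_stripKernel {F : ℂ → ℂ} {C γ δ θ : ℝ} (h0 : 0 < θ) (h1 : θ < 1)
    (hδ : 0 < δ) (hγ0 : 0 ≤ γ) (hγ : γ < Real.pi) (hC0 : 0 ≤ C)
    (hd : DifferentiableOn ℂ F openStrip) (hc : ContinuousOn F closedStrip)
    (hC : ∀ z ∈ closedStrip, ‖F z‖ ≤ Real.exp (C * Real.exp (γ * |z.im|))) (hF : F θ ≠ 0) :
    Real.log ‖F θ‖ ≤
      (∫ y : ℝ, stripKernel (1 - θ) y * Real.log (max ‖F (y * Complex.I)‖ δ)) +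
        ∫ y : ℝ, stripKernel θ y * Real.log (max ‖F (1 + y * Complex.I)‖ δ) := by
  -- The rate lies above `γ`, so that the damping factor beats the growth of `F`, and below `π`, so
  -- that the cosine keeps positive real part on the strip.
  set b := (γ + Real.pi) / 2 with hb
  have hpi := Real.pi_pos
  have hb0 : 0 < b := by linarith
  have hbpi : b < Real.pi := by linarith
  have hγb : γ < b := by linarith
  have hcos : 0 < Real.cos (b / 2) := Real.cos_pos_of_mem_Ioo ⟨by linarith, by linarith⟩
  have hre : ∀ z ∈ closedStrip, 0 ≤ (Complex.cos (b * (z - 1 / 2))).re := fun z hz =>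
    (mul_nonneg hcos.le (Real.cosh_pos _).le).trans (cos_half_mul_cosh_le hb0 hbpi hz)
  set E : ℝ → ℂ → ℂ := fun ε z => Complex.exp (-(ε * Complex.cos (b * (z - 1 / 2)))) with hE
  have hEn : ∀ ε z, ‖E ε z‖ = Real.exp (-(ε * (Complex.cos (b * (z - 1 / 2))).re)) := by
    intro ε z
    simp only [hE, Complex.norm_exp, Complex.neg_re, Complex.re_ofReal_mul]
  have hE1 : ∀ ε, 0 ≤ ε → ∀ z ∈ closedStrip, ‖E ε z‖ ≤ 1 := by
    intro ε hε z hz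
    rw [hEn]
    exact Real.exp_le_one_iff.2 (neg_nonpos.2 (mul_nonneg hε (hre z hz)))
  have m0 : Measurable fun y : ℝ => ‖F (y * Complex.I)‖ :=
    (hc.comp_continuous (by fun_prop) mul_I_mem_closedStrip).norm.measurable
  have m1 : Measurable fun y : ℝ => ‖F (1 + y * Complex.I)‖ :=
    (hc.comp_continuous (by fun_prop) one_add_mul_I_mem_closedStrip).norm.measurable
  have i0 := integrable_stripKernel_mul_log_max_of_growth (x := 1 - θ) (by linarith) (by linarith)
    hδ hγ hC0 m0 (fun y => by simpa using hC _ (mul_I_mem_closedStrip y))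
  have i1 := integrable_stripKernel_mul_log_max_of_growth h0 h1
    hδ hγ hC0 m1 (fun y => by simpa using hC _ (one_add_mul_I_mem_closedStrip y))
  have key : ∀ ε : ℝ, 0 < ε → Real.log ‖F θ‖ - ε * (Complex.cos (b * (θ - 1 / 2))).re ≤
      (∫ y : ℝ, stripKernel (1 - θ) y * Real.log (max ‖F (y * Complex.I)‖ δ)) +
        ∫ y : ℝ, stripKernel θ y * Real.log (max ‖F (1 + y * Complex.I)‖ δ) := by
    intro ε hε
    obtain ⟨D, hD⟩ := exists_growth_le (κ := ε * Real.cos (b / 2) / 2) hγb (by positivity) hγ0 hC0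
    have hEd : Differentiable ℂ (E ε) := by simp only [hE]; fun_prop
    have hbd : ∀ z ∈ closedStrip, ‖F z * E ε z‖ ≤ Real.exp D := by
      intro z hz
      rw [norm_mul, hEn]
      refine (mul_le_mul_of_nonneg_right (hC z hz) (Real.exp_pos _).le).trans ?_
      rw [← Real.exp_add, Real.exp_le_exp]
      have h2 := hD |z.im| (abs_nonneg _)
      have h3 := cos_half_mul_cosh_le hb0 hbpi hz
      have h4 := exp_abs_le_two_mul_cosh (b * z.im)
      rw [abs_mul, abs_of_pos hb0] at h4
      have h5 : ε * (Real.cos (b / 2) * Real.cosh (b * z.im)) ≤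
        ε * (Complex.cos (b * (z - 1 / 2))).re := mul_le_mul_of_nonneg_left h3 hε.le
      have h6 : ε * Real.cos (b / 2) / 2 * Real.exp (b * |z.im|) ≤
          ε * Real.cos (b / 2) / 2 * (2 * Real.cosh (b * z.im)) :=
        mul_le_mul_of_nonneg_left h4 (by positivity)
      linarith
    have hk := log_norm_le_integral_stripKernel_of_bounded (F := fun z => F z * E ε z)
      h0 h1 hδ (hd.mul hEd.differentiableOn) (hc.mul hEd.continuous.continuousOn) hbd
      (mul_ne_zero hF (Complex.exp_ne_zero _))
    have hl : Real.log ‖F θ * E ε θ‖ =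
        Real.log ‖F θ‖ - ε * (Complex.cos (b * (θ - 1 / 2))).re := by
      rw [norm_mul, Real.log_mul (norm_ne_zero_iff.2 hF)
        (norm_ne_zero_iff.2 (Complex.exp_ne_zero _)), hEn, Real.log_exp]
      ring
    rw [hl] at hk
    -- The damping factor has modulus at most $1$, so dropping it on the edges only increases the
    -- integrals. The resulting bound does not depend on `ε`, which may then tend to $0$.
    refine hk.trans (add_le_add (integral_mono ?_ i0 fun y => ?_) (integral_mono ?_ i1 fun y => ?_))
    · refine integrable_stripKernel_mul_log_max (by linarith) (by linarith) hδ ?_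
        (fun y => hbd _ (mul_I_mem_closedStrip y))
      exact ((hc.mul hEd.continuous.continuousOn).comp_continuous (by fun_prop)
        mul_I_mem_closedStrip).norm.measurable
    · refine mul_le_mul_of_nonneg_left (Real.log_le_log (lt_max_of_lt_right hδ)
        (max_le_max ?_ le_rfl)) (stripKernel_pos (by linarith) (by linarith) y).le
      rw [norm_mul]
      exact mul_le_of_le_one_right (norm_nonneg _) (hE1 ε hε.le _ (mul_I_mem_closedStrip y))
    · refine integrable_stripKernel_mul_log_max h0 h1 hδ ?_
        (fun y => hbd _ (one_add_mul_I_mem_closedStrip y))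
      exact ((hc.mul hEd.continuous.continuousOn).comp_continuous (by fun_prop)
        one_add_mul_I_mem_closedStrip).norm.measurable
    · refine mul_le_mul_of_nonneg_left (Real.log_le_log (lt_max_of_lt_right hδ)
        (max_le_max ?_ le_rfl)) (stripKernel_pos h0 h1 y).le
      rw [norm_mul]
      exact mul_le_of_le_one_right (norm_nonneg _) (hE1 ε hε.le _ (one_add_mul_I_mem_closedStrip y))
  have hlim : Filter.Tendsto
      (fun ε : ℝ => Real.log ‖F θ‖ - ε * (Complex.cos (b * (θ - 1 / 2))).re)
      (nhdsWithin 0 (Ioi 0)) (nhds (Real.log ‖F θ‖ - 0 * (Complex.cos (b * (θ - 1 / 2))).re)) :=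
    (Continuous.tendsto (by fun_prop) 0).mono_left nhdsWithin_le_nhds
  rw [zero_mul, sub_zero] at hlim
  exact le_of_tendsto hlim (eventually_mem_nhdsWithin.mono fun ε hε => key ε hε)

/-! ### Geometric means in $L^r$ and Hölder's inequality. -/

theorem eLpNorm_le_one_iff_lintegral {α : Type*} [MeasurableSpace α] {ν : Measure α} {r : ℝ≥0∞}
    (hr : r ≠ 0) (hr' : r ≠ ∞) {f : α → ℝ} :
    eLpNorm f r ν ≤ 1 ↔ ∫⁻ k, ‖f k‖ₑ ^ r.toReal ∂ν ≤ 1 := by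
  have hpos := ENNReal.toReal_pos hr hr'
  rw [eLpNorm_eq_lintegral_rpow_enorm_toReal hr hr', one_div,
    ENNReal.rpow_inv_le_iff hpos, ENNReal.one_rpow]

/-- A geometric mean of nonnegative functions in the unit ball of `L^r` lies in the unit ball,
for every `0 < r ≤ ∞`. -/
theorem eLpNorm_exp_integral_log_le_one {Y α : Type*} [MeasurableSpace Y] [MeasurableSpace α]
    [Countable α] [MeasurableSingletonClass α] {P : Measure Y} [IsProbabilityMeasure P]
    {ν : Measure α} {r : ℝ≥0∞} (hr : r ≠ 0) {b : Y → α → ℝ}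
    (hpos : ∀ y k, 0 < b y k) (hint : ∀ k, Integrable (fun y => Real.log (b y k)) P)
    (hb : ∀ y, eLpNorm (b y) r ν ≤ 1) :
    eLpNorm (fun k => Real.exp (∫ y, Real.log (b y k) ∂P)) r ν ≤ 1 := by
  rcases eq_or_ne r ∞ with rfl | hr'
  · rw [eLpNorm_exponent_top]
    refine essSup_le_of_ae_le _ (ae_iff_of_countable.2 fun k hk => ?_)
    have h1 : ∀ y, b y k ≤ 1 := by
      intro y
      have h2 := hb y
      rw [eLpNorm_exponent_top] at h2
      have h3 := ae_iff_of_countable.1 (ae_le_eLpNormEssSup (f := b y) (μ := ν)) k hk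
      have h4 := h3.trans h2
      rw [Real.enorm_of_nonneg (hpos y k).le, ENNReal.ofReal_le_one] at h4
      exact h4
    beta_reduce
    rw [Real.enorm_of_nonneg (Real.exp_pos _).le]
    exact ENNReal.ofReal_le_one.2 (Real.exp_le_one_iff.2
      (integral_nonpos fun y => Real.log_nonpos (hpos y k).le (h1 y)))
  · have hrpos := ENNReal.toReal_pos hr hr'
    rw [eLpNorm_le_one_iff_lintegral hr hr']
    have hmeas : ∀ k, AEMeasurable (fun y => ‖b y k‖ₑ ^ r.toReal) P := by
      intro k
      refine AEMeasurable.pow_const ?_ _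
      rw [show (fun y => ‖b y k‖ₑ) = fun y => ‖Real.exp (Real.log (b y k))‖ₑ from
        funext fun y => by rw [Real.exp_log (hpos y k)]]
      exact (Real.measurable_exp.comp_aemeasurable (hint k).aemeasurable).enorm
    -- Jensen's inequality is applied to $\exp$ and $r\log b$, not to the power $t^r$, so convexity
    -- of the latter, that is $r\ge1$, is not needed.
    have hj : ∀ k, ‖Real.exp (∫ y, Real.log (b y k) ∂P)‖ₑ ^ r.toReal ≤
        ∫⁻ y, ‖b y k‖ₑ ^ r.toReal ∂P := by
      intro k
      by_cases htop : ∫⁻ y, ‖b y k‖ₑ ^ r.toReal ∂P = ∞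
      · rw [htop]; exact le_top
      have heq : ∀ y, ‖b y k‖ₑ ^ r.toReal =
          ENNReal.ofReal (Real.exp (r.toReal * Real.log (b y k))) := by
        intro y
        rw [Real.enorm_of_nonneg (hpos y k).le, ENNReal.ofReal_rpow_of_pos (hpos y k),
          Real.rpow_def_of_pos (hpos y k), mul_comm]
      have hmeas' : AEStronglyMeasurable (fun y => Real.exp (r.toReal * Real.log (b y k))) P :=
        (Real.continuous_exp.comp_aestronglyMeasurable
          ((hint k).const_mul r.toReal).aestronglyMeasurable)
      simp only [heq] at htop ⊢
      have hi : Integrable (fun y => Real.exp (r.toReal * Real.log (b y k))) P := by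
        refine ⟨hmeas', ?_⟩
        rw [hasFiniteIntegral_iff_ofReal (Filter.Eventually.of_forall fun y => (Real.exp_pos _).le)]
        exact lt_top_iff_ne_top.2 htop
      rw [← ofReal_integral_eq_lintegral_ofReal hi
        (Filter.Eventually.of_forall fun y => (Real.exp_pos _).le),
        Real.enorm_of_nonneg (Real.exp_pos _).le, ENNReal.ofReal_rpow_of_pos (Real.exp_pos _),
        ← Real.exp_mul, mul_comm, ← integral_const_mul]
      exact ENNReal.ofReal_le_ofReal (convexOn_exp.map_integral_le Real.continuous_exp.continuousOn
        isClosed_univ (Filter.Eventually.of_forall fun _ => mem_univ _)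
        ((hint k).const_mul r.toReal) hi)
    calc ∫⁻ k, ‖Real.exp (∫ y, Real.log (b y k) ∂P)‖ₑ ^ r.toReal ∂ν
        ≤ ∫⁻ k, ∫⁻ y, ‖b y k‖ₑ ^ r.toReal ∂P ∂ν := lintegral_mono hj
      _ = ∫⁻ y, ∫⁻ k, ‖b y k‖ₑ ^ r.toReal ∂ν ∂P := by
          -- On a countable space the interchange is that of a series with an integral, so no joint
          -- measurability in the two variables is required.
          simp only [lintegral_countable']
          rw [lintegral_tsum fun k => (hmeas k).mul_const _]
          congr 1
          ext k
          rw [lintegral_mul_const'' _ (hmeas k)]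
      _ ≤ ∫⁻ _, 1 ∂P := lintegral_mono fun y => (eLpNorm_le_one_iff_lintegral hr hr').1 (hb y)
      _ = 1 := by simp

/-- Hölder's inequality with the exponents $q_0/(1-\theta)$ and $q_1/\theta$, which remains valid
below $1$ and at $\infty$. -/
theorem eLpNorm_rpow_mul_rpow_le_one {α : Type*} [MeasurableSpace α] {ν : Measure α}
    {q₀ q₁ q : ℝ≥0∞} {θ : ℝ} (h0 : 0 < θ) (h1 : θ < 1)
    (hq : 1 / q = ENNReal.ofReal (1 - θ) / q₀ + ENNReal.ofReal θ / q₁)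
    {f g : α → ℝ} (hf : AEStronglyMeasurable f ν) (hg : AEStronglyMeasurable g ν)
    (hf1 : eLpNorm f q₀ ν ≤ 1) (hg1 : eLpNorm g q₁ ν ≤ 1) :
    eLpNorm (fun k => ‖f k‖ ^ (1 - θ) * ‖g k‖ ^ θ) q ν ≤ 1 := by
  have key : ∀ c : ℝ, 0 < c → ∀ (r : ℝ≥0∞) (u : α → ℝ), eLpNorm u r ν ≤ 1 →
      eLpNorm (fun k => ‖u k‖ ^ c) (r / ENNReal.ofReal c) ν ≤ 1 := by
    intro c hc r u hu
    rw [eLpNorm_norm_rpow _ hc, ENNReal.div_mul_cancel (by simpa using hc) ENNReal.ofReal_ne_top]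
    exact ENNReal.rpow_le_one hu hc.le
  have : ENNReal.HolderTriple (q₀ / ENNReal.ofReal (1 - θ)) (q₁ / ENNReal.ofReal θ) q := by
    refine ⟨?_⟩
    rw [ENNReal.inv_div (Or.inl ENNReal.ofReal_ne_top) (Or.inl (by simpa using h1)),
      ENNReal.inv_div (Or.inl ENNReal.ofReal_ne_top) (Or.inl (by simpa using h0)), ← hq, one_div]
  have hc : Continuous fun x : ℝ => x ^ (1 - θ) := Real.continuous_rpow_const (by linarith)
  have hc' : Continuous fun x : ℝ => x ^ θ := Real.continuous_rpow_const h0.le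
  have := eLpNorm_le_eLpNorm_mul_eLpNorm_of_nnnorm (p := q₀ / ENNReal.ofReal (1 - θ))
    (q := q₁ / ENNReal.ofReal θ) (r := q)
    (hc.comp_aestronglyMeasurable hf.norm) (hc'.comp_aestronglyMeasurable hg.norm)
    (fun x y => x * y) 1 (Filter.Eventually.of_forall fun k => by simp [nnnorm_mul])
  refine this.trans ?_
  rw [ENNReal.coe_one, one_mul]
  exact mul_le_one' (key _ (by linarith) _ _ hf1) (key _ h0 _ _ hg1)

/-- The harmonic measure of one boundary line of the strip, normalized to total mass one. -/
noncomputable def stripMeasure (x : ℝ) : Measure ℝ :=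
  volume.withDensity fun y => ((stripKernel x y / x).toNNReal : ℝ≥0∞)

theorem measurable_stripKernel_div {x : ℝ} (h0 : 0 < x) (h1 : x < 1) :
    Measurable fun y => (stripKernel x y / x).toNNReal :=
  ((continuous_stripKernel h0 h1).div_const x).measurable.real_toNNReal

theorem toNNReal_stripKernel_div_smul {x : ℝ} (h0 : 0 < x) (h1 : x < 1) (y t : ℝ) :
    (stripKernel x y / x).toNNReal • t = x⁻¹ * (stripKernel x y * t) := by
  rw [NNReal.smul_def, Real.coe_toNNReal _ (div_nonneg (stripKernel_pos h0 h1 y).le h0.le),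
    smul_eq_mul]
  ring

theorem integral_stripMeasure {x : ℝ} (h0 : 0 < x) (h1 : x < 1) (g : ℝ → ℝ) :
    ∫ y, g y ∂stripMeasure x = x⁻¹ * ∫ y, stripKernel x y * g y := by
  rw [stripMeasure, integral_withDensity_eq_integral_smul (measurable_stripKernel_div h0 h1),
    ← integral_const_mul]
  simp only [toNNReal_stripKernel_div_smul h0 h1]

theorem integrable_stripMeasure {x : ℝ} (h0 : 0 < x) (h1 : x < 1) {g : ℝ → ℝ}
    (hg : Integrable fun y => stripKernel x y * g y) : Integrable g (stripMeasure x) := by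
  rw [stripMeasure, integrable_withDensity_iff_integrable_smul (measurable_stripKernel_div h0 h1)]
  simp only [toNNReal_stripKernel_div_smul h0 h1]
  exact hg.const_mul _

theorem isProbabilityMeasure_stripMeasure {x : ℝ} (h0 : 0 < x) (h1 : x < 1) :
    IsProbabilityMeasure (stripMeasure x) := by
  refine ⟨?_⟩
  rw [stripMeasure, withDensity_apply _ MeasurableSet.univ, Measure.restrict_univ]
  change ∫⁻ y, ENNReal.ofReal (stripKernel x y / x) = 1
  rw [← ofReal_integral_eq_lintegral_ofReal ((integrable_stripKernel h0 h1).div_const x)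
    (Filter.Eventually.of_forall fun y => div_nonneg (stripKernel_pos h0 h1 y).le h0.le),
    integral_div, integral_stripKernel h0 h1, div_self h0.ne', ENNReal.ofReal_one]

/-- Division by the bound `a` normalizes `v` into the unit ball. The outer exponent `x` is the mass
of the kernel, lost on passing to the probability measure. -/
theorem exp_integral_stripKernel_log_mul {x : ℝ} (h0 : 0 < x) (h1 : x < 1) {v a : ℝ → ℝ}
    (hv : ∀ y, 0 < v y) (ha : ∀ y, 0 < a y)
    (iv : Integrable fun y => stripKernel x y * Real.log (v y))
    (ia : Integrable fun y => stripKernel x y * Real.log (a y)) :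
    Integrable (fun y => Real.log (v y / a y)) (stripMeasure x) ∧
    Real.exp (∫ y, stripKernel x y * Real.log (v y)) =
      Real.exp (∫ y, Real.log (v y / a y) ∂stripMeasure x) ^ x *
        Real.exp (∫ y, stripKernel x y * Real.log (a y)) := by
  have e : (fun y => stripKernel x y * Real.log (v y / a y)) =
      fun y => stripKernel x y * Real.log (v y) - stripKernel x y * Real.log (a y) := by
    ext y
    rw [Real.log_div (hv y).ne' (ha y).ne', mul_sub]
  refine ⟨integrable_stripMeasure h0 h1 (e ▸ iv.sub ia), ?_⟩
  rw [← Real.exp_mul, ← Real.exp_add, integral_stripMeasure h0 h1, e, integral_sub iv ia]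
  congr 1
  field_simp
  ring

/-- Interpolation of the norms of the Poisson geometric means of two families of functions on a
countable space. -/
theorem eLpNorm_exp_integral_stripKernel_le {α : Type*} [MeasurableSpace α] [Countable α]
    [MeasurableSingletonClass α] {ν : Measure α} {q₀ q₁ q : ℝ≥0∞} {θ : ℝ} (h0 : 0 < θ) (h1 : θ < 1)
    (hq₀ : q₀ ≠ 0) (hq₁ : q₁ ≠ 0)
    (hq : 1 / q = ENNReal.ofReal (1 - θ) / q₀ + ENNReal.ofReal θ / q₁)
    {v₀ v₁ : ℝ → α → ℝ} {a₀ a₁ : ℝ → ℝ} (hv₀ : ∀ y k, 0 < v₀ y k) (hv₁ : ∀ y k, 0 < v₁ y k)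
    (ha₀ : ∀ y, 0 < a₀ y) (ha₁ : ∀ y, 0 < a₁ y)
    (iv₀ : ∀ k, Integrable fun y => stripKernel (1 - θ) y * Real.log (v₀ y k))
    (iv₁ : ∀ k, Integrable fun y => stripKernel θ y * Real.log (v₁ y k))
    (ia₀ : Integrable fun y => stripKernel (1 - θ) y * Real.log (a₀ y))
    (ia₁ : Integrable fun y => stripKernel θ y * Real.log (a₁ y))
    (hb₀ : ∀ y, eLpNorm (v₀ y) q₀ ν ≤ ENNReal.ofReal (a₀ y))
    (hb₁ : ∀ y, eLpNorm (v₁ y) q₁ ν ≤ ENNReal.ofReal (a₁ y)) :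
    eLpNorm (fun k => Real.exp ((∫ y, stripKernel (1 - θ) y * Real.log (v₀ y k)) +
        ∫ y, stripKernel θ y * Real.log (v₁ y k))) q ν ≤
      ENNReal.ofReal (Real.exp ((∫ y, stripKernel (1 - θ) y * Real.log (a₀ y)) +
        ∫ y, stripKernel θ y * Real.log (a₁ y))) := by
  have h0' : 0 < 1 - θ := by linarith
  have h1' : 1 - θ < 1 := by linarith
  have := isProbabilityMeasure_stripMeasure h0 h1
  have := isProbabilityMeasure_stripMeasure h0' h1'
  have hnorm : ∀ (r : ℝ≥0∞) (v : ℝ → α → ℝ) (a : ℝ → ℝ), (∀ y, 0 < a y) →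
      (∀ y, eLpNorm (v y) r ν ≤ ENNReal.ofReal (a y)) →
      ∀ y, eLpNorm (fun k => v y k / a y) r ν ≤ 1 := by
    intro r v a ha hb y
    have : (fun k => v y k / a y) = (a y)⁻¹ • v y := by
      ext k; simp [div_eq_inv_mul]
    rw [this, eLpNorm_const_smul, Real.enorm_of_nonneg (inv_nonneg.2 (ha y).le),
      ENNReal.ofReal_inv_of_pos (ha y)]
    calc _ ≤ (ENNReal.ofReal (a y))⁻¹ * ENNReal.ofReal (a y) := by gcongr; exact hb y
      _ = 1 := ENNReal.inv_mul_cancel (by simpa using ha y) ENNReal.ofReal_ne_top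
  have k₀ := eLpNorm_exp_integral_log_le_one (P := stripMeasure (1 - θ)) (ν := ν) hq₀
    (b := fun y k => v₀ y k / a₀ y) (fun y k => div_pos (hv₀ y k) (ha₀ y))
    (fun k => (exp_integral_stripKernel_log_mul h0' h1' (fun y => hv₀ y k) ha₀ (iv₀ k) ia₀).1)
    (hnorm q₀ v₀ a₀ ha₀ hb₀)
  have k₁ := eLpNorm_exp_integral_log_le_one (P := stripMeasure θ) (ν := ν) hq₁
    (b := fun y k => v₁ y k / a₁ y) (fun y k => div_pos (hv₁ y k) (ha₁ y))
    (fun k => (exp_integral_stripKernel_log_mul h0 h1 (fun y => hv₁ y k) ha₁ (iv₁ k) ia₁).1)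
    (hnorm q₁ v₁ a₁ ha₁ hb₁)
  have hH := eLpNorm_rpow_mul_rpow_le_one h0 h1 hq
    (measurable_of_countable _).aestronglyMeasurable (measurable_of_countable _).aestronglyMeasurable
    k₀ k₁
  have e : (fun k => Real.exp ((∫ y, stripKernel (1 - θ) y * Real.log (v₀ y k)) +
        ∫ y, stripKernel θ y * Real.log (v₁ y k))) =
      (Real.exp ((∫ y, stripKernel (1 - θ) y * Real.log (a₀ y)) +
        ∫ y, stripKernel θ y * Real.log (a₁ y))) • fun k =>
      ‖Real.exp (∫ y, Real.log (v₀ y k / a₀ y) ∂stripMeasure (1 - θ))‖ ^ (1 - θ) *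
      ‖Real.exp (∫ y, Real.log (v₁ y k / a₁ y) ∂stripMeasure θ)‖ ^ θ := by
    ext k
    rw [Pi.smul_apply, smul_eq_mul, Real.exp_add, Real.exp_add,
      (exp_integral_stripKernel_log_mul h0' h1' (fun y => hv₀ y k) ha₀ (iv₀ k) ia₀).2,
      (exp_integral_stripKernel_log_mul h0 h1 (fun y => hv₁ y k) ha₁ (iv₁ k) ia₁).2,
      Real.norm_of_nonneg (Real.exp_pos _).le, Real.norm_of_nonneg (Real.exp_pos _).le]
    ring
  rw [e, eLpNorm_const_smul, Real.enorm_of_nonneg (Real.exp_pos _).le]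
  exact mul_le_of_le_one_right' hH

/-! ### Averages over countable partitions and their convergence. -/

/-- The average of `g` over the cell `π ⁻¹' {k}` of a countable partition. -/
noncomputable def cellAverage {X : Type*} [MeasurableSpace X] (ν : Measure X) (π : X → ℕ)
    (g : X → ℂ) (k : ℕ) : ℂ :=
  ⨍ x in π ⁻¹' {k}, g x ∂ν

/-- The explicit averages are scalar functions, to which complex analysis applies; their
identification with a conditional expectation makes them contractions of $L^q$ for $q\ge1$. Null
cells may be ignored. -/
theorem cellAverage_comp_ae_eq_condExp {X : Type*} [mX : MeasurableSpace X] {ν : Measure X}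
    [IsFiniteMeasure ν] {π : X → ℕ} (hπ : Measurable π) {g : X → ℂ} (hg : Integrable g ν) :
    (fun x => cellAverage ν π g (π x)) =ᵐ[ν] ν[g | MeasurableSpace.comap π ⊤] := by
  obtain ⟨a, -, ha⟩ := (stronglyMeasurable_condExp (μ := ν) (f := g)
    (m := MeasurableSpace.comap π ⊤)).exists_eq_measurable_comp
  have hm : MeasurableSpace.comap π ⊤ ≤ mX := hπ.comap_le
  have key : ∀ᵐ k ∂(ν.map π), cellAverage ν π g k = a k := by
    refine ae_iff_of_countable.2 fun k hk => ?_
    rw [Measure.map_apply hπ (measurableSet_singleton k)] at hk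
    have h1 : ∫ x in π ⁻¹' {k}, (ν[g | MeasurableSpace.comap π ⊤]) x ∂ν =
        ∫ x in π ⁻¹' {k}, g x ∂ν :=
      setIntegral_condExp hm hg ⟨{k}, trivial, rfl⟩
    have h2 : ∫ x in π ⁻¹' {k}, (ν[g | MeasurableSpace.comap π ⊤]) x ∂ν =
        ∫ x in π ⁻¹' {k}, a k ∂ν := by
      refine setIntegral_congr_fun (hπ (measurableSet_singleton k)) fun x hx => ?_
      have hx' : π x = k := hx
      simp only [ha, Function.comp_apply, hx']
    rw [cellAverage, setAverage_eq, ← h1, h2, setIntegral_const, smul_smul,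
      inv_mul_cancel₀, one_smul]
    exact (ENNReal.toReal_pos hk (measure_ne_top _ _)).ne'
  filter_upwards [ae_of_ae_map hπ.aemeasurable key] with x hx
  rw [hx, ha, Function.comp_apply]

theorem eLpNorm_cellAverage_comp_le {X : Type*} [MeasurableSpace X] {ν : Measure X}
    [IsFiniteMeasure ν] {π : X → ℕ} (hπ : Measurable π) {g : X → ℂ} (hg : Integrable g ν)
    {q : ℝ≥0∞} (hq : 1 ≤ q) :
    eLpNorm (fun x => cellAverage ν π g (π x)) q ν ≤ eLpNorm g q ν := by
  rw [eLpNorm_congr_ae (cellAverage_comp_ae_eq_condExp hπ hg)]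
  exact eLpNorm_condExp_le_eLpNorm g hq

/-- Averaging $\mathbb E$ fixes $h\circ\pi$, so $\mathbb Eg-g=\mathbb E(g-h\circ\pi)-(g-h\circ\pi)$,
and $\mathbb E$ contracts $L^1$. -/
theorem eLpNorm_cellAverage_comp_sub_le {X : Type*} [mX : MeasurableSpace X] {ν : Measure X}
    [IsFiniteMeasure ν] {π : X → ℕ} (hπ : Measurable π) {g : X → ℂ} (hg : Integrable g ν)
    {h : ℕ → ℂ} (hh : Integrable (fun x => h (π x)) ν) :
    eLpNorm (fun x => cellAverage ν π g (π x) - g x) 1 ν ≤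
      2 * eLpNorm (fun x => g x - h (π x)) 1 ν := by
  have hm : MeasurableSpace.comap π ⊤ ≤ mX := hπ.comap_le
  have hmeas : StronglyMeasurable[MeasurableSpace.comap π ⊤] fun x => h (π x) := by
    have : Measurable[MeasurableSpace.comap π ⊤] fun x => h (π x) :=
      (measurable_of_countable h).comp (comap_measurable π)
    exact this.stronglyMeasurable
  have e1 := condExp_sub hg hh (MeasurableSpace.comap π ⊤)
  rw [condExp_of_stronglyMeasurable hm hmeas hh] at e1
  have e2 : (fun x => cellAverage ν π g (π x) - g x) =ᵐ[ν]
      (ν[g - (fun x => h (π x)) | MeasurableSpace.comap π ⊤]) + fun x => -(g x - h (π x)) := by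
    filter_upwards [e1, cellAverage_comp_ae_eq_condExp hπ hg] with x hx hx2
    rw [Pi.add_apply, hx, hx2, Pi.sub_apply]
    ring
  rw [eLpNorm_congr_ae e2, two_mul]
  refine (eLpNorm_add_le integrable_condExp.aestronglyMeasurable
    (hg.sub hh).neg.aestronglyMeasurable le_rfl).trans (add_le_add ?_ (le_of_eq ?_))
  · exact eLpNorm_condExp_le_eLpNorm _ le_rfl
  · exact eLpNorm_neg _ _ _

theorem tendsto_eLpNorm_one_sub_of_tendsto {X : Type*} [MeasurableSpace X] {ν : Measure X}
    [IsFiniteMeasure ν] {F : ℕ → X → ℂ} {f : X → ℂ} {C : ℝ}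
    (hF : ∀ n, AEStronglyMeasurable (F n) ν) (hf : AEStronglyMeasurable f ν)
    (hC : ∀ n x, ‖F n x‖ ≤ C) (hlim : ∀ᵐ x ∂ν, Filter.Tendsto (fun n => F n x) Filter.atTop (nhds (f x))) :
    Filter.Tendsto (fun n => eLpNorm (F n - f) 1 ν) Filter.atTop (nhds 0) := by
  have hfC : ∀ᵐ x ∂ν, ‖f x‖ ≤ C := by
    filter_upwards [hlim] with x hx
    exact le_of_tendsto hx.norm (Filter.Eventually.of_forall fun n => hC n x)
  simp only [eLpNorm_one_eq_lintegral_enorm, Pi.sub_apply]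
  rw [← lintegral_zero (μ := ν)]
  refine tendsto_lintegral_of_dominated_convergence' (fun _ => ENNReal.ofReal (C + C))
    (fun n => ((hF n).sub hf).enorm) (fun n => ?_) ?_ ?_
  · filter_upwards [hfC] with x hx
    rw [← ofReal_norm]
    exact ENNReal.ofReal_le_ofReal ((norm_sub_le _ _).trans (add_le_add (hC n x) hx))
  · simp [ENNReal.mul_eq_top]
  · filter_upwards [hlim] with x hx
    have := (hx.sub_const (f x)).enorm
    simpa using this

/-- The σ-algebra may be larger than the Borel one, so density rests on the inner approximation
`hreg`. An indicator is replaced by that of a closed subset, and this one by thickened indicators.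
-/
theorem exists_bounded_continuous_eLpNorm_sub_le {X : Type*} [MetricSpace X] [MeasurableSpace X]
    [OpensMeasurableSpace X] {ν : Measure X} [IsFiniteMeasure ν]
    (hreg : ∀ A : Set X, MeasurableSet A → ∀ ε : ℝ≥0∞, ε ≠ 0 →
      ∃ C ⊆ A, IsClosed C ∧ ν (A \ C) ≤ ε)
    {g : X → ℂ} (hg : MemLp g 1 ν) {ε : ℝ≥0∞} (hε : ε ≠ 0) :
    ∃ u : X → ℂ, eLpNorm (g - u) 1 ν ≤ ε ∧ Continuous u ∧ ∃ C : ℝ, ∀ x, ‖u x‖ ≤ C := by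
  have hmeas : ∀ u : X → ℂ, Continuous u → AEStronglyMeasurable u ν := fun u hu =>
    hu.measurable.aestronglyMeasurable
  refine hg.induction_dense ENNReal.one_ne_top (fun u => Continuous u ∧ ∃ C : ℝ, ∀ x, ‖u x‖ ≤ C)
    ?_ ?_ (fun u hu => hmeas u hu.1) hε
  · intro c s hs _ ε hε
    have hε2 : ε / 2 ≠ 0 := by simpa using hε
    obtain ⟨η, ηpos, hη⟩ : ∃ η : NNReal, 0 < η ∧
        ∀ s : Set X, ν s ≤ η → eLpNorm (s.indicator fun _x => c) 1 ν ≤ ε / 2 :=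
      exists_eLpNorm_indicator_le ENNReal.one_ne_top c hε2
    obtain ⟨C, hCs, hCc, hC⟩ := hreg s hs η (by exact_mod_cast ηpos.ne')
    have I1 : eLpNorm ((C.indicator fun _ => c) - s.indicator fun _ => c) 1 ν ≤ ε / 2 := by
      rw [← eLpNorm_neg, neg_sub, ← indicator_sdiff hCs]
      exact hη _ hC
    have hδ : ∀ n : ℕ, (0 : ℝ) < 1 / ((n : ℝ) + 1) := fun n => by positivity
    have hb : ∀ n x, ‖((thickenedIndicator (hδ n) C x : ℝ) : ℂ) * c‖ ≤ ‖c‖ := by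
      intro n x
      rw [norm_mul, Complex.norm_real, Real.norm_of_nonneg (NNReal.coe_nonneg _)]
      exact mul_le_of_le_one_left (norm_nonneg _)
        (by exact_mod_cast thickenedIndicator_le_one (hδ n) C x)
    have hc : ∀ n, Continuous fun x => ((thickenedIndicator (hδ n) C x : ℝ) : ℂ) * c := fun n =>
      (Complex.continuous_ofReal.comp (NNReal.continuous_coe.comp
        (thickenedIndicator (hδ n) C).continuous)).mul continuous_const
    have hT := tendsto_eLpNorm_one_sub_of_tendsto (ν := ν) (f := C.indicator fun _ => c)
      (fun n => hmeas _ (hc n))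
      ((measurable_const.indicator hCc.measurableSet).aestronglyMeasurable) hb
      (Filter.Eventually.of_forall fun x => by
        have h1 := thickenedIndicator_tendsto_indicator_closure hδ
          tendsto_one_div_add_atTop_nhds_zero_nat C
        rw [hCc.closure_eq, tendsto_pi_nhds] at h1
        have h2 : Filter.Tendsto (fun n => ((thickenedIndicator (hδ n) C x : ℝ) : ℂ) * c)
            Filter.atTop (nhds ((((C.indicator (fun _ => (1 : NNReal)) x : NNReal) : ℝ) : ℂ) * c)) :=
          ((Complex.continuous_ofReal.comp NNReal.continuous_coe).tendsto _ |>.comp (h1 x)).mul_const c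
        convert h2 using 2
        by_cases hx : x ∈ C <;> simp [hx])
    obtain ⟨n, hn⟩ := (hT.eventually (ge_mem_nhds (pos_iff_ne_zero.2 hε2))).exists
    refine ⟨_, ?_, hc n, ‖c‖, hb n⟩
    rw [← sub_add_sub_cancel _ (C.indicator fun _ => c)]
    refine (eLpNorm_add_le ((hmeas _ (hc n)).sub
      (measurable_const.indicator hCc.measurableSet).aestronglyMeasurable)
      ((measurable_const.indicator hCc.measurableSet).aestronglyMeasurable.sub
      (measurable_const.indicator hs).aestronglyMeasurable) le_rfl).trans ?_
    exact (add_le_add hn I1).trans (ENNReal.add_halves ε).le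
  · rintro f g ⟨hf, C, hC⟩ ⟨hg, D, hD⟩
    exact ⟨hf.add hg, C + D, fun x => (norm_add_le _ _).trans (add_le_add (hC x) (hD x))⟩

theorem IsRegularMetricMeasure.measure_lt_top_of_isCompact {X : Type*} [MetricSpace X]
    [MeasurableSpace X] {μ : Measure X} (hμ : IsRegularMetricMeasure μ) {K : Set X}
    (hK : IsCompact K) : μ K < ∞ := by
  rcases K.eq_empty_or_nonempty with rfl | ⟨x, _⟩
  · simp
  · obtain ⟨r, hr⟩ := hK.isBounded.subset_ball x
    exact (measure_mono hr).trans_lt (hμ.ball_lt_top x r)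

theorem IsRegularMetricMeasure.exists_isCompact_diff_le {X : Type*} [MetricSpace X]
    [MeasurableSpace X] [OpensMeasurableSpace X] {μ : Measure X} (hμ : IsRegularMetricMeasure μ)
    {A : Set X} (hA : MeasurableSet A) (hA' : μ A < ∞) {ε : ℝ≥0∞} (hε : ε ≠ 0) :
    ∃ C ⊆ A, IsCompact C ∧ μ (A \ C) ≤ ε := by
  by_cases h0 : μ A = 0
  · exact ⟨∅, empty_subset _, isCompact_empty, by simp [h0]⟩
  have h1 : μ A - ε < ⨆ (K : Set X) (_ : K ⊆ A) (_ : IsCompact K), μ K := by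
    rw [← hμ.inner_regular A hA hA']
    exact ENNReal.sub_lt_self hA'.ne h0 hε
  simp only [lt_iSup_iff] at h1
  obtain ⟨C, hCA, hC, hlt⟩ := h1
  refine ⟨C, hCA, hC, ?_⟩
  rw [measure_sdiff hCA hC.measurableSet.nullMeasurableSet
    (hμ.measure_lt_top_of_isCompact hC).ne, tsub_le_iff_tsub_le]
  exact hlt.le

/-- On a compact set, the averages over the cells of a suitable sequence of finite partitions
converge in `L¹`. -/
theorem IsRegularMetricMeasure.exists_partitions {X : Type*} [MetricSpace X] [MeasurableSpace X]
    [OpensMeasurableSpace X] {μ : Measure X} (hμ : IsRegularMetricMeasure μ) {K : Set X}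
    (hK : IsCompact K) :
    ∃ π : ℕ → X → ℕ, (∀ n, Measurable (π n)) ∧ ∀ g : X → ℂ, IntegrableOn g K μ →
      Filter.Tendsto (fun n => eLpNorm (fun x => cellAverage (μ.restrict K) (π n) g (π n x) - g x) 1
        (μ.restrict K)) Filter.atTop (nhds 0) := by
  rcases K.eq_empty_or_nonempty with rfl | hne
  · exact ⟨fun _ _ => 0, fun _ => measurable_const, fun g _ => by simp⟩
  have : IsFiniteMeasure (μ.restrict K) :=
    ⟨by simpa using hμ.measure_lt_top_of_isCompact hK⟩
  have : Nonempty K := hne.to_subtype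
  have : CompactSpace K := isCompact_iff_compactSpace.1 hK
  set e : ℕ → X := fun n => (TopologicalSpace.denseSeq K n : K) with he
  have hdense : K ⊆ closure (range e) := by
    intro x hx
    have h1 := TopologicalSpace.denseRange_denseSeq K ⟨x, hx⟩
    have h2 := image_closure_subset_closure_image (s := range (TopologicalSpace.denseSeq K))
      (continuous_subtype_val (p := fun x => x ∈ K)) (mem_image_of_mem _ h1)
    rwa [← range_comp] at h2
  have hreg : ∀ A : Set X, MeasurableSet A → ∀ ε : ℝ≥0∞, ε ≠ 0 →
      ∃ C ⊆ A, IsClosed C ∧ μ.restrict K (A \ C) ≤ ε := by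
    intro A hA ε hε
    obtain ⟨C, hCA, hC, hle⟩ := hμ.exists_isCompact_diff_le (hA.inter hK.measurableSet)
      ((measure_mono inter_subset_right).trans_lt (hμ.measure_lt_top_of_isCompact hK)) hε
    refine ⟨C, hCA.trans inter_subset_left, hC.isClosed, ?_⟩
    rw [Measure.restrict_apply (hA.diff hC.measurableSet)]
    refine (measure_mono ?_).trans hle
    rintro x ⟨⟨h1, h2⟩, h3⟩
    exact ⟨⟨h1, h3⟩, h2⟩
  -- The cells collect the points with the same nearest point among $e_0,\dots,e_n$. For bounded
  -- continuous $u$ the function $u(\text{nearest point})$ is constant on cells and converges to $u$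
  -- on $K$ because $e$ is dense there.
  refine ⟨fun n => SimpleFunc.nearestPtInd e n, fun n => SimpleFunc.measurable _, fun g hg => ?_⟩
  rw [ENNReal.tendsto_nhds_zero]
  intro ε hε
  -- Two errors of size `ε / 4` are doubled by `eLpNorm_cellAverage_comp_sub_le`.
  have hε4 : ε / 4 ≠ 0 := by simpa using hε.ne'
  obtain ⟨u, hu, huc, C, huC⟩ := exists_bounded_continuous_eLpNorm_sub_le hreg
    (memLp_one_iff_integrable.2 hg) hε4
  have hum : AEStronglyMeasurable u (μ.restrict K) := huc.measurable.aestronglyMeasurable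
  have hnm : ∀ n, AEStronglyMeasurable (fun x => u (SimpleFunc.nearestPt e n x)) (μ.restrict K) :=
    fun n => (huc.measurable.comp (SimpleFunc.measurable _)).aestronglyMeasurable
  have hT := tendsto_eLpNorm_one_sub_of_tendsto (ν := μ.restrict K) (f := u)
    (F := fun n x => u (SimpleFunc.nearestPt e n x)) (C := C) hnm hum (fun n x => huC _) (by
      filter_upwards [ae_restrict_mem hK.measurableSet] with x hx
      exact (huc.tendsto x).comp (SimpleFunc.tendsto_nearestPt (hdense hx)))
  filter_upwards [hT.eventually (ge_mem_nhds (pos_iff_ne_zero.2 hε4))] with n hn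
  have hi : Integrable (fun x => u (SimpleFunc.nearestPt e n x)) (μ.restrict K) :=
    Integrable.of_bound (hnm n) C (Filter.Eventually.of_forall fun x => huC _)
  refine (eLpNorm_cellAverage_comp_sub_le (h := fun k => u (e k)) (SimpleFunc.measurable _) hg
    hi).trans ?_
  have h3 : eLpNorm (fun x => g x - u (e (SimpleFunc.nearestPtInd e n x))) 1 (μ.restrict K) ≤
      ε / 4 + ε / 4 := by
    have e1 : (fun x => g x - u (e (SimpleFunc.nearestPtInd e n x))) =
        (g - u) - ((fun x => u (SimpleFunc.nearestPt e n x)) - u) := by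
      ext x
      simp only [Pi.sub_apply]
      rw [sub_sub_sub_cancel_right]
      rfl
    rw [e1]
    exact (eLpNorm_sub_le (hg.aestronglyMeasurable.sub hum) ((hnm n).sub hum) le_rfl).trans
      (add_le_add hu hn)
  calc 2 * eLpNorm (fun x => g x - u (e (SimpleFunc.nearestPtInd e n x))) 1 (μ.restrict K)
      ≤ 2 * (ε / 4 + ε / 4) := by gcongr
    _ = ε := by
      have : (4 : ℝ≥0∞) = 2 * 2 := by norm_num
      rw [← two_mul, ← mul_assoc, ← this, ENNReal.mul_div_cancel (by simp) (by simp)]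

theorem eLpNorm_map_comp_of_countable {X α E : Type*} [MeasurableSpace X] [MeasurableSpace α]
    [Countable α] [MeasurableSingletonClass α] [NormedAddCommGroup E] [MeasurableSpace E]
    [BorelSpace E] [SecondCountableTopology E] {ν : Measure X} {π : X → α} (hπ : Measurable π)
    (u : α → E) (r : ℝ≥0∞) :
    eLpNorm u r (ν.map π) = eLpNorm (fun x => u (π x)) r ν :=
  eLpNorm_map_measure (measurable_of_countable u).aestronglyMeasurable hπ.aemeasurable

/-! ### Majorants for the norms of truncated cell averages. -/

/-- Since $1+D\le e^{D}\le e^{DE}$, a constant factor is absorbed into the exponent, and the class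
of doubly exponential growth is stable under it. -/
theorem le_exp_of_le_mul_exp {t C D E : ℝ} (hD : 0 ≤ D) (hE : 1 ≤ E)
    (h : t ≤ (1 + D) * Real.exp (C * E)) : t ≤ Real.exp ((C + D) * E) := by
  refine h.trans ?_
  have h1 : 1 + D ≤ Real.exp (D * E) := by
    have := Real.add_one_le_exp (D * E)
    nlinarith
  rw [add_mul C D E, Real.exp_add, mul_comm (Real.exp (C * E))]
  exact mul_le_mul_of_nonneg_right h1 (Real.exp_pos _).le

theorem eLpNorm_max_norm_le_add {X : Type*} [MeasurableSpace X] {ν : Measure X} {r : ℝ≥0∞}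
    (hr : 1 ≤ r) {f : X → ℂ} (hf : AEStronglyMeasurable f ν) {δ : ℝ} (hδ : 0 ≤ δ) :
    eLpNorm (fun x => max ‖f x‖ δ) r ν ≤
      eLpNorm f r ν + ν univ ^ r.toReal⁻¹ * ENNReal.ofReal δ := by
  have h1 : eLpNorm (fun x => max ‖f x‖ δ) r ν ≤ eLpNorm ((fun x => ‖f x‖) + fun _ => δ) r ν := by
    refine eLpNorm_mono fun x => ?_
    rw [Real.norm_of_nonneg (hδ.trans (le_max_right _ _)), Pi.add_apply,
      Real.norm_of_nonneg (add_nonneg (norm_nonneg _) hδ)]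
    exact max_le (le_add_of_nonneg_right hδ) (le_add_of_nonneg_left (norm_nonneg _))
  refine h1.trans ((eLpNorm_add_le hf.norm aestronglyMeasurable_const hr).trans (add_le_add ?_ ?_))
  · rw [eLpNorm_norm]
  · exact eLpNorm_le_of_ae_bound (Filter.Eventually.of_forall fun _ =>
      (Real.norm_of_nonneg hδ).le)

/-- For $r\le1$ the power $t\mapsto t^r$ is subadditive; this replaces the triangle inequality. -/
theorem eLpNorm_rpow_le_add_of_enorm_le {X E F G : Type*} [MeasurableSpace X]
    [NormedAddCommGroup E] [NormedAddCommGroup F] [NormedAddCommGroup G]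
    {ν : Measure X} {r : ℝ≥0∞} (hr0 : r ≠ 0) (hr1 : r ≤ 1) {f : X → E} {g : X → F} {h : X → G}
    (hg : AEStronglyMeasurable g ν) (hle : ∀ x, ‖f x‖ₑ ≤ ‖g x‖ₑ + ‖h x‖ₑ) :
    eLpNorm f r ν ^ r.toReal ≤ eLpNorm g r ν ^ r.toReal + eLpNorm h r ν ^ r.toReal := by
  have hrt : r ≠ ∞ := ne_top_of_le_ne_top ENNReal.one_ne_top hr1
  have hpos := ENNReal.toReal_pos hr0 hrt
  have hle1 : r.toReal ≤ 1 := ENNReal.toReal_le_of_le_ofReal zero_le_one (by simpa using hr1)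
  have e' : eLpNorm f r ν ^ r.toReal = ∫⁻ x, ‖f x‖ₑ ^ r.toReal ∂ν := by
    rw [eLpNorm_eq_lintegral_rpow_enorm_toReal hr0 hrt, one_div, ENNReal.rpow_inv_rpow hpos.ne']
  have e'' : eLpNorm g r ν ^ r.toReal = ∫⁻ x, ‖g x‖ₑ ^ r.toReal ∂ν := by
    rw [eLpNorm_eq_lintegral_rpow_enorm_toReal hr0 hrt, one_div, ENNReal.rpow_inv_rpow hpos.ne']
  have e3 : eLpNorm h r ν ^ r.toReal = ∫⁻ x, ‖h x‖ₑ ^ r.toReal ∂ν := by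
    rw [eLpNorm_eq_lintegral_rpow_enorm_toReal hr0 hrt, one_div, ENNReal.rpow_inv_rpow hpos.ne']
  rw [e', e'', e3, ← lintegral_add_left' (hg.enorm.pow_const _)]
  exact lintegral_mono fun x => (ENNReal.rpow_le_rpow (hle x) hpos.le).trans
    (ENNReal.rpow_add_le_add_rpow _ _ hpos.le hle1)

/-- On a countable space the norm is a power of a series of measurable terms. It is needed when
$r<1$, where the majorants are built from the norms themselves. -/
theorem measurable_eLpNorm_of_countable {Y α : Type*} [MeasurableSpace Y] [MeasurableSpace α]
    [Countable α] [MeasurableSingletonClass α] {ρ : Measure α} {r : ℝ≥0∞} (hr0 : r ≠ 0)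
    (hrt : r ≠ ∞) {v : Y → α → ℝ} (hv : ∀ k, Measurable fun y => v y k) :
    Measurable fun y => eLpNorm (v y) r ρ := by
  simp only [eLpNorm_eq_lintegral_rpow_enorm_toReal hr0 hrt, lintegral_countable']
  exact (Measurable.tsum fun k => ((hv k).enorm.pow_const _).mul_const _).pow_const _

/-- The truncated `L^r` norms of the cell averages of `g y` admit measurable majorants which
converge to a given majorant of the `L^r` norm of `g y`. -/
theorem exists_majorants_of_cellAverage {X : Type*} [MeasurableSpace X] {ν : Measure X}
    [IsFiniteMeasure ν] {π : ℕ → X → ℕ} (hπ : ∀ n, Measurable (π n)) {g : ℝ → X → ℂ}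
    (hg : ∀ y, Integrable (g y) ν)
    (hlim : ∀ y, Filter.Tendsto
      (fun n => eLpNorm (fun x => cellAverage ν (π n) (g y) (π n x) - g y x) 1 ν)
      Filter.atTop (nhds 0))
    (hmeas : ∀ n k, Measurable fun y => cellAverage ν (π n) (g y) k)
    {N : ℝ → ℝ} (hN : Measurable N) (hN0 : ∀ y, 0 ≤ N y) {C γ : ℝ} (hC : 0 ≤ C) (hγ : 0 ≤ γ)
    (hNC : ∀ y, N y ≤ Real.exp (C * Real.exp (γ * |y|)))
    (hgC : ∀ y, eLpNorm (g y) 1 ν ≤ ENNReal.ofReal (Real.exp (C * Real.exp (γ * |y|))))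
    {r : ℝ≥0∞} (hr : r ≠ 0) (hgN : ∀ y, eLpNorm (g y) r ν ≤ ENNReal.ofReal (N y))
    {δ : ℕ → ℝ} (hδ0 : ∀ n, 0 < δ n) (hδ1 : ∀ n, δ n ≤ 1)
    (hδ : Filter.Tendsto δ Filter.atTop (nhds 0)) :
    ∃ b : ℕ → ℝ → ℝ, (∀ n, Measurable (b n)) ∧
      (∃ D : ℝ, 0 ≤ D ∧ ∀ n y, b n y ≤ Real.exp (D * Real.exp (γ * |y|))) ∧
      (∀ n y, eLpNorm (fun k => max ‖cellAverage ν (π n) (g y) k‖ (δ n)) r (ν.map (π n)) ≤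
        ENNReal.ofReal (b n y)) ∧
      ∀ y, Filter.Tendsto (fun n => b n y) Filter.atTop (nhds (N y)) := by
  have hE : ∀ y : ℝ, 1 ≤ Real.exp (γ * |y|) := fun y => Real.one_le_exp (by positivity)
  have hexp : ∀ y : ℝ, 1 ≤ Real.exp (C * Real.exp (γ * |y|)) := fun y =>
    Real.one_le_exp (by positivity)
  have hcm : ∀ n y, AEStronglyMeasurable (fun x => cellAverage ν (π n) (g y) (π n x)) ν :=
    fun n y => ((measurable_of_countable (cellAverage ν (π n) (g y))).comp
      (hπ n)).aestronglyMeasurable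
  have hVW : ∀ e : ℝ, 0 ≤ e → ν univ ^ e ≠ ∞ := fun e he =>
    ENNReal.rpow_ne_top_of_nonneg he (measure_ne_top _ _)
  have hE1 : ∀ n y, eLpNorm (fun x => max ‖cellAverage ν (π n) (g y) (π n x)‖ (δ n)) 1 ν ≤
      ENNReal.ofReal (Real.exp (C * Real.exp (γ * |y|)) + (ν univ).toReal) := by
    intro n y
    refine (eLpNorm_max_norm_le_add le_rfl (hcm n y) (hδ0 n).le).trans ?_
    rw [ENNReal.ofReal_add (Real.exp_pos _).le ENNReal.toReal_nonneg,
      ENNReal.ofReal_toReal (measure_ne_top _ _)]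
    refine add_le_add ((eLpNorm_cellAverage_comp_le (hπ n) (hg y) le_rfl).trans (hgC y)) ?_
    rw [ENNReal.toReal_one, inv_one, ENNReal.rpow_one]
    exact mul_le_of_le_one_right' (ENNReal.ofReal_le_one.2 (hδ1 n))
  -- For $r\ge1$ averaging contracts $L^r$, and the truncation costs only $\delta_n\,\nu(X)^{1/r}$,
  -- which gives the majorant explicitly.
  rcases le_or_gt 1 r with h1 | h1
  · have hD := hVW r.toReal⁻¹ (by positivity)
    refine ⟨fun n y => N y + δ n * (ν univ ^ r.toReal⁻¹).toReal, fun n => hN.add_const _,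
      ⟨C + (ν univ ^ r.toReal⁻¹).toReal, by positivity, fun n y => ?_⟩, fun n y => ?_, fun y => ?_⟩
    · refine le_exp_of_le_mul_exp ENNReal.toReal_nonneg (hE y) ?_
      have := hNC y
      have h3 : δ n * (ν univ ^ r.toReal⁻¹).toReal ≤
          (ν univ ^ r.toReal⁻¹).toReal * Real.exp (C * Real.exp (γ * |y|)) := by
        rw [mul_comm]
        exact mul_le_mul_of_nonneg_left ((hδ1 n).trans (hexp y)) ENNReal.toReal_nonneg
      linarith
    · rw [eLpNorm_map_comp_of_countable (hπ n)]
      refine (eLpNorm_max_norm_le_add h1 (hcm n y) (hδ0 n).le).trans ?_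
      rw [ENNReal.ofReal_add (hN0 y) (mul_nonneg (hδ0 n).le ENNReal.toReal_nonneg),
        ENNReal.ofReal_mul (hδ0 n).le, ENNReal.ofReal_toReal hD, mul_comm (ENNReal.ofReal (δ n))]
      exact add_le_add_left ((eLpNorm_cellAverage_comp_le (hπ n) (hg y) h1).trans (hgN y)) _
    · simpa using (hδ.mul_const (ν univ ^ r.toReal⁻¹).toReal).const_add (N y)
  · have hrt : r ≠ ∞ := h1.ne_top
    have hpos := ENNReal.toReal_pos hr hrt
    -- For $r<1$ averaging need not contract $L^r$. The norms are instead controlled through $L^1$,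
    -- with `w` the Hölder constant from $L^1$ to $L^r$. The majorant is the norm itself, raised to
    -- at least `N y` so that it can be squeezed to that limit.
    set w := ν univ ^ (1 / r.toReal - 1 / (1 : ℝ≥0∞).toReal) with hw
    have hwt : w ≠ ∞ := by
      refine hVW _ ?_
      have : r.toReal ≤ 1 := ENNReal.toReal_le_of_le_ofReal zero_le_one (by simpa using h1.le)
      rw [ENNReal.toReal_one, sub_nonneg]
      exact one_div_le_one_div_of_le hpos this
    have hcmp : ∀ (f : X → ℝ), AEStronglyMeasurable f ν → eLpNorm f r ν ≤ eLpNorm f 1 ν * w :=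
      fun f hf => eLpNorm_le_eLpNorm_mul_rpow_measure_univ h1.le hf
    set E : ℕ → ℝ → ℝ≥0∞ := fun n y =>
      eLpNorm (fun k => max ‖cellAverage ν (π n) (g y) k‖ (δ n)) r (ν.map (π n)) with hEdef
    have hEbd : ∀ n y, E n y ≤ ENNReal.ofReal
        ((Real.exp (C * Real.exp (γ * |y|)) + (ν univ).toReal) * w.toReal) := by
      intro n y
      rw [ENNReal.ofReal_mul (by positivity), ENNReal.ofReal_toReal hwt, hEdef]
      simp only [eLpNorm_map_comp_of_countable (hπ n)]
      refine (hcmp _ ?_).trans (mul_le_mul_left (hE1 n y) _)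
      exact (hcm n y).norm.sup aestronglyMeasurable_const
    have hEt : ∀ n y, E n y ≠ ∞ := fun n y => ne_top_of_le_ne_top ENNReal.ofReal_ne_top (hEbd n y)
    refine ⟨fun n y => max (E n y).toReal (N y), fun n => ?_, ⟨C + (w.toReal + (ν univ).toReal *
      w.toReal), by positivity, fun n y => ?_⟩, fun n y => ?_, fun y => ?_⟩
    · refine Measurable.max (Measurable.ennreal_toReal ?_) hN
      exact measurable_eLpNorm_of_countable hr hrt fun k => (hmeas n k).norm.max measurable_const
    · refine le_exp_of_le_mul_exp (by positivity) (hE y) (max_le ?_ ?_)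
      · refine (ENNReal.toReal_le_of_le_ofReal (by positivity) (hEbd n y)).trans ?_
        have h3 := hexp y
        have : (0 : ℝ) ≤ w.toReal := ENNReal.toReal_nonneg
        have : (ν univ).toReal * w.toReal ≤
            (ν univ).toReal * w.toReal * Real.exp (C * Real.exp (γ * |y|)) :=
          le_mul_of_one_le_right (by positivity) h3
        nlinarith
      · refine (hNC y).trans (le_mul_of_one_le_left (Real.exp_pos _).le ?_)
        have : 0 ≤ w.toReal + (ν univ).toReal * w.toReal := by positivity
        linarith
    · refine le_trans ?_ (ENNReal.ofReal_le_ofReal (le_max_left _ _))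
      rw [ENNReal.ofReal_toReal (hEt n y)]
    · set t : ℕ → ℝ≥0∞ := fun n => (eLpNorm (fun x => cellAverage ν (π n) (g y) (π n x) - g y x) 1 ν
        + ν univ ^ (1 : ℝ≥0∞).toReal⁻¹ * ENNReal.ofReal (δ n)) * w with ht
      have ht0 : Filter.Tendsto t Filter.atTop (nhds 0) := by
        have h3 : Filter.Tendsto (fun n => ENNReal.ofReal (δ n)) Filter.atTop (nhds 0) := by
          simpa using ENNReal.tendsto_ofReal hδ
        have h4 := ENNReal.Tendsto.const_mul h3 (Or.inr (hVW (1 : ℝ≥0∞).toReal⁻¹ (by simp)))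
        have h5 := ENNReal.Tendsto.mul_const ((hlim y).add h4) (Or.inr hwt)
        simpa only [mul_zero, add_zero, zero_mul] using h5
      have hEle : ∀ n, E n y ≤ (ENNReal.ofReal (N y) ^ r.toReal + t n ^ r.toReal) ^ r.toReal⁻¹ := by
        intro n
        rw [ENNReal.le_rpow_inv_iff hpos, hEdef]
        simp only [eLpNorm_map_comp_of_countable (hπ n)]
        refine (eLpNorm_rpow_le_add_of_enorm_le hr h1.le (hg y).aestronglyMeasurable
          (h := fun x => max ‖cellAverage ν (π n) (g y) (π n x) - g y x‖ (δ n) ) fun x => ?_).trans ?_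
        · rw [← ofReal_norm, ← ofReal_norm, ← ofReal_norm,
            ← ENNReal.ofReal_add (norm_nonneg _) (norm_nonneg _),
            Real.norm_of_nonneg ((hδ0 n).le.trans (le_max_right _ _)),
            Real.norm_of_nonneg ((hδ0 n).le.trans (le_max_right _ _))]
          refine ENNReal.ofReal_le_ofReal (max_le ?_ ?_)
          · refine (norm_le_norm_add_norm_sub' _ (g y x)).trans ?_
            gcongr
            exact le_max_left _ _
          · exact (le_max_right _ _).trans (le_add_of_nonneg_left (norm_nonneg _))
        · have hsub := (hcm n y).sub (hg y).aestronglyMeasurable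
          refine add_le_add (ENNReal.rpow_le_rpow (hgN y) hpos.le) (ENNReal.rpow_le_rpow ?_ hpos.le)
          exact (hcmp _ (hsub.norm.sup aestronglyMeasurable_const)).trans
            (mul_le_mul_left (eLpNorm_max_norm_le_add le_rfl hsub (hδ0 n).le) w)
      have hlimU : Filter.Tendsto
          (fun n => max ((ENNReal.ofReal (N y) ^ r.toReal + t n ^ r.toReal) ^ r.toReal⁻¹).toReal
            (N y)) Filter.atTop (nhds (N y)) := by
        have h6 : Filter.Tendsto (fun n => (ENNReal.ofReal (N y) ^ r.toReal + t n ^ r.toReal) ^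
            r.toReal⁻¹) Filter.atTop (nhds (ENNReal.ofReal (N y))) := by
          have := ((ht0.ennrpow_const r.toReal).const_add
            (ENNReal.ofReal (N y) ^ r.toReal)).ennrpow_const r.toReal⁻¹
          rwa [ENNReal.zero_rpow_of_pos hpos, add_zero, ENNReal.rpow_rpow_inv hpos.ne'] at this
        have h7 := ((ENNReal.tendsto_toReal ENNReal.ofReal_ne_top).comp h6).max
          (tendsto_const_nhds (x := N y))
        rwa [ENNReal.toReal_ofReal (hN0 y), max_self] at h7
      refine tendsto_of_tendsto_of_tendsto_of_le_of_le' tendsto_const_nhds hlimU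
        (Filter.Eventually.of_forall fun n => le_max_right _ _) ?_
      have hfin : ∀ᶠ n in Filter.atTop, t n < ∞ := ht0.eventually (gt_mem_nhds ENNReal.zero_lt_top)
      filter_upwards [hfin] with n hn
      refine max_le_max (ENNReal.toReal_mono ?_ (hEle n)) le_rfl
      refine ENNReal.rpow_ne_top_of_nonneg (by positivity) (ENNReal.add_ne_top.2 ⟨?_, ?_⟩)
      · exact ENNReal.rpow_ne_top_of_nonneg hpos.le ENNReal.ofReal_ne_top
      · exact ENNReal.rpow_ne_top_of_nonneg hpos.le hn.ne

/-! ### Interpolation for weakly analytic families of functions. -/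

/-- The integrals of the family `G` against bounded measurable functions of compact support are
analytic in the open strip and continuous on the closed strip. -/
def IsWeaklyAnalytic {X : Type*} [TopologicalSpace X] [MeasurableSpace X] (μ : Measure X)
    (G : ℂ → X → ℂ) : Prop :=
  ∀ w : X → ℂ, Measurable w → (∃ R : ℝ, ∀ x, ‖w x‖ ≤ R) → HasCompactSupport w →
    DifferentiableOn ℂ (fun z => ∫ x, G z x * w x ∂μ) openStrip ∧
    ContinuousOn (fun z => ∫ x, G z x * w x ∂μ) closedStrip

/-- The average is the pairing with a normalized indicator, which is bounded and supported in `K`,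
hence an admissible test function. On a null cell the inverse is `0` and both sides vanish. -/
theorem cellAverage_restrict_eq_integral_mul {X : Type*} [MeasurableSpace X] (μ : Measure X)
    {K : Set X} (hK : MeasurableSet K) {π : X → ℕ} (hπ : Measurable π) (g : X → ℂ) (k : ℕ) :
    cellAverage (μ.restrict K) π g k = ∫ x, g x * (π ⁻¹' {k} ∩ K).indicator
      (fun _ => ((((μ.restrict K).real (π ⁻¹' {k}))⁻¹ : ℝ) : ℂ)) x ∂μ := by
  have hc : MeasurableSet (π ⁻¹' {k}) := hπ (measurableSet_singleton k)
  rw [cellAverage, setAverage_eq, Measure.restrict_restrict hc, ← integral_smul,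
    ← integral_indicator (hc.inter hK)]
  congr 1
  ext x
  by_cases hx : x ∈ π ⁻¹' {k} ∩ K
  · simp only [indicator_of_mem hx, Complex.real_smul, mul_comm]
  · simp only [indicator_of_notMem hx, mul_zero]

theorem IsWeaklyAnalytic.analytic_cellAverage {X : Type*} [MetricSpace X] [MeasurableSpace X]
    [OpensMeasurableSpace X] {μ : Measure X} {G : ℂ → X → ℂ} (hG : IsWeaklyAnalytic μ G)
    {K : Set X} (hK : IsCompact K) {π : X → ℕ} (hπ : Measurable π) (k : ℕ) :
    DifferentiableOn ℂ (fun z => cellAverage (μ.restrict K) π (G z) k) openStrip ∧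
    ContinuousOn (fun z => cellAverage (μ.restrict K) π (G z) k) closedStrip := by
  simp only [cellAverage_restrict_eq_integral_mul μ hK.measurableSet hπ]
  refine hG _ (measurable_const.indicator ((hπ (measurableSet_singleton k)).inter hK.measurableSet))
    ⟨_, fun x => norm_indicator_le_norm_self _ _⟩ (HasCompactSupport.intro hK fun x hx => ?_)
  exact indicator_of_notMem (fun h => hx h.2) _

theorem norm_cellAverage_le {X : Type*} [MeasurableSpace X] {ν : Measure X} {π : X → ℕ} {g : X → ℂ}
    (hg : Integrable g ν) (k : ℕ) {R : ℝ} (hR : 0 ≤ R) (h : eLpNorm g 1 ν ≤ ENNReal.ofReal R) :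
    ‖cellAverage ν π g k‖ ≤ (ν.real (π ⁻¹' {k}))⁻¹ * R := by
  rw [cellAverage, setAverage_eq, norm_smul, Real.norm_of_nonneg (by positivity)]
  refine mul_le_mul_of_nonneg_left ?_ (by positivity)
  refine (norm_integral_le_integral_norm _).trans ((setIntegral_le_integral hg.norm
    (Filter.Eventually.of_forall fun x => norm_nonneg _)).trans ?_)
  rw [integral_norm_eq_lintegral_enorm hg.aestronglyMeasurable, ← eLpNorm_one_eq_lintegral_enorm]
  exact ENNReal.toReal_le_of_le_ofReal hR h

/-- Hirschman's lemma is applied on each cell separately, then the geometric means are interpolated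
over the countable space of cells. The growth constant depends on the cell, which is harmless
because it does not enter Hirschman's bound. -/
theorem eLpNorm_cellAverage_le_exp {X : Type*} [MetricSpace X] [MeasurableSpace X]
    [OpensMeasurableSpace X] {μ : Measure X} {G : ℂ → X → ℂ} (hG : IsWeaklyAnalytic μ G)
    {K : Set X} (hK : IsCompact K) {C γ : ℝ} (hC : 0 ≤ C) (hγ0 : 0 ≤ γ) (hγ : γ < Real.pi)
    (hGi : ∀ z, IntegrableOn (G z) K μ)
    (hGC : ∀ z ∈ closedStrip, eLpNorm (G z) 1 (μ.restrict K) ≤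
      ENNReal.ofReal (Real.exp (C * Real.exp (γ * |z.im|))))
    {q₀ q₁ q : ℝ≥0∞} {θ : ℝ} (h0 : 0 < θ) (h1 : θ < 1) (hq₀ : q₀ ≠ 0) (hq₁ : q₁ ≠ 0)
    (hq : 1 / q = ENNReal.ofReal (1 - θ) / q₀ + ENNReal.ofReal θ / q₁)
    {π : X → ℕ} (hπ : Measurable π) {δ : ℝ} (hδ : 0 < δ) {a₀ a₁ : ℝ → ℝ}
    (ha₀ : ∀ y, 0 < a₀ y) (ha₁ : ∀ y, 0 < a₁ y)
    (ia₀ : Integrable fun y => stripKernel (1 - θ) y * Real.log (a₀ y))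
    (ia₁ : Integrable fun y => stripKernel θ y * Real.log (a₁ y))
    (hb₀ : ∀ y : ℝ, eLpNorm (fun k => max ‖cellAverage (μ.restrict K) π (G (y * Complex.I)) k‖ δ) q₀
      ((μ.restrict K).map π) ≤ ENNReal.ofReal (a₀ y))
    (hb₁ : ∀ y : ℝ, eLpNorm (fun k => max ‖cellAverage (μ.restrict K) π (G (1 + y * Complex.I)) k‖ δ)
      q₁ ((μ.restrict K).map π) ≤ ENNReal.ofReal (a₁ y)) :
    eLpNorm (cellAverage (μ.restrict K) π (G θ)) q ((μ.restrict K).map π) ≤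
      ENNReal.ofReal (Real.exp ((∫ y, stripKernel (1 - θ) y * Real.log (a₀ y)) +
        ∫ y, stripKernel θ y * Real.log (a₁ y))) := by
  have hgr : ∀ k, ∀ z ∈ closedStrip, ‖cellAverage (μ.restrict K) π (G z) k‖ ≤
      Real.exp ((C + ((μ.restrict K).real (π ⁻¹' {k}))⁻¹) * Real.exp (γ * |z.im|)) := by
    intro k z hz
    refine le_exp_of_le_mul_exp (by positivity) (Real.one_le_exp (by positivity)) ?_
    refine (norm_cellAverage_le (hGi z) k (Real.exp_pos _).le (hGC z hz)).trans ?_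
    gcongr
    linarith
  have hD : ∀ k, 0 ≤ C + ((μ.restrict K).real (π ⁻¹' {k}))⁻¹ := fun k => by positivity
  have hcont := fun k => (hG.analytic_cellAverage hK hπ k).2
  refine le_trans (eLpNorm_mono fun k => ?_) (eLpNorm_exp_integral_stripKernel_le h0 h1 hq₀ hq₁ hq
    (v₀ := fun y k => max ‖cellAverage (μ.restrict K) π (G (y * Complex.I)) k‖ δ)
    (v₁ := fun y k => max ‖cellAverage (μ.restrict K) π (G (1 + y * Complex.I)) k‖ δ)
    (fun y k => lt_max_of_lt_right hδ) (fun y k => lt_max_of_lt_right hδ) ha₀ ha₁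
    (fun k => ?_) (fun k => ?_) ia₀ ia₁ hb₀ hb₁)
  · rw [Real.norm_of_nonneg (Real.exp_pos _).le]
    by_cases hF : cellAverage (μ.restrict K) π (G θ) k = 0
    · rw [hF, norm_zero]; exact (Real.exp_pos _).le
    · rw [← Real.log_le_iff_le_exp (norm_pos_iff.2 hF)]
      exact log_norm_le_integral_stripKernel
        (F := fun z => cellAverage (μ.restrict K) π (G z) k) h0 h1 hδ hγ0 hγ (hD k)
        (hG.analytic_cellAverage hK hπ k).1 (hcont k) (hgr k) hF
  · refine integrable_stripKernel_mul_log_max_of_growth (by linarith) (by linarith) hδ hγ (hD k)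
      ((hcont k).comp_continuous (by fun_prop) mul_I_mem_closedStrip).norm.measurable fun y => ?_
    simpa using hgr k _ (mul_I_mem_closedStrip y)
  · refine integrable_stripKernel_mul_log_max_of_growth h0 h1 hδ hγ (hD k)
      ((hcont k).comp_continuous (by fun_prop) one_add_mul_I_mem_closedStrip).norm.measurable
      fun y => ?_
    simpa using hgr k _ (one_add_mul_I_mem_closedStrip y)

/-- The floor `η` and the uniform growth bound provide a majorant integrable against the kernel. -/
theorem tendsto_integral_stripKernel_mul_log_max {x D γ η : ℝ} (h0 : 0 < x) (h1 : x < 1)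
    (hη : 0 < η) (hγ : γ < Real.pi) (hD : 0 ≤ D) {b : ℕ → ℝ → ℝ} {N : ℝ → ℝ}
    (hb : ∀ n, Measurable (b n)) (hbD : ∀ n y, b n y ≤ Real.exp (D * Real.exp (γ * |y|)))
    (hlim : ∀ y, Filter.Tendsto (fun n => b n y) Filter.atTop (nhds (N y))) :
    Filter.Tendsto (fun n => ∫ y, stripKernel x y * Real.log (max (b n y) η)) Filter.atTop
      (nhds (∫ y, stripKernel x y * Real.log (max (N y) η))) := by
  refine tendsto_integral_of_dominated_convergence
    (fun y => stripKernel x y * (|Real.log η| + D * Real.exp (γ * |y|))) (fun n => ?_) ?_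
    (fun n => ?_) ?_
  · exact (integrable_stripKernel_mul_log_max_of_growth h0 h1 hη hγ hD (hb n)
      (hbD n)).aestronglyMeasurable
  · refine integrable_stripKernel_mul_of_abs_le_exp (A := |Real.log η|) (C := D) h0 h1 hγ
      (by fun_prop) fun y => ?_
    rw [abs_of_nonneg (by positivity)]
  · refine Filter.Eventually.of_forall fun y => ?_
    rw [norm_mul, Real.norm_of_nonneg (stripKernel_pos h0 h1 y).le]
    exact mul_le_mul_of_nonneg_left (abs_log_max_le_exp hη hD (hbD n y))
      (stripKernel_pos h0 h1 y).le
  · refine Filter.Eventually.of_forall fun y => Filter.Tendsto.const_mul _ ?_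
    exact ((hlim y).max tendsto_const_nhds).log (lt_max_of_lt_right hη).ne'

/-- Interpolation for a weakly analytic family of functions, on a compact set. -/
theorem IsWeaklyAnalytic.eLpNorm_restrict_le {X : Type*} [MetricSpace X] [MeasurableSpace X]
    [OpensMeasurableSpace X] {μ : Measure X} (hμ : IsRegularMetricMeasure μ) {G : ℂ → X → ℂ}
    (hG : IsWeaklyAnalytic μ G)
    {K : Set X} (hK : IsCompact K) {C γ : ℝ} (hC : 0 ≤ C) (hγ0 : 0 ≤ γ) (hγ : γ < Real.pi)
    (hGi : ∀ z, IntegrableOn (G z) K μ)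
    (hGC : ∀ z ∈ closedStrip, eLpNorm (G z) 1 (μ.restrict K) ≤
      ENNReal.ofReal (Real.exp (C * Real.exp (γ * |z.im|))))
    {q₀ q₁ q : ℝ≥0∞} {θ : ℝ} (h0 : 0 < θ) (h1 : θ < 1) (hq₀ : q₀ ≠ 0) (hq₁ : q₁ ≠ 0)
    (hq : 1 / q = ENNReal.ofReal (1 - θ) / q₀ + ENNReal.ofReal θ / q₁)
    {N₀ N₁ : ℝ → ℝ} (hN₀m : Measurable N₀) (hN₁m : Measurable N₁)
    (hN₀ : ∀ y, 0 ≤ N₀ y) (hN₁ : ∀ y, 0 ≤ N₁ y)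
    (hN₀C : ∀ y, N₀ y ≤ Real.exp (C * Real.exp (γ * |y|)))
    (hN₁C : ∀ y, N₁ y ≤ Real.exp (C * Real.exp (γ * |y|)))
    (hb₀ : ∀ y : ℝ, eLpNorm (G (y * Complex.I)) q₀ (μ.restrict K) ≤ ENNReal.ofReal (N₀ y))
    (hb₁ : ∀ y : ℝ, eLpNorm (G (1 + y * Complex.I)) q₁ (μ.restrict K) ≤ ENNReal.ofReal (N₁ y))
    {η₀ η₁ : ℝ} (hη₀ : 0 < η₀) (hη₁ : 0 < η₁) :
    eLpNorm (G θ) q (μ.restrict K) ≤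
      ENNReal.ofReal (Real.exp ((∫ y, stripKernel (1 - θ) y * Real.log (max (N₀ y) η₀)) +
        ∫ y, stripKernel θ y * Real.log (max (N₁ y) η₁))) := by
  have : IsFiniteMeasure (μ.restrict K) := ⟨by simpa using hμ.measure_lt_top_of_isCompact hK⟩
  have h0' : 0 < 1 - θ := by linarith
  have h1' : 1 - θ < 1 := by linarith
  obtain ⟨π, hπ, hlim⟩ := hμ.exists_partitions hK
  -- The truncation level of the averages tends to $0$ with the partitions, while the floors `η₀`,
  -- `η₁` of the boundary majorants stay fixed.
  set δ : ℕ → ℝ := fun n => 1 / ((n : ℝ) + 1) with hδ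
  have hδ0 : ∀ n, 0 < δ n := fun n => by positivity
  have hδ1 : ∀ n, δ n ≤ 1 := fun n => by
    rw [hδ, div_le_one (by positivity)]
    exact le_add_of_nonneg_left (Nat.cast_nonneg n)
  have hδl : Filter.Tendsto δ Filter.atTop (nhds 0) := tendsto_one_div_add_atTop_nhds_zero_nat
  obtain ⟨b₀, hb₀m, ⟨D₀, hD₀, hbD₀⟩, hbb₀, hbl₀⟩ := exists_majorants_of_cellAverage hπ
    (g := fun y => G (y * Complex.I)) (fun y => hGi _) (fun y => hlim _ (hGi _))
    (fun n k => (((hG.analytic_cellAverage hK (hπ n) k).2).comp_continuous (by fun_prop)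
      mul_I_mem_closedStrip).measurable) hN₀m hN₀ hC hγ0 hN₀C
    (fun y => by simpa using hGC _ (mul_I_mem_closedStrip y)) hq₀ hb₀ hδ0 hδ1 hδl
  obtain ⟨b₁, hb₁m, ⟨D₁, hD₁, hbD₁⟩, hbb₁, hbl₁⟩ := exists_majorants_of_cellAverage hπ
    (g := fun y => G (1 + y * Complex.I)) (fun y => hGi _) (fun y => hlim _ (hGi _))
    (fun n k => (((hG.analytic_cellAverage hK (hπ n) k).2).comp_continuous (by fun_prop)
      one_add_mul_I_mem_closedStrip).measurable) hN₁m hN₁ hC hγ0 hN₁C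
    (fun y => by simpa using hGC _ (one_add_mul_I_mem_closedStrip y)) hq₁ hb₁ hδ0 hδ1 hδl
  have hstep : ∀ n, eLpNorm (fun x => cellAverage (μ.restrict K) (π n) (G θ) (π n x)) q
      (μ.restrict K) ≤ ENNReal.ofReal (Real.exp
        ((∫ y, stripKernel (1 - θ) y * Real.log (max (b₀ n y) η₀)) +
          ∫ y, stripKernel θ y * Real.log (max (b₁ n y) η₁))) := by
    intro n
    rw [← eLpNorm_map_comp_of_countable (hπ n)]
    refine eLpNorm_cellAverage_le_exp hG hK hC hγ0 hγ hGi hGC h0 h1 hq₀ hq₁ hq (hπ n) (hδ0 n)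
      (fun y => lt_max_of_lt_right hη₀) (fun y => lt_max_of_lt_right hη₁)
      (integrable_stripKernel_mul_log_max_of_growth h0' h1' hη₀ hγ hD₀ (hb₀m n) (hbD₀ n))
      (integrable_stripKernel_mul_log_max_of_growth h0 h1 hη₁ hγ hD₁ (hb₁m n) (hbD₁ n))
      (fun y => ?_) (fun y => ?_)
    · exact (hbb₀ n y).trans (ENNReal.ofReal_le_ofReal (le_max_left _ _))
    · exact (hbb₁ n y).trans (ENNReal.ofReal_le_ofReal (le_max_left _ _))
  have hcm : ∀ n, AEStronglyMeasurable
      (fun x => cellAverage (μ.restrict K) (π n) (G θ) (π n x)) (μ.restrict K) := fun n =>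
    ((measurable_of_countable (cellAverage (μ.restrict K) (π n) (G θ))).comp
      (hπ n)).aestronglyMeasurable
  -- Convergence in $L^1(K)$ yields an a.e. convergent subsequence, along which Fatou's lemma works
  -- for every `q`.
  obtain ⟨ns, hns, hae⟩ := (tendstoInMeasure_of_tendsto_eLpNorm one_ne_zero hcm
    (hGi θ).aestronglyMeasurable (hlim _ (hGi θ))).exists_seq_tendsto_ae
  refine (Lp.eLpNorm_lim_le_liminf_eLpNorm (fun n => hcm (ns n)) _ hae).trans ?_
  have hR : Filter.Tendsto (fun n => ENNReal.ofReal (Real.exp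
        ((∫ y, stripKernel (1 - θ) y * Real.log (max (b₀ n y) η₀)) +
          ∫ y, stripKernel θ y * Real.log (max (b₁ n y) η₁)))) Filter.atTop
      (nhds (ENNReal.ofReal (Real.exp
        ((∫ y, stripKernel (1 - θ) y * Real.log (max (N₀ y) η₀)) +
          ∫ y, stripKernel θ y * Real.log (max (N₁ y) η₁))))) := by
    refine ENNReal.tendsto_ofReal ((Real.continuous_exp.tendsto _).comp (Filter.Tendsto.add ?_ ?_))
    · exact tendsto_integral_stripKernel_mul_log_max h0' h1' hη₀ hγ hD₀ hb₀m hbD₀ hbl₀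
    · exact tendsto_integral_stripKernel_mul_log_max h0 h1 hη₁ hγ hD₁ hb₁m hbD₁ hbl₁
  rw [← (hR.comp hns.tendsto_atTop).liminf_eq]
  exact Filter.liminf_le_liminf (Filter.Eventually.of_forall fun n => hstep (ns n))

/-- Inner regularity of the balls of integer radius exhausts the space, up to a null set, by an
increasing sequence `L n` of compact sets. Fatou's lemma then passes to the limit. -/
theorem IsRegularMetricMeasure.eLpNorm_le_of_forall_isCompact {X E : Type*} [MetricSpace X]
    [MeasurableSpace X] [OpensMeasurableSpace X] [NormedAddCommGroup E] {μ : Measure X}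
    (hμ : IsRegularMetricMeasure μ) {f : X → E} (hf : AEStronglyMeasurable f μ) {q B : ℝ≥0∞}
    (h : ∀ K, IsCompact K → eLpNorm f q (μ.restrict K) ≤ B) : eLpNorm f q μ ≤ B := by
  rcases isEmpty_or_nonempty X with hX | ⟨⟨x₀⟩⟩
  · simp
  have hball : ∀ n : ℕ, MeasurableSet (Metric.ball x₀ n) := fun n =>
    Metric.isOpen_ball.measurableSet
  have hex : ∀ p : ℕ × ℕ, ∃ C ⊆ Metric.ball x₀ (p.1 : ℝ), IsCompact C ∧
      μ (Metric.ball x₀ (p.1 : ℝ) \ C) ≤ ((p.2 : ℝ≥0∞) + 1)⁻¹ := fun p =>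
    hμ.exists_isCompact_diff_le (hball p.1) (hμ.ball_lt_top _ _) (by simp)
  choose C hCb hCc hC using hex
  set L : ℕ → Set X := fun n => ⋃ p ∈ Finset.range n ×ˢ Finset.range n, C p with hL
  have hLc : ∀ n, IsCompact (L n) := fun n => Finset.isCompact_biUnion _ fun p _ => hCc p
  have hnull : ∀ m : ℕ, μ (Metric.ball x₀ (m : ℝ) \ ⋃ n, L n) = 0 := by
    intro m
    have hle : ∀ j : ℕ, μ (Metric.ball x₀ (m : ℝ) \ ⋃ n, L n) ≤ ((j : ℝ≥0∞) + 1)⁻¹ := by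
      intro j
      refine (measure_mono (sdiff_subset_sdiff_right ?_)).trans (hC (m, j))
      intro x hx
      refine mem_iUnion.2 ⟨max m j + 1, mem_biUnion (x := (m, j)) ?_ hx⟩
      simp only [Finset.coe_product, Finset.coe_range, mem_prod, mem_Iio]
      omega
    have hlim : Filter.Tendsto (fun j : ℕ => ((j : ℝ≥0∞) + 1)⁻¹) Filter.atTop (nhds 0) := by
      have := (Filter.tendsto_add_atTop_iff_nat 1).2 ENNReal.tendsto_inv_nat_nhds_zero
      simpa using this
    exact le_antisymm (ge_of_tendsto' hlim hle) (zero_le)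
  have hae : ∀ᵐ x ∂μ, x ∈ ⋃ n, L n := by
    rw [ae_iff]
    refine measure_mono_null ?_ (measure_iUnion_null hnull)
    intro x hx
    obtain ⟨m, hm⟩ := exists_nat_gt (dist x x₀)
    exact mem_iUnion.2 ⟨m, hm, hx⟩
  refine Lp.eLpNorm_le_of_ae_tendsto (u := Filter.atTop) (f := fun n => (L n).indicator f)
    (Filter.Eventually.of_forall fun n => ?_) (fun n => hf.indicator (hLc n).measurableSet) ?_
  · rw [eLpNorm_indicator_eq_eLpNorm_restrict (hLc n).measurableSet]
    exact h _ (hLc n)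
  · filter_upwards [hae] with x hx
    obtain ⟨m, hm⟩ := mem_iUnion.1 hx
    refine tendsto_const_nhds.congr' ?_
    filter_upwards [Filter.eventually_ge_atTop m] with n hn
    refine (indicator_of_mem ?_ f).symm
    refine biUnion_subset_biUnion_left ?_ hm
    intro p hp
    simp only [Finset.coe_product, Finset.coe_range, mem_prod, mem_Iio] at hp ⊢
    omega

/-! ### Analytic deformations of functions in $C_c$ and their norms. -/

theorem norm_sum_mul_le_of_convex {ι : Type*} {s : Finset ι} {l : ι → ℝ} (hl : ∀ i ∈ s, 0 ≤ l i)
    (hs : ∑ i ∈ s, l i = 1) {v : ι → ℂ} {B : ℝ} (hv : ∀ i ∈ s, l i ≠ 0 → ‖v i‖ ≤ B) :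
    ‖∑ i ∈ s, (l i : ℂ) * v i‖ ≤ B := by
  calc ‖∑ i ∈ s, (l i : ℂ) * v i‖ ≤ ∑ i ∈ s, l i * B := by
        refine norm_sum_le_of_le s fun i hi => ?_
        rw [norm_mul, Complex.norm_real, Real.norm_of_nonneg (hl i hi)]
        rcases eq_or_ne (l i) 0 with h | h
        · simp [h]
        · exact mul_le_mul_of_nonneg_left (hv i hi h) (hl i hi)
    _ = B := by rw [← Finset.sum_mul, hs, one_mul]

/-- The coefficient `c ‖c‖ ^ (s z - 1)`, where `s` is the affine function with values `α₀` at `0`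
and `α₁` at `1`. -/
noncomputable def analyticCoeff (α₀ α₁ : ℝ) (c z : ℂ) : ℂ :=
  c * Complex.exp ((α₀ * (1 - z) + α₁ * z - 1) * Real.log ‖c‖)

theorem differentiable_analyticCoeff (α₀ α₁ : ℝ) (c : ℂ) :
    Differentiable ℂ (analyticCoeff α₀ α₁ c) := by
  unfold analyticCoeff
  fun_prop

theorem norm_analyticCoeff (α₀ α₁ : ℝ) (c z : ℂ) :
    ‖analyticCoeff α₀ α₁ c z‖ =
      ‖c‖ * Real.exp ((α₀ * (1 - z.re) + α₁ * z.re - 1) * Real.log ‖c‖) := by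
  rw [analyticCoeff, norm_mul, Complex.norm_exp]
  congr 2
  rw [Complex.re_mul_ofReal]
  simp

theorem norm_analyticCoeff_le_rpow {α₀ α₁ R : ℝ} {c z : ℂ} (hcR : ‖c‖ ≤ R)
    (hβ : 0 ≤ α₀ * (1 - z.re) + α₁ * z.re) :
    ‖analyticCoeff α₀ α₁ c z‖ ≤ R ^ (α₀ * (1 - z.re) + α₁ * z.re) := by
  rcases eq_or_ne c 0 with rfl | hc
  · rw [norm_analyticCoeff, norm_zero, zero_mul]
    exact Real.rpow_nonneg (by simpa using hcR) _
  · have hpos := norm_pos_iff.2 hc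
    refine le_trans (le_of_eq ?_) (Real.rpow_le_rpow hpos.le hcR hβ)
    rw [norm_analyticCoeff, sub_mul, one_mul, Real.exp_sub, Real.exp_log hpos,
      Real.rpow_def_of_pos hpos, mul_comm (Real.log ‖c‖)]
    field_simp

theorem exists_norm_analyticCoeff_le (α₀ α₁ : ℝ) (c : ℂ) :
    ∃ R : ℝ, ∀ z ∈ closedStrip, ‖analyticCoeff α₀ α₁ c z‖ ≤ R := by
  refine ⟨‖c‖ * Real.exp ((|α₀| + |α₁| + 1) * |Real.log ‖c‖|), fun z hz => ?_⟩
  rw [norm_analyticCoeff]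
  refine mul_le_mul_of_nonneg_left (Real.exp_le_exp.2 ?_) (norm_nonneg _)
  refine (le_abs_self _).trans ?_
  rw [abs_mul]
  refine mul_le_mul_of_nonneg_right ?_ (abs_nonneg _)
  have h1 : |α₀ * (1 - z.re)| ≤ |α₀| := by
    rw [abs_mul]
    exact mul_le_of_le_one_right (abs_nonneg _) (abs_le.2 ⟨by linarith [hz.2], by linarith [hz.1]⟩)
  have h2 : |α₁ * z.re| ≤ |α₁| := by
    rw [abs_mul]
    exact mul_le_of_le_one_right (abs_nonneg _) (abs_le.2 ⟨by linarith [hz.1], by linarith [hz.2]⟩)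
  calc |α₀ * (1 - z.re) + α₁ * z.re - 1| ≤ |α₀ * (1 - z.re) + α₁ * z.re| + |(1 : ℝ)| := abs_sub _ _
    _ ≤ |α₀ * (1 - z.re)| + |α₁ * z.re| + 1 := by
      rw [abs_one]; gcongr; exact abs_add_le _ _
    _ ≤ _ := by gcongr

/-- The majorant of the analytic deformations of `f` with exponent `β`. -/
noncomputable def deformationBound {X : Type*} (f : X → ℂ) (β ε : ℝ) (x : X) : ℝ :=
  if f x = 0 then 0 else (‖f x‖ + ε) ^ β + 3 * ε

/-- A continuous function of compact support is the value at `θ` of a family of finite sums of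
continuous functions of compact support with analytic coefficients, such that the modulus of the
sum at `z` is essentially the power of `|f|` whose exponent is the affine function of `Re z` with
values `α₀` at `0` and `α₁` at `1`. -/
theorem exists_analytic_deformation {X : Type*} [TopologicalSpace X] (f : C_c(X, ℂ))
    {α₀ α₁ θ ε : ℝ} (hα₀ : 0 ≤ α₀) (hα₁ : 0 ≤ α₁) (hα : (1 - θ) * α₀ + θ * α₁ = 1) (hε : 0 < ε) :
    ∃ (n : ℕ) (φ : Fin n → C_c(X, ℂ)) (a : Fin n → ℂ → ℂ), (∀ j, Differentiable ℂ (a j)) ∧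
      (∀ j, ∃ R : ℝ, ∀ z ∈ closedStrip, ‖a j z‖ ≤ R) ∧ ∑ j, a j θ • φ j = f ∧
      ∀ z ∈ closedStrip, ∀ x, ‖(∑ j, a j z • φ j) x‖ ≤
        deformationBound f (α₀ * (1 - z.re) + α₁ * z.re) ε x := by
  classical
  suffices H : ∃ (ι : Type) (_ : Fintype ι) (φ : ι → C_c(X, ℂ)) (a : ι → ℂ → ℂ),
      (∀ j, Differentiable ℂ (a j)) ∧
      (∀ j, ∃ R : ℝ, ∀ z ∈ closedStrip, ‖a j z‖ ≤ R) ∧ ∑ j, a j θ • φ j = f ∧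
      ∀ z ∈ closedStrip, ∀ x, ‖(∑ j, a j z • φ j) x‖ ≤
        deformationBound f (α₀ * (1 - z.re) + α₁ * z.re) ε x by
    obtain ⟨ι, _, φ, a, h1, h2, h3, h4⟩ := H
    have e := (Fintype.equivFin ι).symm
    refine ⟨Fintype.card ι, φ ∘ e, a ∘ e, fun j => h1 _, fun j => h2 _, ?_, fun z hz x => ?_⟩
    · rw [← h3]
      exact e.sum_comp fun j => a j θ • φ j
    · have := h4 z hz x
      rw [← e.sum_comp fun j => a j z • φ j] at this
      exact this
  -- The compact range of `f` is covered by finitely many ε-balls. The bumps `ψ c`, composed with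
  -- `f` and normalized, form a partition of unity `l c` on `X`, and `l c x ≠ 0` only if `c` is
  -- within `ε` of `f x`.
  obtain ⟨t, -, htf, hcov⟩ := (f.hasCompactSupport.isCompact_range f.continuous).finite_cover_balls hε
  set T := htf.toFinset with hT
  set ψ : ℂ → ℂ → ℝ := fun c w => max 0 (ε - ‖w - c‖) with hψ
  have hψ0 : ∀ c w, 0 ≤ ψ c w := fun c w => le_max_left _ _
  have hψc : ∀ c, Continuous (ψ c) := fun c => by simp only [hψ]; fun_prop
  have hψn : ∀ c w, ψ c w ≠ 0 → ‖w - c‖ < ε := by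
    intro c w h
    by_contra hlt
    exact h (max_eq_left (by linarith))
  have hS : ∀ x, 0 < ∑ c ∈ T, ψ c (f x) := by
    intro x
    obtain ⟨c, hc, hx⟩ := mem_iUnion₂.1 (hcov (mem_range_self x))
    refine Finset.sum_pos' (fun c _ => hψ0 c _) ⟨c, by simpa [hT] using hc, ?_⟩
    rw [Metric.mem_ball, dist_eq_norm] at hx
    exact lt_max_of_lt_right (by linarith)
  set l : ℂ → X → ℝ := fun c x => ψ c (f x) / ∑ c ∈ T, ψ c (f x) with hl
  have hl0 : ∀ c x, 0 ≤ l c x := fun c x => div_nonneg (hψ0 _ _) (hS x).le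
  have hl1 : ∀ x, ∑ c ∈ T, l c x = 1 := fun x => by
    simp only [hl]
    rw [← Finset.sum_div, div_self (hS x).ne']
  have hln : ∀ c x, l c x ≠ 0 → ‖f x - c‖ < ε := fun c x h =>
    hψn _ _ fun h0 => h (by simp only [hl, h0, zero_div])
  have hlc : ∀ c, Continuous (l c) := fun c =>
    ((hψc c).comp f.continuous).div
      (continuous_finsetSum _ fun c _ => (hψc c).comp f.continuous) fun x => (hS x).ne'
  -- The weights `l c` need not have compact support. The cutoff vanishes with `f` and equals $1$
  -- where $\|f\|\ge\varepsilon$.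
  set m : X → ℝ := fun x => min 1 (‖f x‖ / ε) with hm
  have hm0 : ∀ x, 0 ≤ m x := fun x => le_min zero_le_one (by positivity)
  have hm1 : ∀ x, m x ≤ 1 := fun x => min_le_left _ _
  have hmc : Continuous m := continuous_const.min (f.continuous.norm.div_const ε)
  have hmz : ∀ x, f x = 0 → m x = 0 := fun x h => by simp [hm, h]
  have hφc : ∀ c, Continuous fun x => ((m x : ℝ) : ℂ) * ((l c x : ℝ) : ℂ) := fun c =>
    (Complex.continuous_ofReal.comp hmc).mul (Complex.continuous_ofReal.comp (hlc c))
  set φ : ℂ → C_c(X, ℂ) := fun c => ⟨⟨_, hφc c⟩, f.hasCompactSupport.mono fun x hx => by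
    rw [Function.mem_support] at hx ⊢
    intro h0
    exact hx (by simp [hmz x h0])⟩ with hφ
  have hφx : ∀ c x, φ c x = (m x : ℂ) * (l c x : ℂ) := fun c x => rfl
  -- The approximation error is kept in the family with constant coefficient $1$, so that the value
  -- at `θ` is exactly `f`.
  set r : C_c(X, ℂ) := f - ∑ c : T, (c : ℂ) • φ c with hr
  have hsum : ∀ (b : ℂ → ℂ) x, (∑ c : T, b c • φ c) x =
      (m x : ℂ) * ∑ c ∈ T, (l c x : ℂ) * b c := by
    intro b x
    rw [CompactlySupportedContinuousMap.sum_apply, Finset.sum_coe_sort T fun c => (b c • φ c) x,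
      Finset.mul_sum]
    refine Finset.sum_congr rfl fun c _ => ?_
    rw [CompactlySupportedContinuousMap.smul_apply, hφx, smul_eq_mul]
    ring
  -- The partition of unity costs at most `ε` and the cutoff at most `ε`; the factor $3$ leaves
  -- room.
  have hr3 : ∀ x, ‖r x‖ ≤ 3 * ε := by
    intro x
    rw [hr, CompactlySupportedContinuousMap.sub_apply, hsum fun c => c]
    set A := ∑ c ∈ T, (l c x : ℂ) * c with hA
    have h1 : ‖f x - A‖ ≤ ε := by
      have : f x - A = ∑ c ∈ T, (l c x : ℂ) * (f x - c) := by
        simp only [mul_sub, Finset.sum_sub_distrib]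
        rw [← Finset.sum_mul, ← Complex.ofReal_sum, hl1 x, Complex.ofReal_one, one_mul]
      rw [this]
      exact norm_sum_mul_le_of_convex (fun c _ => hl0 c x) (hl1 x) fun c _ h => (hln c x h).le
    have h2 : f x - m x * A = m x * (f x - A) + ((1 - m x : ℝ) : ℂ) * f x := by
      push_cast; ring
    rw [h2]
    refine (norm_add_le _ _).trans ?_
    rw [norm_mul, norm_mul, Complex.norm_real, Complex.norm_real, Real.norm_of_nonneg (hm0 x),
      Real.norm_of_nonneg (sub_nonneg.2 (hm1 x))]
    have h3 : m x * ‖f x - A‖ ≤ ε := (mul_le_of_le_one_left (norm_nonneg _) (hm1 x)).trans h1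
    have h4 : (1 - m x) * ‖f x‖ ≤ ε := by
      rcases le_total ε ‖f x‖ with h | h
      · have : m x = 1 := min_eq_left ((one_le_div hε).2 h)
        rw [this, sub_self, zero_mul]; exact hε.le
      · exact (mul_le_of_le_one_left (norm_nonneg _) (by linarith [hm0 x])).trans h
    linarith
  refine ⟨Option T, inferInstance, fun o => o.elim r fun c => φ c,
    fun o => o.elim (fun _ => 1) fun c => analyticCoeff α₀ α₁ c, ?_, ?_, ?_, ?_⟩
  · rintro (_ | c)
    · exact differentiable_const _
    · exact differentiable_analyticCoeff _ _ _
  · rintro (_ | c)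
    · exact ⟨1, fun z _ => by simp⟩
    · exact exists_norm_analyticCoeff_le _ _ _
  · have hθ : ∀ c : ℂ, analyticCoeff α₀ α₁ c θ = c := by
      intro c
      have h' : (1 - (θ : ℂ)) * α₀ + θ * α₁ = 1 := by exact_mod_cast hα
      have : ((α₀ : ℂ) * (1 - θ) + α₁ * θ - 1) = 0 := by linear_combination h'
      rw [analyticCoeff, this, zero_mul, Complex.exp_zero, mul_one]
    rw [Fintype.sum_option]
    simp only [Option.elim, hθ, one_smul, hr]
    exact sub_add_cancel _ _
  · intro z hz x
    have hβ : 0 ≤ α₀ * (1 - z.re) + α₁ * z.re :=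
      add_nonneg (mul_nonneg hα₀ (by linarith [hz.2])) (mul_nonneg hα₁ hz.1)
    rw [Fintype.sum_option]
    simp only [Option.elim, one_smul]
    rw [CompactlySupportedContinuousMap.add_apply, hsum fun c => analyticCoeff α₀ α₁ c z,
      deformationBound]
    split_ifs with h0
    · rw [hr, CompactlySupportedContinuousMap.sub_apply, hsum fun c => c, hmz x h0, h0]
      simp
    · rw [add_comm]
      refine (norm_add_le _ _).trans (add_le_add ?_ (hr3 x))
      rw [norm_mul, Complex.norm_real, Real.norm_of_nonneg (hm0 x)]
      refine (mul_le_of_le_one_left (norm_nonneg _) (hm1 x)).trans ?_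
      refine norm_sum_mul_le_of_convex (fun c _ => hl0 c x) (hl1 x) fun c _ h => ?_
      refine norm_analyticCoeff_le_rpow ?_ hβ
      have h5 := hln c x h
      have h6 := norm_sub_norm_le c (f x)
      rw [norm_sub_rev] at h6
      linarith

theorem norm_deformationBound_le {X : Type*} (f : X → ℂ) {β ε : ℝ} (hε : 0 < ε) (x : X) :
    ‖deformationBound f β ε x‖ ≤ (‖f x‖ + ε) ^ β + 3 * ε := by
  have : 0 ≤ (‖f x‖ + ε) ^ β + 3 * ε := by positivity
  unfold deformationBound
  split_ifs
  · simpa using this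
  · rw [Real.norm_of_nonneg this]

theorem measurable_deformationBound {X : Type*} [MeasurableSpace X] {f : X → ℂ} (hf : Measurable f)
    (β ε : ℝ) : Measurable (deformationBound f β ε) := by
  unfold deformationBound
  exact Measurable.ite (hf (measurableSet_singleton 0)) measurable_const
    (((hf.norm.add_const ε).pow_const β).add_const _)

/-- The norms of the majorants of the analytic deformations of `f` tend to powers of the norm of
`f`. -/
theorem exists_tendsto_of_eLpNorm_deformationBound_le {X : Type*} [MetricSpace X]
    [MeasurableSpace X] [OpensMeasurableSpace X] {μ : Measure X} (hμ : IsRegularMetricMeasure μ)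
    (f : C_c(X, ℂ)) {p₀ p : ℝ≥0∞} {β : ℝ} (hp₀ : p₀ ≠ 0) (hp : p ≠ 0) (hpp : p = ∞ → p₀ = ∞)
    (hβ : β = if p = ∞ then 1 else (p / p₀).toReal) {ε : ℕ → ℝ} (hε0 : ∀ n, 0 < ε n)
    (hε1 : ∀ n, ε n ≤ 1) (hε : Filter.Tendsto ε Filter.atTop (nhds 0)) :
    ∃ U : ℕ → ℝ≥0∞, (∀ n, eLpNorm (deformationBound f β (ε n)) p₀ μ ≤ U n) ∧
      Filter.Tendsto U Filter.atTop (nhds (eLpNorm f p μ ^ β)) := by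
  have hfm : Measurable f := f.continuous.measurable
  have hlin : ∀ c a : ℝ, Filter.Tendsto (fun n => ENNReal.ofReal (a + c * ε n)) Filter.atTop
      (nhds (ENNReal.ofReal a)) := fun c a => by
    simpa using ENNReal.tendsto_ofReal ((hε.const_mul c).const_add a)
  by_cases hpt : p = ∞
  · rw [if_pos hpt] at hβ
    subst hβ
    rw [hpp hpt, hpt]
    refine ⟨fun n => eLpNorm f ∞ μ + ENNReal.ofReal (0 + 4 * ε n), fun n => ?_, ?_⟩
    · have h1 : eLpNorm (deformationBound f 1 (ε n)) ∞ μ ≤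
          eLpNorm ((fun x => ‖f x‖) + fun _ => 4 * ε n) ∞ μ := by
        refine eLpNorm_mono fun x => (norm_deformationBound_le f (hε0 n) x).trans ?_
        have := hε0 n
        rw [Real.rpow_one, Pi.add_apply, Real.norm_of_nonneg (by positivity)]
        linarith
      refine h1.trans ((eLpNorm_add_le hfm.norm.aestronglyMeasurable aestronglyMeasurable_const
        le_top).trans (add_le_add (eLpNorm_norm f).le ?_))
      rw [eLpNorm_exponent_top, zero_add]
      refine eLpNormEssSup_le_of_ae_bound (Filter.Eventually.of_forall fun x => ?_)
      rw [Real.norm_of_nonneg (by linarith [hε0 n])]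
    · simpa using (hlin 4 0).const_add (eLpNorm f ∞ μ)
  rw [if_neg hpt] at hβ
  by_cases hp0t : p₀ = ∞
  · rw [hp0t, ENNReal.div_top, ENNReal.toReal_zero] at hβ
    subst hβ
    -- Here `β = 0` and the limit is $\|f\|_p^0=1$ even for $f=0$, where the norms on the left
    -- vanish. This is why majorants `U` are used in place of the norms themselves.
    refine ⟨fun n => ENNReal.ofReal (1 + 3 * ε n), fun n => ?_, by simpa using hlin 3 1⟩
    rw [hp0t, eLpNorm_exponent_top]
    refine eLpNormEssSup_le_of_ae_bound (Filter.Eventually.of_forall fun x => ?_)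
    simpa using norm_deformationBound_le f (β := 0) (hε0 n) x
  · have hpos := ENNReal.toReal_pos hp hpt
    have hpos0 := ENNReal.toReal_pos hp₀ hp0t
    rw [ENNReal.toReal_div] at hβ
    have hβ0 : 0 < β := hβ ▸ div_pos hpos hpos0
    refine ⟨_, fun n => le_rfl, ?_⟩
    simp only [eLpNorm_eq_lintegral_rpow_enorm_toReal hp₀ hp0t,
      eLpNorm_eq_lintegral_rpow_enorm_toReal hp hpt]
    rw [← ENNReal.rpow_mul, show 1 / p.toReal * β = 1 / p₀.toReal by rw [hβ]; field_simp]
    refine Filter.Tendsto.ennrpow_const _ ?_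
    obtain ⟨R, hR⟩ := f.hasCompactSupport.exists_bound_of_continuous f.continuous
    -- The deformation bound is zero where `f` is, so a constant on the support of `f`, which has
    -- finite measure, is an integrable majorant.
    refine tendsto_lintegral_of_dominated_convergence
      ((tsupport f).indicator fun _ => ENNReal.ofReal ((R + 1) ^ β + 3) ^ p₀.toReal) (fun n => ?_)
      (fun n => ?_) ?_ ?_
    · exact (measurable_deformationBound hfm _ _).enorm.pow_const _
    · refine Filter.Eventually.of_forall fun x => ?_
      by_cases hx : f x = 0
      · simp [deformationBound, hx, hpos0]
      · have hx' : x ∈ tsupport f := subset_tsupport f hx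
        beta_reduce
        rw [indicator_of_mem hx', ← ofReal_norm]
        refine ENNReal.rpow_le_rpow (ENNReal.ofReal_le_ofReal
          ((norm_deformationBound_le f (hε0 n) x).trans ?_)) hpos0.le
        have h1 := hε0 n
        have h2 := hε1 n
        have h3 := hR x
        have h4 : (‖f x‖ + ε n) ^ β ≤ (R + 1) ^ β :=
          Real.rpow_le_rpow (by positivity) (by linarith) hβ0.le
        linarith
    · rw [lintegral_indicator (isClosed_tsupport f).measurableSet, setLIntegral_const]
      refine ENNReal.mul_ne_top (ENNReal.rpow_ne_top_of_nonneg hpos0.le ENNReal.ofReal_ne_top)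
        (hμ.measure_lt_top_of_isCompact f.hasCompactSupport).ne
    · refine Filter.Eventually.of_forall fun x => ?_
      by_cases hx : f x = 0
      · simp [deformationBound, hx, hpos0, hpos]
      · have hlimx : Filter.Tendsto (fun n => deformationBound f β (ε n) x) Filter.atTop
            (nhds (‖f x‖ ^ β)) := by
          simp only [deformationBound, hx, if_false]
          have h1 : Filter.Tendsto (fun n => ‖f x‖ + ε n) Filter.atTop (nhds ‖f x‖) := by
            simpa using hε.const_add ‖f x‖
          simpa using (h1.rpow_const (Or.inr hβ0.le)).add (hε.const_mul 3)
        have h2 := (hlimx.enorm).ennrpow_const p₀.toReal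
        convert h2 using 2
        rw [Real.enorm_of_nonneg (by positivity), ← ofReal_norm (f x),
          ← ENNReal.ofReal_rpow_of_nonneg (norm_nonneg _) hβ0.le, ← ENNReal.rpow_mul, hβ]
        congr 1
        field_simp

/-! ### The mean $M(\theta)$ as a limit of truncated means. -/

theorem lineIntegralEReal_coe {g : ℝ → ℝ} (hg : Integrable g) :
    lineIntegralEReal (fun y => (g y : EReal)) = ((∫ y, g y : ℝ) : EReal) := by
  have h1 : ∫⁻ y, ENNReal.ofReal (g y) ≠ ∞ := hg.lintegral_lt_top.ne
  have h2 : ∫⁻ y, ENNReal.ofReal (-g y) ≠ ∞ := hg.neg.lintegral_lt_top.ne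
  rw [integral_eq_lintegral_pos_part_sub_lintegral_neg_part hg, EReal.coe_sub,
    EReal.coe_ennreal_toReal h1, EReal.coe_ennreal_toReal h2]
  rfl

/-- Monotone convergence for the integral of extended real functions: an antitone sequence whose
first term has a positive part of finite integral. -/
theorem tendsto_lineIntegralEReal_of_antitone {h : ℕ → ℝ → EReal} {k : ℝ → EReal}
    (hm : ∀ n, Measurable (h n)) (hanti : ∀ y, Antitone fun n => h n y)
    (h0 : ∫⁻ y, (h 0 y).toENNReal ≠ ∞)
    (hlim : ∀ y, Filter.Tendsto (fun n => h n y) Filter.atTop (nhds (k y))) :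
    lineIntegralEReal k < ⊤ ∧
      Filter.Tendsto (fun n => lineIntegralEReal (h n)) Filter.atTop
        (nhds (lineIntegralEReal k)) := by
  have hk : ∫⁻ y, (k y).toENNReal ≠ ∞ := by
    refine ne_top_of_le_ne_top h0 (lintegral_mono fun y => EReal.toENNReal_le_toENNReal ?_)
    exact (hanti y).le_of_tendsto (hlim y) 0
  have hpos : Filter.Tendsto (fun n => ∫⁻ y, (h n y).toENNReal) Filter.atTop
      (nhds (∫⁻ y, (k y).toENNReal)) :=
    lintegral_tendsto_of_tendsto_of_antitone (fun n => (hm n).ereal_toENNReal.aemeasurable)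
      (Filter.Eventually.of_forall fun y i j hij =>
        EReal.toENNReal_le_toENNReal (hanti y hij)) h0
      (Filter.Eventually.of_forall fun y =>
        (EReal.continuous_toENNReal.tendsto _).comp (hlim y))
  have hneg : Filter.Tendsto (fun n => ∫⁻ y, (-h n y).toENNReal) Filter.atTop
      (nhds (∫⁻ y, (-k y).toENNReal)) :=
    lintegral_tendsto_of_tendsto_of_monotone (fun n => (hm n).neg.ereal_toENNReal.aemeasurable)
      (Filter.Eventually.of_forall fun y i j hij =>
        EReal.toENNReal_le_toENNReal (EReal.neg_le_neg_iff.2 (hanti y hij)))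
      (Filter.Eventually.of_forall fun y =>
        (EReal.continuous_toENNReal.tendsto _).comp ((continuous_neg.tendsto _).comp (hlim y)))
  have hkt : ((∫⁻ y, (k y).toENNReal : ℝ≥0∞) : EReal) ≠ ⊤ := by
    simpa using hk
  have hnt : -((∫⁻ y, (-k y).toENNReal : ℝ≥0∞) : EReal) ≠ ⊤ := by
    simp
  refine ⟨EReal.add_lt_top hkt hnt, ?_⟩
  -- The positive parts decrease from a finite integral, so the difference of the two limits is
  -- never $\infty-\infty$ and addition is continuous there.
  have hadd := EReal.continuousAt_add (p := (((∫⁻ y, (k y).toENNReal : ℝ≥0∞) : EReal),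
    -((∫⁻ y, (-k y).toENNReal : ℝ≥0∞) : EReal))) (Or.inl hkt)
    (Or.inl (by simp))
  exact hadd.tendsto.comp
    (((continuous_coe_ennreal_ereal.tendsto _).comp hpos).prodMk_nhds
      ((continuous_neg.tendsto _).comp ((continuous_coe_ennreal_ereal.tendsto _).comp hneg)))

/-- The geometric mean `stripMean` is finite, and it is the limit of the means of the truncations
of the boundary data from below. -/
theorem stripMean_lt_top_and_tendsto {M₀ M₁ : ℝ → ℝ} {θ c τ : ℝ} (h0 : 0 < θ) (h1 : θ < 1)
    (hM₀m : Measurable M₀) (hM₁m : Measurable M₁) (hc : 0 ≤ c) (hτ : τ < Real.pi)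
    (hM₀ : ∀ y, M₀ y ≤ Real.exp (c * Real.exp (τ * |y|)))
    (hM₁ : ∀ y, M₁ y ≤ Real.exp (c * Real.exp (τ * |y|))) :
    stripMean M₀ M₁ θ < ∞ ∧
    Filter.Tendsto (fun n : ℕ => ENNReal.ofReal (Real.exp
      ((∫ y, stripKernel (1 - θ) y * Real.log (max (M₀ y) (1 / ((n : ℝ) + 1)))) +
        ∫ y, stripKernel θ y * Real.log (max (M₁ y) (1 / ((n : ℝ) + 1))))))
      Filter.atTop (nhds (stripMean M₀ M₁ θ)) := by
  have h0' : 0 < 1 - θ := by linarith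
  have h1' : 1 - θ < 1 := by linarith
  have hη : ∀ n : ℕ, 0 < 1 / ((n : ℝ) + 1) := fun n => Nat.one_div_pos_of_nat
  have hlog : ∀ (M : ℝ → ℝ) (n : ℕ) (y : ℝ),
      ENNReal.log (ENNReal.ofReal (max (M y) (1 / ((n : ℝ) + 1)))) =
        (Real.log (max (M y) (1 / ((n : ℝ) + 1))) : EReal) := fun M n y =>
    ENNReal.log_ofReal_of_pos (lt_max_of_lt_right (hη n))
  have hi₀ := fun n => integrable_stripKernel_mul_log_max_of_growth h0' h1' (hη n) hτ hc hM₀m hM₀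
  have hi₁ := fun n => integrable_stripKernel_mul_log_max_of_growth h0 h1 (hη n) hτ hc hM₁m hM₁
  set h : ℕ → ℝ → EReal := fun n y =>
    (stripKernel (1 - θ) y : EReal) *
        ENNReal.log (ENNReal.ofReal (max (M₀ y) (1 / ((n : ℝ) + 1)))) +
      (stripKernel θ y : EReal) * ENNReal.log (ENNReal.ofReal (max (M₁ y) (1 / ((n : ℝ) + 1))))
    with hh
  have hreal : ∀ n, h n = fun y =>
      ((stripKernel (1 - θ) y * Real.log (max (M₀ y) (1 / ((n : ℝ) + 1))) +
        stripKernel θ y * Real.log (max (M₁ y) (1 / ((n : ℝ) + 1))) : ℝ) : EReal) := by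
    intro n
    funext y
    simp only [hh, hlog]
    push_cast
    rfl
  have hint : ∀ n, lineIntegralEReal (h n) =
      (((∫ y, stripKernel (1 - θ) y * Real.log (max (M₀ y) (1 / ((n : ℝ) + 1)))) +
        ∫ y, stripKernel θ y * Real.log (max (M₁ y) (1 / ((n : ℝ) + 1))) : ℝ) : EReal) := by
    intro n
    rw [hreal, ← integral_add (hi₀ n) (hi₁ n)]
    exact lineIntegralEReal_coe ((hi₀ n).add (hi₁ n))
  have hterm : ∀ (x : ℝ) (M : ℝ → ℝ) (y : ℝ), Filter.Tendsto
      (fun n : ℕ => (stripKernel x y : EReal) *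
        ENNReal.log (ENNReal.ofReal (max (M y) (1 / ((n : ℝ) + 1))))) Filter.atTop
      (nhds ((stripKernel x y : EReal) * ENNReal.log (ENNReal.ofReal (M y)))) := by
    intro x M y
    refine EReal.Tendsto.const_mul ?_ (Or.inl (EReal.coe_ne_bot _)) (Or.inl (EReal.coe_ne_top _))
    refine (ENNReal.continuous_log.tendsto _).comp ?_
    have : ENNReal.ofReal (M y) = ENNReal.ofReal (max (M y) 0) := by
      rcases le_total (M y) 0 with hy | hy
      · rw [max_eq_right hy, ENNReal.ofReal_zero, ENNReal.ofReal_of_nonpos hy]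
      · rw [max_eq_left hy]
    rw [this]
    exact (ENNReal.continuous_ofReal.tendsto _).comp
      (tendsto_const_nhds.max tendsto_one_div_add_atTop_nhds_zero_nat)
  -- Either term may be $-\infty$ but neither is $+\infty$, so their sum is a point of continuity of
  -- addition.
  have hne : ∀ (x : ℝ) (M : ℝ → ℝ) (y : ℝ) , 0 ≤ stripKernel x y →
      (stripKernel x y : EReal) * ENNReal.log (ENNReal.ofReal (M y)) ≠ ⊤ := by
    intro x M y hk
    have := ENNReal.log_lt_top_iff.2 (ENNReal.ofReal_lt_top (r := M y))
    refine (EReal.mul_ne_top _ _).2 ⟨Or.inl (EReal.coe_ne_bot _), ?_, Or.inl (EReal.coe_ne_top _),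
      Or.inr this.ne⟩
    exact Or.inl (EReal.coe_nonneg.2 hk)
  have hanti : ∀ y, Antitone fun n => h n y := by
    intro y i j hij
    have hij' : (1 : ℝ) / ((j : ℝ) + 1) ≤ 1 / ((i : ℝ) + 1) := Nat.one_div_le_one_div hij
    refine add_le_add (mul_le_mul_of_nonneg_left ?_ ?_) (mul_le_mul_of_nonneg_left ?_ ?_)
    · exact ENNReal.log_le_log (ENNReal.ofReal_le_ofReal (max_le_max_left _ hij'))
    · exact EReal.coe_nonneg.2 (stripKernel_pos h0' h1' y).le
    · exact ENNReal.log_le_log (ENNReal.ofReal_le_ofReal (max_le_max_left _ hij'))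
    · exact EReal.coe_nonneg.2 (stripKernel_pos h0 h1 y).le
  obtain ⟨hlt, hlim⟩ := tendsto_lineIntegralEReal_of_antitone (h := h)
    (k := fun y => (stripKernel (1 - θ) y : EReal) * ENNReal.log (ENNReal.ofReal (M₀ y)) +
      (stripKernel θ y : EReal) * ENNReal.log (ENNReal.ofReal (M₁ y)))
    (fun n => by
      rw [hreal]
      have := continuous_stripKernel h0 h1
      have := continuous_stripKernel h0' h1'
      fun_prop) hanti
    (by
      rw [hreal]
      exact ((hi₀ 0).add (hi₁ 0)).lintegral_lt_top.ne)
    fun y => (EReal.continuousAt_add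
      (p := ((stripKernel (1 - θ) y : EReal) * ENNReal.log (ENNReal.ofReal (M₀ y)),
        (stripKernel θ y : EReal) * ENNReal.log (ENNReal.ofReal (M₁ y))))
      (Or.inl (hne _ _ _ (stripKernel_pos h0' h1' y).le))
      (Or.inr (hne _ _ _ (stripKernel_pos h0 h1 y).le))).tendsto.comp
        ((hterm _ M₀ y).prodMk_nhds (hterm _ M₁ y))
  refine ⟨EReal.exp_lt_top_iff.2 hlt, ?_⟩
  refine ((ENNReal.continuous_exp.tendsto _).comp hlim).congr fun n => ?_
  rw [Function.comp_apply, hint, EReal.exp_coe]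

/-! ### Linear combinations of weakly analytic families and their growth. -/

section LinearCombinations

variable {X : Type*} [MetricSpace X] [MeasurableSpace X] {μ : Measure X}

theorem L1loc.integrableOn (f : L1loc μ) {K : Set X} (hK : IsCompact K) :
    IntegrableOn (f : X →ₘ[μ] ℂ) K μ :=
  f.2 K hK

/-- The integral of locally integrable functions against a bounded measurable function of compact
support, as a linear form. -/
noncomputable def L1loc.pairing [OpensMeasurableSpace X] (w : X → ℂ) (hw : Measurable w)
    (hwb : ∃ R : ℝ, ∀ x, ‖w x‖ ≤ R) (hwc : HasCompactSupport w) : L1loc μ →ₗ[ℂ] ℂ where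
  toFun f := ∫ x, (f : X →ₘ[μ] ℂ) x * w x ∂μ
  map_add' f g := by
    have hint : ∀ f : L1loc μ, Integrable (fun x => (f : X →ₘ[μ] ℂ) x * w x) μ := by
      intro f
      obtain ⟨R, hR⟩ := hwb
      have h : IntegrableOn (fun x => (f : X →ₘ[μ] ℂ) x * w x) (tsupport w) μ :=
        (L1loc.integrableOn f hwc).mul_bdd (c := R) hw.aestronglyMeasurable (Filter.Eventually.of_forall hR)
      refine (integrableOn_iff_integrable_of_support_subset fun x hx => ?_).1 h
      exact subset_tsupport w (right_ne_zero_of_mul hx)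
    rw [← integral_add (hint f) (hint g)]
    refine integral_congr_ae ?_
    filter_upwards [AEEqFun.coeFn_add (f : X →ₘ[μ] ℂ) (g : X →ₘ[μ] ℂ)] with x hx
    rw [Submodule.coe_add, hx, Pi.add_apply, add_mul]
  map_smul' c f := by
    rw [RingHom.id_apply, smul_eq_mul, ← integral_const_mul]
    refine integral_congr_ae ?_
    filter_upwards [AEEqFun.coeFn_smul c (f : X →ₘ[μ] ℂ)] with x hx
    rw [Submodule.coe_smul, hx, Pi.smul_apply, smul_eq_mul, mul_assoc]

/-- Linear combinations of weakly analytic families with analytic coefficients are weakly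
analytic. -/
theorem isWeaklyAnalytic_sum [OpensMeasurableSpace X] {ι : Type*} [Fintype ι] {c : ι → ℂ → ℂ}
    {g : ι → ℂ → L1loc μ} (hc : ∀ i, Differentiable ℂ (c i))
    (hg : ∀ i, IsWeaklyAnalytic μ fun z => (g i z : X →ₘ[μ] ℂ)) :
    IsWeaklyAnalytic μ fun z => ((∑ i, c i z • g i z : L1loc μ) : X →ₘ[μ] ℂ) := by
  intro w hw hwb hwc
  have key : (fun z => ∫ x, ((∑ i, c i z • g i z : L1loc μ) : X →ₘ[μ] ℂ) x * w x ∂μ) =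
      fun z => ∑ i, c i z * ∫ x, (g i z : X →ₘ[μ] ℂ) x * w x ∂μ := by
    funext z
    have h := map_sum (L1loc.pairing (μ := μ) w hw hwb hwc) (fun i => c i z • g i z) Finset.univ
    simp only [map_smul, smul_eq_mul] at h
    exact h
  rw [key]
  constructor
  · exact DifferentiableOn.fun_sum fun i _ =>
      (hc i).differentiableOn.mul (hg i w hw hwb hwc).1
  · exact continuousOn_finsetSum _ fun i _ =>
      (hc i).continuous.continuousOn.mul (hg i w hw hwb hwc).2

theorem eLpNorm_sum_smul_le {ι : Type*} [Fintype ι] (c : ι → ℂ) (g : ι → L1loc μ)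
    (K : Set X) {p : ℝ≥0∞} (hp : 1 ≤ p) :
    eLpNorm ((∑ i, c i • g i : L1loc μ) : X →ₘ[μ] ℂ) p (μ.restrict K) ≤
      ∑ i, ‖c i‖ₑ * eLpNorm (g i : X →ₘ[μ] ℂ) p (μ.restrict K) := by
  have hsm : ∀ f : L1loc μ, AEStronglyMeasurable (f : X →ₘ[μ] ℂ) (μ.restrict K) := fun f =>
    (AEEqFun.aestronglyMeasurable _).restrict
  refine (Finset.le_sum_of_subadditive
    (fun f : L1loc μ => eLpNorm (f : X →ₘ[μ] ℂ) p (μ.restrict K)) ?_ (fun f g => ?_) _ _).trans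
    (Finset.sum_le_sum fun i _ => ?_)
  · have : ((0 : L1loc μ) : X →ₘ[μ] ℂ) =ᵐ[μ.restrict K] (0 : X → ℂ) :=
      ae_restrict_of_ae AEEqFun.coeFn_zero
    rw [eLpNorm_congr_ae this, eLpNorm_zero]
  · rw [Submodule.coe_add,
      eLpNorm_congr_ae (ae_restrict_of_ae (AEEqFun.coeFn_add (f : X →ₘ[μ] ℂ) (g : X →ₘ[μ] ℂ)))]
    exact eLpNorm_add_le (hsm f) (hsm g) hp
  · rw [Submodule.coe_smul,
      eLpNorm_congr_ae (ae_restrict_of_ae (AEEqFun.coeFn_smul (c i) (g i : X →ₘ[μ] ℂ))),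
      eLpNorm_const_smul]

end LinearCombinations

/-- Admissible growth survives finite sums with bounded coefficients: the exponents are dominated by
the sum `D` of their moduli, and the total coefficient `Q` is absorbed into the exponent. -/
theorem exists_sum_mul_le_exp {ι : Type*} [Fintype ι] {γ : ℝ} {S : Set ℂ} {N : ι → ℂ → ℝ≥0∞}
    {R : ι → ℝ≥0∞} (hγ : 0 ≤ γ) (hR : ∀ i, R i ≠ ∞) (hN : ∀ i, ∃ C : ℝ, ∀ z ∈ S,
      N i z ≤ ENNReal.ofReal (Real.exp (C * Real.exp (γ * |z.im|)))) :
    ∃ C : ℝ, 0 ≤ C ∧ ∀ z ∈ S,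
      ∑ i, R i * N i z ≤ ENNReal.ofReal (Real.exp (C * Real.exp (γ * |z.im|))) := by
  choose C hC using hN
  set D : ℝ := ∑ i, |C i|
  set Q : ℝ := ∑ i, (R i).toReal
  have hD : 0 ≤ D := Finset.sum_nonneg fun i _ => abs_nonneg _
  have hQ : 0 ≤ Q := Finset.sum_nonneg fun i _ => ENNReal.toReal_nonneg
  refine ⟨D + Q, by positivity, fun z hz => ?_⟩
  set E := Real.exp (γ * |z.im|)
  have hE : 1 ≤ E := Real.one_le_exp (by positivity)
  have hle : ∑ i, R i * N i z ≤ ENNReal.ofReal (Q * Real.exp (D * E)) := by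
    rw [Finset.sum_mul, ENNReal.ofReal_sum_of_nonneg fun i _ => by positivity]
    refine Finset.sum_le_sum fun i _ => ?_
    rw [ENNReal.ofReal_mul ENNReal.toReal_nonneg, ENNReal.ofReal_toReal (hR i)]
    refine mul_le_mul_right ((hC i z hz).trans (ENNReal.ofReal_le_ofReal ?_)) _
    have : C i ≤ D := (le_abs_self _).trans
      (Finset.single_le_sum (f := fun i => |C i|) (fun i _ => abs_nonneg _) (Finset.mem_univ i))
    gcongr
  refine hle.trans (ENNReal.ofReal_le_ofReal (le_exp_of_le_mul_exp hQ hE ?_))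
  gcongr
  linarith

section Interpolation

variable {m : ℕ} {X₀ : Type*} {X : Fin m → Type*}
  [MetricSpace X₀] [MeasurableSpace X₀] [∀ κ, MetricSpace (X κ)]

/-- An analytic family of admissible growth has exponential growth in `L¹` of compact sets. -/
theorem IsOfAdmissibleGrowth.exists_eLpNorm_one_le {μ₀ : Measure X₀}
    (hμ₀ : IsRegularMetricMeasure μ₀)
    {T : ℂ → MultilinearMap ℂ (fun κ => C_c(X κ, ℂ)) (L1loc μ₀)}
    (hT : IsOfAdmissibleGrowth μ₀ T) :
    ∃ γ : ℝ, 0 ≤ γ ∧ γ < Real.pi ∧ ∀ (φ : ∀ κ, C_c(X κ, ℂ)) (K : Set X₀), IsCompact K →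
      ∃ C : ℝ, ∀ z ∈ closedStrip, eLpNorm (T z φ : X₀ →ₘ[μ₀] ℂ) 1 (μ₀.restrict K) ≤
        ENNReal.ofReal (Real.exp (C * Real.exp (γ * |z.im|))) := by
  obtain ⟨γ, hγ0, hγ, s, hs, h⟩ := hT
  refine ⟨γ, hγ0, hγ, fun φ K hK => ?_⟩
  obtain ⟨C, hC⟩ := h φ K hK
  set e : ℝ := 1 / (1 : ℝ≥0∞).toReal - 1 / s.toReal
  have he : 0 ≤ e := by
    simp only [e, ENNReal.toReal_one, div_one, sub_nonneg]
    by_cases hst : s = ∞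
    · simp [hst]
    · rw [div_le_one (ENNReal.toReal_pos (zero_lt_one.trans_le hs).ne' hst)]
      simpa using ENNReal.toReal_mono hst hs
  have hfin : (μ₀.restrict K) univ ^ e ≠ ∞ := by
    refine ENNReal.rpow_ne_top_of_nonneg he ?_
    simpa using (hμ₀.measure_lt_top_of_isCompact hK).ne
  -- A sum with one term, used to absorb the Hölder constant of the passage from $L^s(K)$ to
  -- $L^1(K)$.
  obtain ⟨C', -, hC'⟩ := exists_sum_mul_le_exp (ι := Unit) (S := closedStrip) (R := fun _ =>
    (μ₀.restrict K) univ ^ e) (N := fun _ z => eLpNorm (T z φ : X₀ →ₘ[μ₀] ℂ) s (μ₀.restrict K)) hγ0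
    (fun _ => hfin) fun _ => ⟨C, fun z hz => by
      rw [← EReal.exp_coe, ← ENNReal.exp_log (eLpNorm _ _ _)]
      exact EReal.exp_le_exp_iff.2 (hC z hz)⟩
  refine ⟨C', fun z hz => ?_⟩
  refine le_trans ?_ (hC' z hz)
  rw [Fintype.sum_unique, mul_comm]
  exact eLpNorm_le_eLpNorm_mul_rpow_measure_univ hs
    (AEEqFun.aestronglyMeasurable _).restrict

end Interpolation

/-! ### Exponents, and assembly of the theorem. -/

/-- The exponents of the analytic deformations used to interpolate between `L^{p₀}` and
`L^{p₁}`. -/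
theorem interpolation_exponents {p₀ p₁ p : ℝ≥0∞} {θ : ℝ} (hp₀ : p₀ ≠ 0) (hp₁ : p₁ ≠ 0)
    (h0 : 0 < θ) (h1 : θ < 1)
    (hp : 1 / p = ENNReal.ofReal (1 - θ) / p₀ + ENNReal.ofReal θ / p₁) :
    p ≠ 0 ∧ (p = ∞ → p₀ = ∞) ∧ (p = ∞ → p₁ = ∞) ∧
      (1 - θ) * (if p = ∞ then 1 else (p / p₀).toReal) +
        θ * (if p = ∞ then 1 else (p / p₁).toReal) = 1 := by
  have h0' : 0 < 1 - θ := by linarith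
  have hpne : p ≠ 0 := by
    rintro rfl
    have : ENNReal.ofReal (1 - θ) / p₀ + ENNReal.ofReal θ / p₁ ≠ ∞ :=
      ENNReal.add_ne_top.2 ⟨ENNReal.div_ne_top ENNReal.ofReal_ne_top hp₀,
        ENNReal.div_ne_top ENNReal.ofReal_ne_top hp₁⟩
    rw [← hp] at this
    simp at this
  have htop : p = ∞ → p₀ = ∞ ∧ p₁ = ∞ := by
    rintro rfl
    rw [ENNReal.div_top, eq_comm, add_eq_zero, ENNReal.div_eq_zero_iff, ENNReal.div_eq_zero_iff] at hp
    simpa [h0.not_ge, h1.not_ge] using hp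
  refine ⟨hpne, fun h => (htop h).1, fun h => (htop h).2, ?_⟩
  -- If `p = ∞`, all three exponents are infinite and the quotients would be `∞ / ∞ = 0`, so the
  -- exponent is set to $1$. Otherwise the claim is the relation `hp` multiplied by `p`.
  split_ifs with hpt
  · ring
  have h := congrArg (fun t => (p * t).toReal) hp
  have e1 : p * (1 / p) = 1 := by rw [one_div, ENNReal.mul_inv_cancel hpne hpt]
  have e2 : ∀ {a : ℝ} {r : ℝ≥0∞}, 0 ≤ a → (p * (ENNReal.ofReal a / r)).toReal =
      a * (p / r).toReal := by
    intro a r ha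
    rw [ENNReal.toReal_mul, ENNReal.toReal_div, ENNReal.toReal_div, ENNReal.toReal_ofReal ha]
    ring
  simp only [e1, mul_add] at h
  rw [ENNReal.toReal_add (ENNReal.mul_ne_top hpt (ENNReal.div_ne_top ENNReal.ofReal_ne_top hp₀))
    (ENNReal.mul_ne_top hpt (ENNReal.div_ne_top ENNReal.ofReal_ne_top hp₁)), e2 h0'.le, e2 h0.le,
    ENNReal.toReal_one] at h
  exact h.symm

section Interpolation

variable {m : ℕ} {X₀ : Type*} {X : Fin m → Type*}
  [MetricSpace X₀] [MeasurableSpace X₀] [∀ κ, MetricSpace (X κ)] [∀ κ, MeasurableSpace (X κ)]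

/-- A multilinear map at finite sums with scalar coefficients. -/
theorem MultilinearMap.map_sum_smul {R ι N : Type*} {M : ι → Type*} [CommSemiring R] [Fintype ι]
    [DecidableEq ι] [∀ i, AddCommMonoid (M i)] [AddCommMonoid N] [∀ i, Module R (M i)] [Module R N]
    (f : MultilinearMap R M N) {α : ι → Type*} [∀ i, Fintype (α i)] (a : ∀ i, α i → R)
    (φ : ∀ i, α i → M i) :
    f (fun i => ∑ j, a i j • φ i j) =
      ∑ r : ∀ i, α i, (∏ i, a i (r i)) • f fun i => φ i (r i) := by
  rw [f.map_sum]
  exact Finset.sum_congr rfl fun r _ => f.map_smul_univ _ _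

theorem eLpNorm_le_of_deformationBound {μ₀ : Measure X₀} {μ : ∀ κ, Measure (X κ)}
    {S : MultilinearMap ℂ (fun κ => C_c(X κ, ℂ)) (L1loc μ₀)} {p : Fin m → ℝ≥0∞} {q : ℝ≥0∞}
    {B A M : ℝ} (hB : 0 ≤ B) (hA : 0 ≤ A)
    (h : ∀ f : ∀ κ, C_c(X κ, ℂ), eLpNorm (S f : X₀ →ₘ[μ₀] ℂ) q μ₀ ≤
      ENNReal.ofReal (B * M) * ∏ κ, eLpNorm (f κ) (p κ) (μ κ))
    {f g : ∀ κ, C_c(X κ, ℂ)} {β : Fin m → ℝ} {ε : ℝ}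
    (hg : ∀ κ x, ‖g κ x‖ ≤ deformationBound (f κ) (β κ) ε x)
    (hAB : ENNReal.ofReal B * ∏ κ, eLpNorm (deformationBound (f κ) (β κ) ε) (p κ) (μ κ) ≤
      ENNReal.ofReal A) (K : Set X₀) :
    eLpNorm (S g : X₀ →ₘ[μ₀] ℂ) q (μ₀.restrict K) ≤ ENNReal.ofReal (A * M) := by
  calc eLpNorm (S g : X₀ →ₘ[μ₀] ℂ) q (μ₀.restrict K)
      ≤ eLpNorm (S g : X₀ →ₘ[μ₀] ℂ) q μ₀ := eLpNorm_restrict_le _ _ _ _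
    _ ≤ ENNReal.ofReal (B * M) * ∏ κ, eLpNorm (g κ) (p κ) (μ κ) := h g
    _ ≤ ENNReal.ofReal (B * M) *
          ∏ κ, eLpNorm (deformationBound (f κ) (β κ) ε) (p κ) (μ κ) := by
        gcongr with κ
        exact eLpNorm_mono_real (hg κ)
    _ = ENNReal.ofReal B * (∏ κ, eLpNorm (deformationBound (f κ) (β κ) ε) (p κ) (μ κ)) *
          ENNReal.ofReal M := by
        rw [ENNReal.ofReal_mul hB]; ring
    _ ≤ ENNReal.ofReal A * ENNReal.ofReal M := by gcongr
    _ = ENNReal.ofReal (A * M) := (ENNReal.ofReal_mul hA).symm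

/-- Interpolation with constants which bound the norms of the analytic deformations of the
arguments. -/
theorem eLpNorm_le_mul_stripMean [OpensMeasurableSpace X₀] {μ₀ : Measure X₀} {μ : ∀ κ, Measure (X κ)}
    (hμ₀ : IsRegularMetricMeasure μ₀)
    {T : ℂ → MultilinearMap ℂ (fun κ => C_c(X κ, ℂ)) (L1loc μ₀)}
    (hT : IsAnalyticFamily μ₀ T) (hT' : IsOfAdmissibleGrowth μ₀ T)
    {p₀ p₁ : Fin m → ℝ≥0∞} {q₀ q₁ q : ℝ≥0∞} {θ : ℝ} (hq₀ : q₀ ≠ 0) (hq₁ : q₁ ≠ 0)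
    (hθ₀ : 0 < θ) (hθ₁ : θ < 1)
    (hq : 1 / q = ENNReal.ofReal (1 - θ) / q₀ + ENNReal.ofReal θ / q₁)
    {B₀ B₁ : ℝ} (hB₀ : 0 ≤ B₀) (hB₁ : 0 ≤ B₁) {M₀ M₁ : ℝ → ℝ}
    (hM₀m : Measurable M₀) (hM₁m : Measurable M₁) (hM₀ : ∀ y, 0 ≤ M₀ y) (hM₁ : ∀ y, 0 ≤ M₁ y)
    {c τ : ℝ} (hc : 0 ≤ c) (hτ : τ < Real.pi)
    (hM₀c : ∀ y, M₀ y ≤ Real.exp (c * Real.exp (τ * |y|)))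
    (hM₁c : ∀ y, M₁ y ≤ Real.exp (c * Real.exp (τ * |y|)))
    (h₀ : ∀ (f : ∀ κ, C_c(X κ, ℂ)) (y : ℝ),
      eLpNorm (T ((y : ℂ) * Complex.I) f : X₀ →ₘ[μ₀] ℂ) q₀ μ₀ ≤
        ENNReal.ofReal (B₀ * M₀ y) * ∏ κ, eLpNorm (f κ) (p₀ κ) (μ κ))
    (h₁ : ∀ (f : ∀ κ, C_c(X κ, ℂ)) (y : ℝ),
      eLpNorm (T (1 + (y : ℂ) * Complex.I) f : X₀ →ₘ[μ₀] ℂ) q₁ μ₀ ≤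
        ENNReal.ofReal (B₁ * M₁ y) * ∏ κ, eLpNorm (f κ) (p₁ κ) (μ κ))
    {α₀ α₁ : Fin m → ℝ} (hα₀ : ∀ κ, 0 ≤ α₀ κ) (hα₁ : ∀ κ, 0 ≤ α₁ κ)
    (hα : ∀ κ, (1 - θ) * α₀ κ + θ * α₁ κ = 1) (f : ∀ κ, C_c(X κ, ℂ)) {ε : ℝ} (hε : 0 < ε)
    {A₀ A₁ : ℝ} (hA₀ : 0 < A₀) (hA₁ : 0 < A₁)
    (hAB₀ : ENNReal.ofReal B₀ * ∏ κ, eLpNorm (deformationBound (f κ) (α₀ κ) ε) (p₀ κ) (μ κ) ≤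
      ENNReal.ofReal A₀)
    (hAB₁ : ENNReal.ofReal B₁ * ∏ κ, eLpNorm (deformationBound (f κ) (α₁ κ) ε) (p₁ κ) (μ κ) ≤
      ENNReal.ofReal A₁) :
    eLpNorm (T (θ : ℂ) f : X₀ →ₘ[μ₀] ℂ) q μ₀ ≤
      ENNReal.ofReal A₀ ^ (1 - θ) * ENNReal.ofReal A₁ ^ θ * stripMean M₀ M₁ θ := by
  have h0' : 0 < 1 - θ := by linarith
  have h1' : 1 - θ < 1 := by linarith
  choose n φ a ha haR haf hab using fun κ =>
    exists_analytic_deformation (f κ) (hα₀ κ) (hα₁ κ) (hα κ) hε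
  obtain ⟨γ, hγ0, hγ, hgrowth⟩ := hT'.exists_eLpNorm_one_le hμ₀
  -- The family of functions to be interpolated is $G_z=T_z(f_z)$, with $f_z$ the deformed
  -- arguments; its value at `θ` is $T_\theta f$.
  set g : ℂ → ∀ κ, C_c(X κ, ℂ) := fun z κ => ∑ j, a κ j z • φ κ j with hg
  set G : ℂ → X₀ → ℂ := fun z => (T z (g z) : X₀ →ₘ[μ₀] ℂ) with hGdef
  have hGsum : ∀ z, G z = ((∑ r : ∀ κ, Fin (n κ), (∏ κ, a κ (r κ) z) •
      T z (fun κ => φ κ (r κ)) : L1loc μ₀) : X₀ →ₘ[μ₀] ℂ) := fun z => by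
    simp only [hGdef, hg]
    rw [(T z).map_sum_smul (fun κ j => a κ j z)]
  have hGw : IsWeaklyAnalytic μ₀ G := by
    rw [funext hGsum]
    exact isWeaklyAnalytic_sum
      (c := fun (r : ∀ κ, Fin (n κ)) z => ∏ κ, a κ (r κ) z)
      (g := fun r z => T z fun κ => φ κ (r κ))
      (fun r => by
        have := fun κ => ha κ (r κ)
        fun_prop) fun r => hT _
  have hgθ : g θ = f := funext haf
  choose R hR using haR
  have hlim := (stripMean_lt_top_and_tendsto hθ₀ hθ₁ hM₀m hM₁m hc hτ hM₀c hM₁c).2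
  have hmain : ∀ k : ℕ, eLpNorm (T (θ : ℂ) f : X₀ →ₘ[μ₀] ℂ) q μ₀ ≤
      ENNReal.ofReal A₀ ^ (1 - θ) * ENNReal.ofReal A₁ ^ θ * ENNReal.ofReal (Real.exp
      ((∫ y, stripKernel (1 - θ) y * Real.log (max (M₀ y) (1 / ((k : ℝ) + 1)))) +
        ∫ y, stripKernel θ y * Real.log (max (M₁ y) (1 / ((k : ℝ) + 1))))) := by
    intro k
    set η : ℝ := 1 / ((k : ℝ) + 1)
    have hη : 0 < η := Nat.one_div_pos_of_nat
    refine hμ₀.eLpNorm_le_of_forall_isCompact (AEEqFun.aestronglyMeasurable _) fun K hK => ?_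
    obtain ⟨C, hC0, hC⟩ := exists_sum_mul_le_exp (S := closedStrip)
      (N := fun (r : ∀ κ, Fin (n κ)) z =>
        eLpNorm (T z (fun κ => φ κ (r κ)) : X₀ →ₘ[μ₀] ℂ) 1 (μ₀.restrict K))
      (R := fun r => ENNReal.ofReal (∏ κ, R κ (r κ))) hγ0 (fun _ => ENNReal.ofReal_ne_top)
      fun r => hgrowth _ K hK
    -- The pair `D`, `σ` serves both for the $L^1(K)$ growth of `G` and for the boundary functions
    -- $A_jM_j$, where the factor $A_j\le1+A_j$ goes into the exponent.
    set D := max C (c + A₀ + A₁)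
    set σ := max γ τ
    have hσ : 0 ≤ σ := le_max_of_le_left hγ0
    have hD : 0 ≤ D := le_max_of_le_left hC0
    have hN : ∀ {A : ℝ} {M : ℝ → ℝ}, 0 < A → A ≤ A₀ + A₁ → (∀ y, 0 ≤ M y) →
        (∀ y, M y ≤ Real.exp (c * Real.exp (τ * |y|))) →
        ∀ y, A * M y ≤ Real.exp (D * Real.exp (σ * |y|)) := by
      intro A M hA hAA hM hMc y
      have hE : 1 ≤ Real.exp (σ * |y|) := Real.one_le_exp (by positivity)
      have hDA : c + A ≤ D := le_max_of_le_right (by linarith)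
      refine (le_exp_of_le_mul_exp (C := c) hA.le hE ?_).trans
        (Real.exp_le_exp.2 (mul_le_mul_of_nonneg_right hDA (by positivity)))
      refine mul_le_mul (by linarith) ((hMc y).trans (Real.exp_le_exp.2 ?_)) (hM y) (by positivity)
      gcongr
      exact le_max_right _ _
    -- Taking the floor to be `A * η` lets `A` leave the maximum. As the kernel at `x` has mass `x`,
    -- it contributes the factor $A^x$, which is the source of $A_0^{1-\theta}A_1^{\theta}$.
    have hlog : ∀ {A x : ℝ} {M : ℝ → ℝ}, 0 < A → 0 < x → x < 1 → Measurable M →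
        (∀ y, M y ≤ Real.exp (c * Real.exp (τ * |y|))) →
        ∫ y, stripKernel x y * Real.log (max (A * M y) (A * η)) =
          x * Real.log A + ∫ y, stripKernel x y * Real.log (max (M y) η) := by
      intro A x M hA hx0 hx1 hM hMc
      have : ∀ y, stripKernel x y * Real.log (max (A * M y) (A * η)) =
          stripKernel x y * Real.log A + stripKernel x y * Real.log (max (M y) η) := fun y => by
        rw [← mul_max_of_nonneg _ _ hA.le,
          Real.log_mul hA.ne' (lt_max_of_lt_right hη).ne', mul_add]
      simp only [this]
      rw [integral_add ((integrable_stripKernel hx0 hx1).mul_const _)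
        (integrable_stripKernel_mul_log_max_of_growth hx0 hx1 hη hτ hc hM hMc),
        integral_mul_const, integral_stripKernel hx0 hx1]
    have key := hGw.eLpNorm_restrict_le hμ₀ hK hD hσ (max_lt hγ hτ)
      (fun z => L1loc.integrableOn _ hK) (fun z hz => ?_) hθ₀ hθ₁ hq₀ hq₁ hq
      (hM₀m.const_mul A₀) (hM₁m.const_mul A₁) (fun y => mul_nonneg hA₀.le (hM₀ y))
      (fun y => mul_nonneg hA₁.le (hM₁ y)) (hN hA₀ (by linarith) hM₀ hM₀c)
      (hN hA₁ (by linarith) hM₁ hM₁c)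
      (fun y => eLpNorm_le_of_deformationBound hB₀ hA₀.le (fun f => h₀ f y)
        (fun κ x => (hab κ _ (mul_I_mem_closedStrip y) x).trans_eq (by simp)) hAB₀ K)
      (fun y => eLpNorm_le_of_deformationBound hB₁ hA₁.le (fun f => h₁ f y)
        (fun κ x => (hab κ _ (one_add_mul_I_mem_closedStrip y) x).trans_eq (by simp)) hAB₁ K)
      (mul_pos hA₀ hη) (mul_pos hA₁ hη)
    · rw [hlog hA₀ h0' h1' hM₀m hM₀c, hlog hA₁ hθ₀ hθ₁ hM₁m hM₁c] at key
      simp only [hGdef, hgθ] at key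
      refine key.trans_eq ?_
      rw [ENNReal.ofReal_rpow_of_pos hA₀, ENNReal.ofReal_rpow_of_pos hA₁,
        Real.rpow_def_of_pos hA₀, Real.rpow_def_of_pos hA₁,
        ← ENNReal.ofReal_mul (by positivity), ← ENNReal.ofReal_mul (by positivity),
        ← Real.exp_add, ← Real.exp_add]
      congr 2
      ring
    · rw [hGsum]
      refine (eLpNorm_sum_smul_le _ _ K le_rfl).trans (le_trans (Finset.sum_le_sum fun r _ => ?_)
        ((hC z hz).trans (ENNReal.ofReal_le_ofReal (Real.exp_le_exp.2 ?_))))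
      · gcongr
        rw [← ofReal_norm, norm_prod]
        exact ENNReal.ofReal_le_ofReal (Finset.prod_le_prod (fun _ _ => norm_nonneg _)
          fun κ _ => hR κ (r κ) z hz)
      · have h1 : C ≤ D := le_max_left _ _
        have h2 : γ ≤ σ := le_max_left _ _
        gcongr
  refine ge_of_tendsto' (ENNReal.Tendsto.const_mul hlim (Or.inr ?_)) hmain
  exact ENNReal.mul_ne_top (ENNReal.rpow_ne_top_of_nonneg h0'.le ENNReal.ofReal_ne_top)
    (ENNReal.rpow_ne_top_of_nonneg hθ₀.le ENNReal.ofReal_ne_top)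

end Interpolation

theorem mainTheorem1 {m : ℕ} {X₀ : Type*} {X : Fin m → Type*}
    [MetricSpace X₀] [MeasurableSpace X₀] [OpensMeasurableSpace X₀]
    [∀ κ, MetricSpace (X κ)] [∀ κ, MeasurableSpace (X κ)] [∀ κ, OpensMeasurableSpace (X κ)]
    (μ₀ : Measure X₀) (μ : ∀ κ, Measure (X κ))
    (hμ₀ : IsRegularMetricMeasure μ₀) (hμ : ∀ κ, IsRegularMetricMeasure (μ κ))
    (T : ℂ → MultilinearMap ℂ (fun κ => C_c(X κ, ℂ)) (L1loc μ₀))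
    (hT : IsAnalyticFamily μ₀ T) (hT' : IsOfAdmissibleGrowth μ₀ T)
    (p₀ p₁ p : Fin m → ℝ≥0∞) (q₀ q₁ q : ℝ≥0∞) (θ : ℝ)
    (hp₀ : ∀ κ, 0 < p₀ κ) (hp₁ : ∀ κ, 0 < p₁ κ) (hq₀ : 0 < q₀) (hq₁ : 0 < q₁)
    (hθ₀ : 0 < θ) (hθ₁ : θ < 1)
    (hp : ∀ κ, 1 / p κ = ENNReal.ofReal (1 - θ) / p₀ κ + ENNReal.ofReal θ / p₁ κ)
    (hq : 1 / q = ENNReal.ofReal (1 - θ) / q₀ + ENNReal.ofReal θ / q₁)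
    (B₀ B₁ : ℝ) (hB₀ : 0 < B₀) (hB₁ : 0 < B₁)
    (M₀ M₁ : ℝ → ℝ) (hM₀c : Continuous M₀) (hM₁c : Continuous M₁)
    (hM₀ : ∀ y, 0 ≤ M₀ y) (hM₁ : ∀ y, 0 ≤ M₁ y)
    (hM : ∃ c τ : ℝ, 0 ≤ c ∧ 0 ≤ τ ∧ τ < Real.pi ∧ ∀ y : ℝ,
      M₀ y ≤ Real.exp (c * Real.exp (τ * |y|)) ∧ M₁ y ≤ Real.exp (c * Real.exp (τ * |y|)))
    (h₀ : ∀ (f : ∀ κ, C_c(X κ, ℂ)) (y : ℝ),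
      eLpNorm (T ((y : ℂ) * Complex.I) f : X₀ →ₘ[μ₀] ℂ) q₀ μ₀ ≤
        ENNReal.ofReal (B₀ * M₀ y) * ∏ κ, eLpNorm (f κ) (p₀ κ) (μ κ))
    (h₁ : ∀ (f : ∀ κ, C_c(X κ, ℂ)) (y : ℝ),
      eLpNorm (T (1 + (y : ℂ) * Complex.I) f : X₀ →ₘ[μ₀] ℂ) q₁ μ₀ ≤
        ENNReal.ofReal (B₁ * M₁ y) * ∏ κ, eLpNorm (f κ) (p₁ κ) (μ κ)) :
    stripMean M₀ M₁ θ < ∞ ∧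
    ∀ f : ∀ κ, C_c(X κ, ℂ),
      eLpNorm (T (θ : ℂ) f : X₀ →ₘ[μ₀] ℂ) q μ₀ ≤
        ENNReal.ofReal (B₀ ^ (1 - θ) * B₁ ^ θ) * stripMean M₀ M₁ θ *
          ∏ κ, eLpNorm (f κ) (p κ) (μ κ) := by
  obtain ⟨c, τ, hc, -, hτ, hMc⟩ := hM
  have hlt := (stripMean_lt_top_and_tendsto hθ₀ hθ₁ hM₀c.measurable hM₁c.measurable hc hτ
    (fun y => (hMc y).1) fun y => (hMc y).2).1
  refine ⟨hlt, fun f => ?_⟩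
  have h0' : 0 ≤ 1 - θ := by linarith
  have hexp := fun κ => interpolation_exponents (hp₀ κ).ne' (hp₁ κ).ne' hθ₀ hθ₁ (hp κ)
  set α₀ : Fin m → ℝ := fun κ => if p κ = ∞ then 1 else (p κ / p₀ κ).toReal with hα₀
  set α₁ : Fin m → ℝ := fun κ => if p κ = ∞ then 1 else (p κ / p₁ κ).toReal with hα₁
  have hα₀0 : ∀ κ, 0 ≤ α₀ κ := fun κ => by
    simp only [hα₀]; split_ifs <;> positivity
  have hα₁0 : ∀ κ, 0 ≤ α₁ κ := fun κ => by
    simp only [hα₁]; split_ifs <;> positivity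
  have hε0 : ∀ n : ℕ, 0 < 1 / ((n : ℝ) + 1) := fun n => Nat.one_div_pos_of_nat
  have hε1 : ∀ n : ℕ, 1 / ((n : ℝ) + 1) ≤ 1 := fun n => by
    rw [div_le_one (by positivity)]; linarith [n.cast_nonneg (α := ℝ)]
  choose U₀ hU₀ hU₀lim using fun κ => exists_tendsto_of_eLpNorm_deformationBound_le (hμ κ) (f κ)
    (hp₀ κ).ne' (hexp κ).1 (hexp κ).2.1 (β := α₀ κ) rfl hε0 hε1
    tendsto_one_div_add_atTop_nhds_zero_nat
  choose U₁ hU₁ hU₁lim using fun κ => exists_tendsto_of_eLpNorm_deformationBound_le (hμ κ) (f κ)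
    (hp₁ κ).ne' (hexp κ).1 (hexp κ).2.2.1 (β := α₁ κ) rfl hε0 hε1
    tendsto_one_div_add_atTop_nhds_zero_nat
  have hNt : ∀ κ, eLpNorm (f κ) (p κ) (μ κ) ≠ ∞ := fun κ => by
    have : IsFiniteMeasureOnCompacts (μ κ) :=
      ⟨fun _ hK => (hμ κ).measure_lt_top_of_isCompact hK⟩
    exact ((f κ).continuous.memLp_of_hasCompactSupport (f κ).hasCompactSupport).eLpNorm_ne_top
  -- The added $1/(n+1)$ keeps the constants positive, as `eLpNorm_le_mul_stripMean` requires, even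
  -- when some `f κ` vanishes. Finiteness of the norms gives continuity of the product.
  have hlim : ∀ {B : ℝ} {U : Fin m → ℕ → ℝ≥0∞} {α : Fin m → ℝ}, (∀ κ, 0 ≤ α κ) →
      (∀ κ, Filter.Tendsto (U κ) Filter.atTop (nhds (eLpNorm (f κ) (p κ) (μ κ) ^ α κ))) →
      ENNReal.ofReal B * ∏ κ, eLpNorm (f κ) (p κ) (μ κ) ^ α κ ≠ ∞ ∧
      Filter.Tendsto (fun n : ℕ => ENNReal.ofReal B * ∏ κ, U κ n +
        ENNReal.ofReal (1 / ((n : ℝ) + 1))) Filter.atTop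
        (nhds (ENNReal.ofReal B * ∏ κ, eLpNorm (f κ) (p κ) (μ κ) ^ α κ)) := by
    intro B U α hα hU
    have ht : ∏ κ, eLpNorm (f κ) (p κ) (μ κ) ^ α κ ≠ ∞ :=
      ENNReal.prod_ne_top fun κ _ => ENNReal.rpow_ne_top_of_nonneg (hα κ) (hNt κ)
    have hprod : Filter.Tendsto (fun n => ∏ κ, U κ n) Filter.atTop
        (nhds (∏ κ, eLpNorm (f κ) (p κ) (μ κ) ^ α κ)) :=
      ENNReal.tendsto_finsetProd_of_ne_top _ (fun κ _ => hU κ)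
        fun κ _ => ENNReal.rpow_ne_top_of_nonneg (hα κ) (hNt κ)
    refine ⟨ENNReal.mul_ne_top ENNReal.ofReal_ne_top ht, ?_⟩
    simpa using (ENNReal.Tendsto.const_mul hprod (Or.inr ENNReal.ofReal_ne_top)).add
      (ENNReal.tendsto_ofReal tendsto_one_div_add_atTop_nhds_zero_nat)
  obtain ⟨hW₀t, hW₀⟩ := hlim (B := B₀) hα₀0 hU₀lim
  obtain ⟨hW₁t, hW₁⟩ := hlim (B := B₁) hα₁0 hU₁lim
  have hbound : ∀ᶠ n : ℕ in Filter.atTop, eLpNorm (T (θ : ℂ) f : X₀ →ₘ[μ₀] ℂ) q μ₀ ≤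
      (ENNReal.ofReal B₀ * ∏ κ, U₀ κ n + ENNReal.ofReal (1 / ((n : ℝ) + 1))) ^ (1 - θ) *
        (ENNReal.ofReal B₁ * ∏ κ, U₁ κ n + ENNReal.ofReal (1 / ((n : ℝ) + 1))) ^ θ *
          stripMean M₀ M₁ θ := by
    filter_upwards [hW₀.eventually_lt_const hW₀t.lt_top, hW₁.eventually_lt_const hW₁t.lt_top]
      with n hn₀ hn₁
    have hpos : ∀ t : ℝ≥0∞, t + ENNReal.ofReal (1 / ((n : ℝ) + 1)) ≠ 0 := fun t h =>
      (ENNReal.ofReal_pos.2 (hε0 n)).ne' (add_eq_zero.1 h).2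
    rw [← ENNReal.ofReal_toReal hn₀.ne, ← ENNReal.ofReal_toReal hn₁.ne]
    refine eLpNorm_le_mul_stripMean hμ₀ hT hT' hq₀.ne' hq₁.ne' hθ₀ hθ₁ hq hB₀.le hB₁.le
      hM₀c.measurable hM₁c.measurable hM₀ hM₁ hc hτ (fun y => (hMc y).1) (fun y => (hMc y).2)
      h₀ h₁ hα₀0 hα₁0 (fun κ => (hexp κ).2.2.2) f (hε0 n)
      (ENNReal.toReal_pos (hpos _) hn₀.ne) (ENNReal.toReal_pos (hpos _) hn₁.ne)
      ?_ ?_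
    · rw [ENNReal.ofReal_toReal hn₀.ne]
      refine le_add_right ?_
      gcongr with κ
      exact hU₀ κ n
    · rw [ENNReal.ofReal_toReal hn₁.ne]
      refine le_add_right ?_
      gcongr with κ
      exact hU₁ κ n
  refine (ge_of_tendsto (ENNReal.Tendsto.mul_const (ENNReal.Tendsto.mul (hW₀.ennrpow_const (1 - θ))
    (Or.inr (ENNReal.rpow_ne_top_of_nonneg hθ₀.le hW₁t)) (hW₁.ennrpow_const θ)
    (Or.inr (ENNReal.rpow_ne_top_of_nonneg h0' hW₀t))) (Or.inr hlt.ne)) hbound).trans_eq ?_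
  -- The powers recombine because $(1-\theta)\alpha_0+\theta\alpha_1=1$; the exponents being
  -- nonnegative, this holds for a vanishing norm as well.
  have hN : (∏ κ, eLpNorm (f κ) (p κ) (μ κ) ^ α₀ κ) ^ (1 - θ) *
      (∏ κ, eLpNorm (f κ) (p κ) (μ κ) ^ α₁ κ) ^ θ = ∏ κ, eLpNorm (f κ) (p κ) (μ κ) := by
    rw [← ENNReal.prod_rpow_of_nonneg h0', ← ENNReal.prod_rpow_of_nonneg hθ₀.le,
      ← Finset.prod_mul_distrib]
    refine Finset.prod_congr rfl fun κ _ => ?_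
    rw [← ENNReal.rpow_mul, ← ENNReal.rpow_mul, ← ENNReal.rpow_add_of_nonneg _ _
      (mul_nonneg (hα₀0 κ) h0') (mul_nonneg (hα₁0 κ) hθ₀.le), mul_comm, mul_comm (α₁ κ),
      (hexp κ).2.2.2, ENNReal.rpow_one]
  rw [ENNReal.mul_rpow_of_nonneg _ _ h0', ENNReal.mul_rpow_of_nonneg _ _ hθ₀.le, ← hN,
    ENNReal.ofReal_mul (by positivity), ENNReal.ofReal_rpow_of_pos hB₀,
    ENNReal.ofReal_rpow_of_pos hB₁]
  ring
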